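/- Let $M$ be a smooth (real, finite-dimensional) supermanifold with local coordinates $x^a$ of parity $\tilde a$, and let $\Delta$ be an odd differential operator of order $\le 2$ on $C^\infty(M)$ with $\Delta 1=0$; in local coordinates $$\Delta=\tfrac12 S^{ab}\partial_b\partial_a+T^a\partial_a,\qquad S^{ab}=(-1)^{\tilde a\tilde b}S^{ba}.$$ Let $S=\tfrac12 S^{ab}p_bp_a$ be its principal symbol, a function on $T^*M$, and let $\gamma=\gamma^ap_a$ with $\gamma^a=\partial_bS^{ba}-2T^a$ be its subprincipal symbol, a function on the cotangent bundle of each coordinate domain (the local connection form of an "upper connection" on volume forms). Let $(\ ,\ )$ be the canonical even Poisson bracket on $T^*M$, normalized by $(p_a,x^b)=\delta_a^b$, and put $D=(S,\ )$. For homogeneous functions let $$\{f,g\}=\Delta(fg)-(\Delta f)\,g-(-1)^{\tilde f}f\,(\Delta g)$$ be the odd symmetric bracket generated by $\Delta$. For a linear operator $L$ on $C^\infty(M)$, $\operatorname{ord}L\le N$ means that all $(N+1)$-fold supercommutators $[\dots[[L,f_0],f_1],\dots,f_N]$ with functions vanish. Let $\mathrm{Jacobi}_3$ be the condition that $$\{\{f,g\},h\}+(-1)^{\tilde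 g\tilde h}\{\{f,h\},g\}+(-1)^{\tilde f(\tilde g+\tilde h)}\{\{g,h\},f\}=0$$ for all homogeneous $f,g,h\in C^\infty(M)$, and let $\mathrm{Jacobi}_2$ be the condition that $\Delta$ is a derivation of the bracket, i.e. $$\Delta\{f,g\}=-\{\Delta f,g\}-(-1)^{\tilde f}\{f,\Delta g\}$$ for all homogeneous $f,g\in C^\infty(M)$. Theorem. (1) The conditions $\operatorname{ord}\Delta^2\le 2$, $\mathrm{Jacobi}_3$ and $(S,S)=0$ are equivalent, and when they hold, $D^2=0$. (2) The following are equivalent: $\operatorname{ord}\Delta^2\le 1$; $\mathrm{Jacobi}_3$ together with $\mathrm{Jacobi}_2$; $(S,S)=0$ together with $(S,\gamma)=0$ in every local coordinate system, i.e. $D\gamma=0$ (the upper connection $\gamma$ is flat). -/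

import Mathlib

open CategoryTheory TopologicalSpace Opposite
open scoped ContDiff

universe u

noncomputable section

namespace SuperGeom

/-! ### Signs and parities -/

/-- The sign `(-1)^i` of a parity `i`, as a real number. -/
def sgn (i : ZMod 2) : ℝ := if i = 0 then 1 else -1

/-- Parity of a coordinate: `inl` labels the even, `inr` the odd coordinates. -/
def par {ι κ : Type} : ι ⊕ κ → ZMod 2
  | Sum.inl _ => 0
  | Sum.inr _ => 1

/-! ### Superfunctions on a superdomain

`ι` labels the even coordinates and `κ` the odd ones. -/

/-- The Grassmann algebra on generators labelled by `κ`. -/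
abbrev Grassmann (κ : Type) : Type := ExteriorAlgebra ℝ (κ → ℝ)

instance instFiniteGrassmann (κ : Type) [Fintype κ] : Module.Finite ℝ (Grassmann κ) := by
  classical
  have htop : (⨆ n : ℕ, (⋀[ℝ]^n (κ → ℝ) : Submodule ℝ (Grassmann κ))) = ⊤ :=
    (DirectSum.Decomposition.isInternal
      (fun n : ℕ => (⋀[ℝ]^n (κ → ℝ) : Submodule ℝ (Grassmann κ)))).submodule_iSup_eq_top
  have hbot : ∀ n : ℕ, Fintype.card κ < n →
      (⋀[ℝ]^n (κ → ℝ) : Submodule ℝ (Grassmann κ)) = ⊥ := by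
    intro n hn
    rw [← Submodule.finrank_eq_zero (R := ℝ), exteriorPower.finrank_eq, Module.finrank_pi]
    exact Nat.choose_eq_zero_of_lt hn
  have hfg : (⨆ n ∈ Finset.range (Fintype.card κ + 1),
      (⋀[ℝ]^n (κ → ℝ) : Submodule ℝ (Grassmann κ))).FG :=
    Submodule.fg_biSup _ _ fun n _ => Module.Finite.iff_fg.1 inferInstance
  rw [Module.finite_def]
  refine (le_antisymm le_top ?_ : (⨆ n ∈ Finset.range (Fintype.card κ + 1),
      (⋀[ℝ]^n (κ → ℝ) : Submodule ℝ (Grassmann κ))) = ⊤) ▸ hfg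
  rw [← htop]
  refine iSup_le fun n => ?_
  by_cases hn : n ∈ Finset.range (Fintype.card κ + 1)
  · exact le_biSup (fun n : ℕ => (⋀[ℝ]^n (κ → ℝ) : Submodule ℝ (Grassmann κ))) hn
  · rw [hbot n (by simpa using hn)]
    exact bot_le

/-- Smoothness of a map from an open set of `ℝ^ι` to the (finite-dimensional) Grassmann algebra:
all its components are `C^∞`. The values outside the open set (here `0`) are irrelevant. -/
def IsSmooth {ι κ : Type} [Fintype ι] (V : Opens (ι → ℝ)) (f : V → Grassmann κ) : Prop :=
  ∀ l : Module.Dual ℝ (Grassmann κ),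
    ContDiffOn ℝ ∞ (Function.extend Subtype.val (fun x => l (f x)) 0) (V : Set (ι → ℝ))

theorem extend_val {ι : Type} {V : Opens (ι → ℝ)} (u : V → ℝ) {x : ι → ℝ} (hx : x ∈ V) :
    Function.extend Subtype.val u 0 x = u ⟨x, hx⟩ :=
  Subtype.val_injective.extend_apply u 0 ⟨x, hx⟩

theorem IsSmooth.of_formula {ι κ : Type} [Fintype ι] {V : Opens (ι → ℝ)} {f : V → Grassmann κ}
    (h : ∀ l : Module.Dual ℝ (Grassmann κ), ∃ u : (ι → ℝ) → ℝ,
      ContDiffOn ℝ ∞ u (V : Set (ι → ℝ)) ∧ ∀ x : V, l (f x) = u x.1) : IsSmooth V f := by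
  intro l
  obtain ⟨u, hu, hf⟩ := h l
  refine hu.congr fun x hx => ?_
  rw [extend_val _ hx]
  exact hf ⟨x, hx⟩

theorem IsSmooth.const {ι κ : Type} [Fintype ι] {V : Opens (ι → ℝ)} (c : Grassmann κ) :
    IsSmooth V (fun _ => c) :=
  IsSmooth.of_formula fun l => ⟨fun _ => l c, contDiffOn_const, fun _ => rfl⟩

theorem IsSmooth.add {ι κ : Type} [Fintype ι] {V : Opens (ι → ℝ)} {f g : V → Grassmann κ}
    (hf : IsSmooth V f) (hg : IsSmooth V g) : IsSmooth V (f + g) :=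
  IsSmooth.of_formula fun l => ⟨_, (hf l).add (hg l), fun x => by
    simp⟩

theorem IsSmooth.linear {ι κ κ' : Type} [Fintype ι] {V : Opens (ι → ℝ)} {f : V → Grassmann κ}
    (hf : IsSmooth V f) (L : Grassmann κ →ₗ[ℝ] Grassmann κ') : IsSmooth V (fun x => L (f x)) :=
  fun l => hf (l.comp L)

theorem IsSmooth.sum_smul {ι κ α : Type} [Fintype ι] [Fintype α] {V : Opens (ι → ℝ)}
    (u : α → (ι → ℝ) → ℝ) (hu : ∀ k, ContDiffOn ℝ ∞ (u k) (V : Set (ι → ℝ)))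
    (c : α → Grassmann κ) : IsSmooth V (fun x => ∑ k, u k x.1 • c k) :=
  IsSmooth.of_formula fun l => ⟨fun x => ∑ k, u k x * l (c k),
    ContDiffOn.sum fun k _ => (hu k).mul contDiffOn_const, fun x => by simp⟩

theorem IsSmooth.mul {ι κ : Type} [Fintype ι] [Fintype κ] {V : Opens (ι → ℝ)}
    {f g : V → Grassmann κ} (hf : IsSmooth V f) (hg : IsSmooth V g) : IsSmooth V (f * g) := by
  have key := IsSmooth.sum_smul (V := V)
    (fun (k : Fin (Module.finrank ℝ (Grassmann κ)) × Fin (Module.finrank ℝ (Grassmann κ))) x =>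
      Function.extend Subtype.val
        (fun y => (Module.finBasis ℝ (Grassmann κ)).coord k.1 (f y)) 0 x *
      Function.extend Subtype.val
        (fun y => (Module.finBasis ℝ (Grassmann κ)).coord k.2 (g y)) 0 x)
    (fun k => (hf _).mul (hg _))
    (fun k => Module.finBasis ℝ (Grassmann κ) k.1 * Module.finBasis ℝ (Grassmann κ) k.2)
  convert key using 1
  funext x
  simp only [Pi.mul_apply, extend_val _ x.2, Subtype.coe_eta, Fintype.sum_prod_type,
    Module.Basis.coord_apply]
  conv_lhs => rw [← (Module.finBasis ℝ (Grassmann κ)).sum_repr (f x),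
    ← (Module.finBasis ℝ (Grassmann κ)).sum_repr (g x), Finset.sum_mul_sum]
  simp only [smul_mul_smul_comm]

/-- The superalgebra `C^∞(V) ⊗ Λ(ξ)` of smooth superfunctions on the superdomain with underlying
open set `V ⊆ ℝ^ι` and odd coordinates labelled by `κ`. -/
def SuperFun {ι : Type} (κ : Type) [Fintype ι] [Fintype κ] (V : Opens (ι → ℝ)) :
    Subalgebra ℝ (V → Grassmann κ) where
  carrier := {f | IsSmooth V f}
  mul_mem' := IsSmooth.mul
  add_mem' := IsSmooth.add
  algebraMap_mem' r := IsSmooth.const (algebraMap ℝ (Grassmann κ) r)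

namespace SuperFun

variable {ι κ : Type} [Fintype ι] [Fintype κ] {V : Opens (ι → ℝ)}

/-- Superfunctions of parity `i`. -/
def parity (V : Opens (ι → ℝ)) (i : ZMod 2) : Submodule ℝ (SuperFun κ V) where
  carrier := {f | ∀ x, f.1 x ∈ CliffordAlgebra.evenOdd (0 : QuadraticForm ℝ (κ → ℝ)) i}
  add_mem' := fun hf hg x => Submodule.add_mem _ (hf x) (hg x)
  zero_mem' := fun _ => Submodule.zero_mem _
  smul_mem' := fun c _ hf x => Submodule.smul_mem _ c (hf x)

/-- Restriction of superfunctions to a smaller open set. -/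
def restrict {W : Opens (ι → ℝ)} (h : V ≤ W) (f : SuperFun κ W) : SuperFun κ V :=
  ⟨fun x => f.1 ⟨x.1, h x.2⟩, IsSmooth.of_formula fun l => ⟨_, (f.2 l).mono h, fun x => by
    rw [extend_val _ (h x.2)]⟩⟩

/-- The parity involution `f ↦ (-1)^{f̃} f`. -/
def invol (f : SuperFun κ V) : SuperFun κ V :=
  ⟨fun x => CliffordAlgebra.involute (f.1 x), f.2.linear CliffordAlgebra.involute.toLinearMap⟩

/-- The partial derivative in the `i`-th even coordinate, computed componentwise. -/
def evenDeriv [DecidableEq ι] (i : ι) (f : SuperFun κ V) : SuperFun κ V :=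
  ⟨fun x => ∑ k, fderiv ℝ (Function.extend Subtype.val
        (fun y => (Module.finBasis ℝ (Grassmann κ)).coord k (f.1 y)) 0) x.1 (Pi.single i 1) •
          Module.finBasis ℝ (Grassmann κ) k,
    IsSmooth.sum_smul (V := V) (fun k x => fderiv ℝ (Function.extend Subtype.val
        (fun y => (Module.finBasis ℝ (Grassmann κ)).coord k (f.1 y)) 0) x (Pi.single i 1))
      (fun k => ((f.2 _).fderiv_of_isOpen V.isOpen (by simp)).clm_apply contDiffOn_const) _⟩

/-- The left partial derivative in the `j`-th odd coordinate: the antiderivation with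
`∂_j ξ^k = δ_j^k`. -/
def oddDeriv (j : κ) (f : SuperFun κ V) : SuperFun κ V :=
  ⟨fun x => CliffordAlgebra.contractLeft (LinearMap.proj (R := ℝ) (φ := fun _ : κ => ℝ) j) (f.1 x),
    f.2.linear (CliffordAlgebra.contractLeft (LinearMap.proj (R := ℝ) (φ := fun _ : κ => ℝ) j))⟩

/-- The left partial derivative `∂_a`. -/
def pd [DecidableEq ι] : ι ⊕ κ → SuperFun κ V → SuperFun κ V
  | Sum.inl i => evenDeriv i
  | Sum.inr j => oddDeriv j

/-- The coordinate function `x^a`. -/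
def coord [DecidableEq κ] (V : Opens (ι → ℝ)) : ι ⊕ κ → SuperFun κ V
  | Sum.inl i => ⟨fun x => algebraMap ℝ (Grassmann κ) (x.1 i), IsSmooth.of_formula fun l =>
      ⟨fun x => x i * l 1, (contDiff_apply ℝ ℝ i).contDiffOn.mul contDiffOn_const, fun x => by
        rw [Algebra.algebraMap_eq_smul_one, map_smul, smul_eq_mul]⟩⟩
  | Sum.inr j => ⟨fun _ => ExteriorAlgebra.ι ℝ (Pi.single j 1), IsSmooth.const _⟩

/-! ### The cotangent bundle of a superdomain

It is the superdomain `T^*V = V × ℝ^ι` with even coordinates `x^i, p_i` (labelled by the two copies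
of `ι` in `ι ⊕ ι`) and odd coordinates `ξ^j, π_j` (the two copies of `κ` in `κ ⊕ κ`): the momentum
`p_a` has the same parity as `x^a`. -/

/-- The underlying open set of the cotangent bundle. -/
def cot (V : Opens (ι → ℝ)) : Opens (ι ⊕ ι → ℝ) :=
  ⟨{z | z ∘ Sum.inl ∈ V}, V.isOpen.preimage (by fun_prop)⟩

/-- The label of `x^a` among the coordinates of the cotangent bundle. -/
def pos : ι ⊕ κ → (ι ⊕ ι) ⊕ (κ ⊕ κ) := Sum.map Sum.inl Sum.inl

/-- The label of the momentum `p_a` among the coordinates of the cotangent bundle. -/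
def mom : ι ⊕ κ → (ι ⊕ ι) ⊕ (κ ⊕ κ) := Sum.map Sum.inr Sum.inr

/-- The pullback of superfunctions along the projection `T^*V → V`. -/
def pull (f : SuperFun κ V) : SuperFun (κ ⊕ κ) (cot V) :=
  ⟨fun z => ExteriorAlgebra.map
      (LinearMap.pi (Sum.elim (fun j : κ => LinearMap.proj (R := ℝ) (φ := fun _ : κ => ℝ) j) 0))
      (f.1 ⟨z.1 ∘ Sum.inl, z.2⟩), by
    refine IsSmooth.linear (f := fun z : cot V => f.1 ⟨z.1 ∘ Sum.inl, z.2⟩) ?_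
      (ExteriorAlgebra.map _).toLinearMap
    refine IsSmooth.of_formula fun l => ⟨fun z => Function.extend Subtype.val
      (fun x => l (f.1 x)) 0 (z ∘ Sum.inl), (f.2 l).comp ?_ fun z hz => hz, fun z => ?_⟩
    · exact (contDiff_pi.2 fun i => contDiff_apply ℝ ℝ (Sum.inl i)).contDiffOn
    · exact (extend_val (fun x => l (f.1 x)) (x := z.1 ∘ Sum.inl) z.2).symm⟩

/-- `(-1)^{ãF̃} F`, extended linearly to inhomogeneous `F`. -/
def twist (a : ι ⊕ κ) (F : SuperFun (κ ⊕ κ) (cot V)) : SuperFun (κ ⊕ κ) (cot V) :=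
  if par a = 0 then F else invol F

/-- The canonical even Poisson bracket on the cotangent bundle, normalized by
`(p_a, x^b) = δ_a^b`. For homogeneous `F` it reads
`(F, G) = ∑_a ((-1)^{ã(F̃+1)} ∂F/∂p_a ∂G/∂x^a - (-1)^{ãF̃} ∂F/∂x^a ∂G/∂p_a)`. -/
def poisson [DecidableEq ι] (F G : SuperFun (κ ⊕ κ) (cot V)) : SuperFun (κ ⊕ κ) (cot V) :=
  ∑ a : ι ⊕ κ, (sgn (par a) • (pd (mom a) (twist a F) * pd (pos a) G)
    - pd (pos a) (twist a F) * pd (mom a) G)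

/-- The principal symbol `½ S^{ab} p_b p_a` of `½ S^{ab} ∂_b ∂_a + T^a ∂_a + R`. -/
def symbol [DecidableEq κ] (S : ι ⊕ κ → ι ⊕ κ → SuperFun κ V) : SuperFun (κ ⊕ κ) (cot V) :=
  (1 / 2 : ℝ) • ∑ a, ∑ b, pull (S a b) * coord (cot V) (mom b) * coord (cot V) (mom a)

/-- The subprincipal symbol `γ = γ^a p_a`, `γ^a = (-1)^{b̃(ε+1)} ∂_b S^{ba} - 2 T^a`, of an operator
`½ S^{ab} ∂_b ∂_a + T^a ∂_a + R` of parity `ε`. -/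
def subprincipal [DecidableEq ι] [DecidableEq κ] (ε : ZMod 2) (S : ι ⊕ κ → ι ⊕ κ → SuperFun κ V)
    (T : ι ⊕ κ → SuperFun κ V) : SuperFun (κ ⊕ κ) (cot V) :=
  ∑ a, pull (∑ b, sgn (par b * (ε + 1)) • pd b (S b a) - (2 : ℝ) • T a) * coord (cot V) (mom a)

end SuperFun

/-! ### Operators on a `ℤ/2`-graded algebra -/

section Algebraic

variable {A : Type*} [Ring A] [Algebra ℝ A] (𝒜 : ZMod 2 → Submodule ℝ A)

/-- A linear operator of parity `ε`. -/
def HasParity (ε : ZMod 2) (L : A →ₗ[ℝ] A) : Prop :=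
  ∀ i, ∀ f ∈ 𝒜 i, L f ∈ 𝒜 (i + ε)

/-- The supercommutator `[L, f]` of an operator `L` of parity `ε` with the multiplication by an
element `f` of parity `i`. -/
def commutator (ε i : ZMod 2) (L : A →ₗ[ℝ] A) (f : A) : A →ₗ[ℝ] A :=
  L ∘ₗ LinearMap.mulLeft ℝ f - sgn (ε * i) • LinearMap.mulLeft ℝ f ∘ₗ L

/-- `CommutatorsVanish 𝒜 n ε L`: all `n`-fold supercommutators `[…[[L, f₁], f₂], …, fₙ]` of the
operator `L` of parity `ε` with homogeneous elements vanish. -/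
def CommutatorsVanish : ℕ → ZMod 2 → (A →ₗ[ℝ] A) → Prop
  | 0, _, L => L = 0
  | n + 1, ε, L => ∀ i, ∀ f ∈ 𝒜 i, CommutatorsVanish n (ε + i) (commutator ε i L f)

/-- The operator `L` of parity `ε` is a differential operator of order `≤ N`. -/
def OrdLE (N : ℕ) (ε : ZMod 2) (L : A →ₗ[ℝ] A) : Prop :=
  CommutatorsVanish 𝒜 (N + 1) ε L

/-- The bracket `{f, g} = Δ(fg) - (Δf) g - (-1)^{f̃} f (Δg) + Δ(1) f g` generated by an odd
operator `Δ`, for `f` of parity `i`. -/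
def bracket (Δ : A →ₗ[ℝ] A) (i : ZMod 2) (f g : A) : A :=
  Δ (f * g) - Δ f * g - sgn i • (f * Δ g) + Δ 1 * (f * g)

/-- The Jacobi identity
`{{f,g},h} + (-1)^{g̃h̃} {{f,h},g} + (-1)^{f̃(g̃+h̃)} {{g,h},f} = 0`
for the odd symmetric bracket generated by `Δ`. The bracket being odd, `{f,g}` has parity
`f̃ + g̃ + 1`. -/
def Jacobi3 (Δ : A →ₗ[ℝ] A) : Prop :=
  ∀ i j k, ∀ f ∈ 𝒜 i, ∀ g ∈ 𝒜 j, ∀ h ∈ 𝒜 k,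
    bracket Δ (i + j + 1) (bracket Δ i f g) h
      + sgn (j * k) • bracket Δ (i + k + 1) (bracket Δ i f h) g
      + sgn (i * (j + k)) • bracket Δ (j + k + 1) (bracket Δ j g h) f = 0

/-- `Δ` is an (odd) derivation of the odd bracket it generates:
`Δ{f,g} = -{Δf, g} - (-1)^{f̃} {f, Δg}`, the signs being given by the sign rule for an odd operator
passing the odd bracket and `f`. -/
def Jacobi2 (Δ : A →ₗ[ℝ] A) : Prop :=
  ∀ i j, ∀ f ∈ 𝒜 i, ∀ g ∈ 𝒜 j,
    Δ (bracket Δ i f g) = -bracket Δ (i + 1) (Δ f) g - sgn i • bracket Δ i f (Δ g)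

end Algebraic

/-! ### Supermanifolds -/

/-- The restriction homomorphisms of a sheaf of algebras. -/
def res {X : TopCat.{u}} (O : TopCat.Sheaf (AlgCat.{u} ℝ) X) {U W : Opens X} (h : U ≤ W) :
    O.obj.obj (op W) →ₐ[ℝ] O.obj.obj (op U) :=
  (O.obj.map (homOfLE h).op).hom

/-- The part of the source of `e` lying over an open set `V`. -/
def overOpens {X : Type*} [TopologicalSpace X] {p : ℕ} (e : OpenPartialHomeomorph X (Fin p → ℝ))
    (V : Opens (Fin p → ℝ)) : Opens X :=
  ⟨e.source ∩ e ⁻¹' V, e.isOpen_inter_preimage V.isOpen⟩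

theorem overOpens_mono {X : Type*} [TopologicalSpace X] {p : ℕ}
    (e : OpenPartialHomeomorph X (Fin p → ℝ)) {V W : Opens (Fin p → ℝ)} (h : V ≤ W) :
    overOpens e V ≤ overOpens e W :=
  fun _ hx => ⟨hx.1, h hx.2⟩

/-- The target of `e`, as an open set. -/
def targetOpens {X : Type*} [TopologicalSpace X] {p : ℕ}
    (e : OpenPartialHomeomorph X (Fin p → ℝ)) : Opens (Fin p → ℝ) :=
  ⟨e.target, e.open_target⟩

/-- A chart (local coordinate system) of a space `X` with a sheaf of `ℤ/2`-graded algebras: a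
homeomorphism `e` from an open subset of `X` onto an open subset of `ℝ^p`, together with an
isomorphism over `e` of the sheaf with the sheaf of superfunctions in `p` even and `q` odd
variables. -/
structure SuperChart (p q : ℕ) {X : TopCat.{u}} (O : TopCat.Sheaf (AlgCat.{u} ℝ) X)
    (parity : ∀ U : Opens X, ZMod 2 → Submodule ℝ (O.obj.obj (op U))) where
  e : OpenPartialHomeomorph X (Fin p → ℝ)
  iso : ∀ V : Opens (Fin p → ℝ), V ≤ targetOpens e →
    (O.obj.obj (op (overOpens e V)) ≃ₐ[ℝ] SuperFun (Fin q) V)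
  iso_res : ∀ (V W : Opens (Fin p → ℝ)) (hV : V ≤ targetOpens e) (hW : W ≤ targetOpens e)
    (h : V ≤ W) (f : O.obj.obj (op (overOpens e W))),
    iso V hV (res O (overOpens_mono e h) f) = SuperFun.restrict h (iso W hW f)
  iso_parity : ∀ (V : Opens (Fin p → ℝ)) (hV : V ≤ targetOpens e) (i : ZMod 2),
    ∀ f ∈ parity (overOpens e V) i, iso V hV f ∈ SuperFun.parity V i

/-- A smooth supermanifold of dimension `p|q`: a Hausdorff second countable space with a sheaf of
supercommutative algebras that is locally isomorphic to the sheaf of superfunctions in `p` even and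
`q` odd variables. -/
structure Supermanifold (p q : ℕ) where
  X : TopCat.{u}
  t2 : T2Space X
  secondCountable : SecondCountableTopology X
  /-- the structure sheaf -/
  O : TopCat.Sheaf (AlgCat.{u} ℝ) X
  /-- the sections of a given parity -/
  parity : ∀ U : Opens X, ZMod 2 → Submodule ℝ (O.obj.obj (op U))
  gradedMonoid : ∀ U, SetLike.GradedMonoid (parity U)
  isInternal : ∀ U, DirectSum.IsInternal (parity U)
  supercomm : ∀ U i j, ∀ f ∈ parity U i, ∀ g ∈ parity U j, f * g = sgn (i * j) • (g * f)
  res_parity : ∀ (U W : Opens X) (h : U ≤ W) (i : ZMod 2), ∀ f ∈ parity W i,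
    res O h f ∈ parity U i
  exists_chart : ∀ x : X, ∃ c : SuperChart p q O parity, x ∈ c.e.source

namespace Supermanifold

variable {p q : ℕ} (M : Supermanifold.{u} p q)

/-- The algebra `C^∞(M)` of (global) functions on `M`. -/
abbrev Functions : Type u := M.O.obj.obj (op ⊤)

/-- The functions on `M` of a given parity. -/
abbrev functionsParity : ZMod 2 → Submodule ℝ M.Functions := M.parity ⊤

/-- The charts of `M`. -/
abbrev Chart : Type u := SuperChart p q M.O M.parity

variable {M}

/-- The expression of a function on `M` in local coordinates. -/
def Chart.localRep (c : M.Chart) (f : M.Functions) : SuperFun (Fin q) (targetOpens c.e) :=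
  c.iso (targetOpens c.e) le_rfl (res M.O le_top f)

/-- An expression `Δ = ½ S^{ab} ∂_b ∂_a + T^a ∂_a + R` of an operator on functions in a chart, with
supersymmetric `S^{ab}`. -/
structure LocalExpr (Δ : M.Functions →ₗ[ℝ] M.Functions) (c : M.Chart) where
  S : Fin p ⊕ Fin q → Fin p ⊕ Fin q → SuperFun (Fin q) (targetOpens c.e)
  T : Fin p ⊕ Fin q → SuperFun (Fin q) (targetOpens c.e)
  R : SuperFun (Fin q) (targetOpens c.e)
  symm : ∀ a b, S a b = sgn (par a * par b) • S b a
  eq : ∀ f : M.Functions, c.localRep (Δ f) =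
    (1 / 2 : ℝ) • ∑ a, ∑ b, S a b * (SuperFun.pd b (SuperFun.pd a (c.localRep f)))
      + ∑ a, T a * SuperFun.pd a (c.localRep f) + R * c.localRep f

variable (M) in
/-- A second-order differential operator on functions on `M`: a linear operator given in every
chart by an expression `½ S^{ab} ∂_b ∂_a + T^a ∂_a + R` (whose coefficients it determines). -/
structure SecondOrderOperator where
  toLin : M.Functions →ₗ[ℝ] M.Functions
  expr : ∀ c : M.Chart, LocalExpr toLin c

namespace SecondOrderOperator

/-- The principal symbol in a chart, a function on the cotangent bundle. -/
def symbol (Δ : M.SecondOrderOperator) (c : M.Chart) :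
    SuperFun (Fin q ⊕ Fin q) (SuperFun.cot (targetOpens c.e)) :=
  SuperFun.symbol (Δ.expr c).S

/-- The (coordinate-dependent) subprincipal symbol `γ` in a chart, for an odd operator. It is the
local connection form of the upper connection defined by the operator. -/
def subprincipal (Δ : M.SecondOrderOperator) (c : M.Chart) :
    SuperFun (Fin q ⊕ Fin q) (SuperFun.cot (targetOpens c.e)) :=
  SuperFun.subprincipal 1 (Δ.expr c).S (Δ.expr c).T

/-- `D = (S, ·)`, acting on functions on the cotangent bundle over a chart. -/
def D (Δ : M.SecondOrderOperator) (c : M.Chart)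
    (F : SuperFun (Fin q ⊕ Fin q) (SuperFun.cot (targetOpens c.e))) :
    SuperFun (Fin q ⊕ Fin q) (SuperFun.cot (targetOpens c.e)) :=
  SuperFun.poisson (Δ.symbol c) F

/-- The equation `(S, S) = 0`. -/
def SymbolMasterEq (Δ : M.SecondOrderOperator) : Prop :=
  ∀ c : M.Chart, SuperFun.poisson (Δ.symbol c) (Δ.symbol c) = 0

/-- The equation `(S, γ) = 0`, in every chart. -/
def FlatEq (Δ : M.SecondOrderOperator) : Prop :=
  ∀ c : M.Chart, SuperFun.poisson (Δ.symbol c) (Δ.subprincipal c) = 0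

end SecondOrderOperator

end Supermanifold

end SuperGeom

end

/-! The theorem separates into a statement about algebras, a computation in coordinates, and a
passage between global functions and charts.

*Algebra.* For an odd operator `Δ` of order `≤ 2` with `Δ 1 = 0`, the double commutator with `f`
and `g` is the multiplication by `{f, g}`. Expanding the commutators of `Δ² = Δ ∘ Δ` by the Leibniz
rule, the triple commutator with `f, g, h` is the multiplication by the Jacobiator
(`commutator₃_sq`), and the double commutator with `f, g` takes at `1` the value
`Δ{f, g} + {Δf, g} ± {f, Δg}` (`commutator_commutator_sq_one`). Since an operator of order `≤ 0` is
the multiplication by its value at `1`, this gives the equivalences between the order of `Δ²` and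
the Jacobi conditions: `ordLE_two_sq_iff`, `ordLE_one_sq_iff`.

*Coordinates.* In a chart, `Δ² = K^{ace} ∂_a ∂_e ∂_c + N^{ce} ∂_e ∂_c + (Δ T^c) ∂_c`
(`secondOrder_secondOrder`): the terms in which the left factor does not differentiate the
coefficients of the right one cancel, because `Δ` is odd. Only the supersymmetrizations `cyc₃ K` and
`cyc₂ N` matter. They vanish if and only if the functions `K^{ace} p_a p_e p_c` and `N^{ce} p_e p_c`
on the cotangent bundle do (`cubicSymbol_eq_zero_iff`, `quadSymbol_eq_zero_iff`), and these are the
brackets in question: `(S, S) = 2 K^{ace} p_a p_e p_c` (`hamilton_symbol_symbol`) and, once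
`(S, S) = 0`, `(S, γ) = -2 N^{ce} p_e p_c` (`hamilton_symbol_subprincipal`). In the latter, the term
of `(S, γ)` with second derivatives of `S` comes from applying the operator `∑ ∂²/∂x^a ∂p_a` to
`(S, S) = 0` (`hamilton_divergence`). On the other hand `cyc₃ K` and `cyc₂ N` are the Jacobiator of
the coordinates and the failure of `Δ` to be a derivation of the bracket on them (`jacobi_coord`,
`derivation_coord`). Finally `D² = 0`, because an odd vector field that annihilates its own
coefficients squares to zero and the coefficients of `D = (S, ·)` are derivatives of `S`
(`hamilton_hamilton`).

*Globalization.* Multiplied by a cutoff function and extended by zero, the coordinates of a chart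
become global functions of the same parity (`Chart.exists_coord`). As the operators are local, the
Jacobi conditions for global functions can therefore be evaluated on coordinates, and the
coefficients `S^{ab}` and `T^a` inherit their parities from `Δ`. Conversely, the vanishing of
commutators is checked chart by chart (`ordLE_of_local`).

The coordinate computations are carried out over an arbitrary supercommutative algebra with a
family of supercommuting derivations (`IsSuperCalculus`, `IsCotangent`). Each sign identity is an
identity between parities in `ZMod 2`, which `decide` verifies. -/

noncomputable section

namespace SuperGeom

/-! ### Signs -/

theorem sgn_zero : sgn 0 = 1 := rfl

theorem sgn_one : sgn 1 = -1 := if_neg (by decide)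

theorem sgn_add (i j : ZMod 2) : sgn (i + j) = sgn i * sgn j := by
  have h : ∀ i j : ZMod 2, (i + j = 0 ∧ (i = 0 ∧ j = 0 ∨ i = 1 ∧ j = 1)) ∨
      (i + j = 1 ∧ (i = 0 ∧ j = 1 ∨ i = 1 ∧ j = 0)) := by decide
  rcases h i j with ⟨h, ⟨rfl, rfl⟩ | ⟨rfl, rfl⟩⟩ | ⟨h, ⟨rfl, rfl⟩ | ⟨rfl, rfl⟩⟩ <;>
    simp [h, sgn_zero, sgn_one]

theorem sgn_smul_smul {A : Type*} [MulAction ℝ A] (i j : ZMod 2) (x : A) :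
    sgn i • sgn j • x = sgn (i + j) • x := by
  rw [sgn_add, smul_smul]

theorem sgn_smul_eq_self {A : Type*} [MulAction ℝ A] {i : ZMod 2} (hi : i = 0) (x : A) :
    sgn i • x = x := by
  rw [hi, sgn_zero, one_smul]

theorem sgn_smul_eq_zero {A : Type*} [AddCommGroup A] [Module ℝ A] {i : ZMod 2} {x : A}
    (h : sgn i • x = 0) : x = 0 := by
  rw [← sgn_smul_eq_self (CharTwo.add_self_eq_zero i) x, ← sgn_smul_smul, h, smul_zero]

theorem neg_eq_sgn_smul {A : Type*} [AddCommGroup A] [Module ℝ A] (x : A) :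
    -x = sgn 1 • x := by
  rw [sgn_one, neg_one_smul]

/-! ### Supercommutators and the order of an operator -/

section Algebraic

variable {A : Type*} [Ring A] [Algebra ℝ A] {𝒜 : ZMod 2 → Submodule ℝ A}

theorem commutator_apply (ε i : ZMod 2) (L : A →ₗ[ℝ] A) (f u : A) :
    commutator ε i L f u = L (f * u) - sgn (ε * i) • (f * L u) := rfl

theorem commutator_add (ε i : ZMod 2) (L M : A →ₗ[ℝ] A) (f : A) :
    commutator ε i (L + M) f = commutator ε i L f + commutator ε i M f := by
  ext u
  simp only [commutator_apply, LinearMap.add_apply, mul_add, smul_add]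
  abel

theorem commutator_smul (ε i : ZMod 2) (r : ℝ) (L : A →ₗ[ℝ] A) (f : A) :
    commutator ε i (r • L) f = r • commutator ε i L f := by
  ext u
  simp only [commutator_apply, LinearMap.smul_apply, mul_smul_comm, smul_sub, smul_comm r]

theorem commutator_zero (ε i : ZMod 2) (f : A) :
    commutator ε i (0 : A →ₗ[ℝ] A) f = 0 := by
  ext u
  simp [commutator_apply]

/-- The Leibniz rule for supercommutators. -/
theorem commutator_comp (ε δ i : ZMod 2) (L M : A →ₗ[ℝ] A) (f : A) :
    commutator (ε + δ) i (L ∘ₗ M) f =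
      L ∘ₗ commutator δ i M f + sgn (δ * i) • commutator ε i L f ∘ₗ M := by
  ext u
  simp only [commutator_apply, LinearMap.add_apply, LinearMap.comp_apply, LinearMap.smul_apply,
    map_sub, map_smul, smul_sub, sgn_smul_smul]
  rw [show (ε + δ) * i = δ * i + ε * i by ring]
  abel

theorem CommutatorsVanish.zero (n : ℕ) (ε : ZMod 2) :
    CommutatorsVanish 𝒜 n ε (0 : A →ₗ[ℝ] A) := by
  induction n generalizing ε with
  | zero => rfl
  | succ n ih =>
    intro i f _
    rw [commutator_zero]
    exact ih _

theorem CommutatorsVanish.add {n : ℕ} {ε : ZMod 2} {L M : A →ₗ[ℝ] A}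
    (hL : CommutatorsVanish 𝒜 n ε L) (hM : CommutatorsVanish 𝒜 n ε M) :
    CommutatorsVanish 𝒜 n ε (L + M) := by
  induction n generalizing ε L M with
  | zero =>
    change L + M = 0
    rw [show L = 0 from hL, show M = 0 from hM, add_zero]
  | succ n ih =>
    intro i f hf
    rw [commutator_add]
    exact ih (hL i f hf) (hM i f hf)

theorem CommutatorsVanish.smul {n : ℕ} {ε : ZMod 2} {L : A →ₗ[ℝ] A}
    (hL : CommutatorsVanish 𝒜 n ε L) (r : ℝ) : CommutatorsVanish 𝒜 n ε (r • L) := by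
  induction n generalizing ε L with
  | zero =>
    change r • L = 0
    rw [show L = 0 from hL, smul_zero]
  | succ n ih =>
    intro i f hf
    rw [commutator_smul]
    exact ih (hL i f hf)

theorem CommutatorsVanish.sum {α : Type*} {n : ℕ} {ε : ZMod 2} (s : Finset α)
    {L : α → A →ₗ[ℝ] A} (hL : ∀ a ∈ s, CommutatorsVanish 𝒜 n ε (L a)) :
    CommutatorsVanish 𝒜 n ε (∑ a ∈ s, L a) :=
  Finset.sum_induction L (CommutatorsVanish 𝒜 n ε) (fun _ _ => .add) (.zero n ε) hL

theorem CommutatorsVanish.succ {n : ℕ} {ε : ZMod 2} {L : A →ₗ[ℝ] A}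
    (hL : CommutatorsVanish 𝒜 n ε L) : CommutatorsVanish 𝒜 (n + 1) ε L := by
  induction n generalizing ε L with
  | zero =>
    rw [show L = 0 from hL]
    exact .zero _ _
  | succ n ih => exact fun i f hf => ih (hL i f hf)

/-- The order of a composition of differential operators is at most the sum of their orders. -/
theorem CommutatorsVanish.comp {m n : ℕ} {ε δ : ZMod 2} {L M : A →ₗ[ℝ] A}
    (hL : CommutatorsVanish 𝒜 m ε L) (hM : CommutatorsVanish 𝒜 n δ M) :
    CommutatorsVanish 𝒜 (m + n - 1) (ε + δ) (L ∘ₗ M) := by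
  induction m generalizing n ε δ L M with
  | zero =>
    rw [show L = 0 from hL, LinearMap.zero_comp]
    exact .zero _ _
  | succ m ihm =>
    induction n generalizing ε δ L M with
    | zero =>
      rw [show M = 0 from hM, LinearMap.comp_zero]
      exact .zero _ _
    | succ n ihn =>
      rw [show m + 1 + (n + 1) - 1 = m + n + 1 by omega]
      intro i f hf
      rw [commutator_comp]
      refine .add ?_ (.smul ?_ _)
      · have := ihn hL (hM i f hf)
        rwa [← add_assoc, show m + 1 + n - 1 = m + n by omega] at this
      · have := ihm (hL i f hf) hM
        rwa [add_right_comm, show m + (n + 1) - 1 = m + n by omega] at this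

/-- An operator intertwined, by a jointly injective family of parity preserving homomorphisms, with
operators of order `≤ N` has order `≤ N`. -/
theorem CommutatorsVanish.of_intertwine {α : Type*} {B : α → Type*} [∀ c, Ring (B c)]
    [∀ c, Algebra ℝ (B c)] {ℬ : ∀ c, ZMod 2 → Submodule ℝ (B c)} (ρ : ∀ c, A →ₐ[ℝ] B c)
    (hρ : ∀ c i, ∀ f ∈ 𝒜 i, ρ c f ∈ ℬ c i) (hinj : ∀ f, (∀ c, ρ c f = 0) → f = 0)
    {n : ℕ} {ε : ZMod 2} {L : A →ₗ[ℝ] A} {Lc : ∀ c, B c →ₗ[ℝ] B c}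
    (hL : ∀ c f, ρ c (L f) = Lc c (ρ c f))
    (h : ∀ c, CommutatorsVanish (ℬ c) n ε (Lc c)) : CommutatorsVanish 𝒜 n ε L := by
  induction n generalizing ε L Lc with
  | zero =>
    refine LinearMap.ext fun f => hinj _ fun c => ?_
    rw [hL, show Lc c = 0 from h c, LinearMap.zero_apply]
  | succ n ih =>
    intro i f hf
    refine ih (Lc := fun c => commutator ε i (Lc c) (ρ c f)) (fun c u => ?_)
      fun c => h c i _ (hρ c i f hf)
    simp only [commutator_apply, map_sub, map_smul, map_mul, hL]

variable (𝒜) in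
/-- A supercommutative `ℤ/2`-graded algebra. -/
structure IsSupercommutative : Prop where
  one_mem : 1 ∈ 𝒜 0
  mul_mem : ∀ {i j f g}, f ∈ 𝒜 i → g ∈ 𝒜 j → f * g ∈ 𝒜 (i + j)
  comm : ∀ {i j f g}, f ∈ 𝒜 i → g ∈ 𝒜 j → f * g = sgn (i * j) • (g * f)

/-- Multiplications supercommute. -/
theorem IsSupercommutative.commutator_mulLeft (hA : IsSupercommutative 𝒜) {i j : ZMod 2}
    {f g : A} (hf : f ∈ 𝒜 i) (hg : g ∈ 𝒜 j) :
    commutator i j (LinearMap.mulLeft ℝ f) g = 0 := by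
  ext u
  simp only [commutator_apply, LinearMap.mulLeft_apply, LinearMap.zero_apply, ← mul_assoc]
  rw [hA.comm hf hg, smul_mul_assoc, sub_self]

/-- An operator of order `≤ 0` is the multiplication by its value at `1`. -/
theorem IsSupercommutative.eq_mulLeft (hA : IsSupercommutative 𝒜) (htop : ∀ f, f ∈ ⨆ i, 𝒜 i)
    {ε : ZMod 2} {L : A →ₗ[ℝ] A} (h1 : L 1 ∈ 𝒜 ε)
    (hL : ∀ i, ∀ f ∈ 𝒜 i, commutator ε i L f = 0) : L = LinearMap.mulLeft ℝ (L 1) := by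
  ext f
  induction htop f using Submodule.iSup_induction' with
  | mem i f hf =>
    have := LinearMap.congr_fun (hL i f hf) 1
    rw [commutator_apply, mul_one, LinearMap.zero_apply, sub_eq_zero] at this
    rw [this, LinearMap.mulLeft_apply, hA.comm h1 hf]
  | zero => simp
  | add f g _ _ hf hg => rw [map_add, map_add, hf, hg]

/-! ### The square of an odd operator of second order -/

section OddOperator

variable {Δ : A →ₗ[ℝ] A} (hA : IsSupercommutative 𝒜) (htop : ∀ f, f ∈ ⨆ i, 𝒜 i)
  (hodd : HasParity 𝒜 1 Δ) (hone : Δ 1 = 0) (hord : OrdLE 𝒜 2 1 Δ)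

include hone in
theorem bracket_eq (i : ZMod 2) (f g : A) :
    bracket Δ i f g = Δ (f * g) - Δ f * g - sgn i • (f * Δ g) := by
  rw [bracket, hone, zero_mul, add_zero]

include hA hodd hone in
theorem bracket_mem {i j : ZMod 2} {f g : A} (hf : f ∈ 𝒜 i) (hg : g ∈ 𝒜 j) :
    bracket Δ i f g ∈ 𝒜 (i + j + 1) := by
  rw [bracket_eq hone]
  refine Submodule.sub_mem _ (Submodule.sub_mem _ (hodd _ _ (hA.mul_mem hf hg)) ?_)
    (Submodule.smul_mem _ _ ?_)
  · have := hA.mul_mem (hodd _ _ hf) hg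
    rwa [add_right_comm] at this
  · have := hA.mul_mem hf (hodd _ _ hg)
    rwa [← add_assoc] at this

include hA hodd hone in
theorem bracket_symm {i j : ZMod 2} {f g : A} (hf : f ∈ 𝒜 i) (hg : g ∈ 𝒜 j) :
    bracket Δ i f g = sgn (i * j) • bracket Δ j g f := by
  rw [bracket_eq hone, bracket_eq hone, hA.comm hf hg, hA.comm (hodd _ _ hf) hg,
    hA.comm hf (hodd _ _ hg), map_smul, smul_sub, smul_sub, sgn_smul_smul, sgn_smul_smul,
    show i + i * (j + 1) = i * j by clear * -; decide +revert,
    show (i + 1) * j = i * j + j by ring]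
  abel

include hA htop hodd hone hord in
/-- For an operator of order `≤ 2`, the double commutator with functions is the multiplication by
their bracket. -/
theorem commutator_commutator_eq_mulLeft {i j : ZMod 2} {f g : A} (hf : f ∈ 𝒜 i) (hg : g ∈ 𝒜 j) :
    commutator (1 + i) j (commutator 1 i Δ f) g = LinearMap.mulLeft ℝ (bracket Δ i f g) := by
  have h1 : commutator (1 + i) j (commutator 1 i Δ f) g 1 = bracket Δ i f g := by
    simp only [commutator_apply, mul_one, hone, mul_zero, smul_zero, sub_zero, one_mul]
    rw [bracket_eq hone, hA.comm (hodd _ _ hf) hg, add_comm i 1]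
    abel
  have hmem := bracket_mem hA hodd hone hf hg
  rw [show i + j + 1 = 1 + i + j by ring, ← h1] at hmem
  rw [hA.eq_mulLeft htop hmem (hord i f hf j g hg), h1]

/-- The double commutator of `Δ²`, for an odd operator `Δ`. -/
theorem commutator_commutator_sq (Δ : A →ₗ[ℝ] A) (i j : ZMod 2) (f g : A) :
    commutator (0 + i) j (commutator 0 i (Δ ∘ₗ Δ) f) g =
      Δ ∘ₗ commutator (1 + i) j (commutator 1 i Δ f) g +
        sgn ((1 + i) * j) • commutator 1 j Δ g ∘ₗ commutator 1 i Δ f +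
        sgn i • (commutator 1 i Δ f ∘ₗ commutator 1 j Δ g +
          sgn j • commutator (1 + i) j (commutator 1 i Δ f) g ∘ₗ Δ) := by
  have h0 : (0 : ZMod 2) = 1 + 1 := by decide
  rw [h0, commutator_comp, commutator_add, commutator_smul, one_mul,
    show (1 + 1 + i : ZMod 2) = 1 + (1 + i) by ring, commutator_comp,
    show (1 + (1 + i) : ZMod 2) = (1 + i) + 1 by ring, commutator_comp, one_mul]

include hone in
/-- At `1`, the double commutator of `Δ²` measures the failure of `Δ` to be a derivation of the
bracket. -/
theorem commutator_commutator_sq_one (i j : ZMod 2) (f g : A) (hi : f ∈ 𝒜 i) (hj : g ∈ 𝒜 j)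
    (hA : IsSupercommutative 𝒜) (hodd : HasParity 𝒜 1 Δ) :
    commutator (0 + i) j (commutator 0 i (Δ ∘ₗ Δ) f) g 1 =
      Δ (bracket Δ i f g) + bracket Δ (i + 1) (Δ f) g + sgn i • bracket Δ i f (Δ g) := by
  have hii : i + i = 0 := by clear * -; decide +revert
  simp only [bracket_eq hone, commutator_apply, LinearMap.comp_apply, mul_one, hone, map_zero,
    mul_zero, smul_zero, sub_zero, map_sub, smul_sub, map_smul, sgn_smul_smul, hii, sgn_zero,
    one_smul, zero_mul, zero_add, sgn_add, sgn_one]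
  have h := hA.comm (hodd _ _ (hodd _ _ hi)) hj
  rw [show (i + 1 + 1) * j = i * j by clear * -; decide +revert] at h
  rw [h]
  simp only [mul_neg, mul_one, neg_smul]
  abel

include hA htop hodd hone hord in
/-- The triple commutator of `Δ²` with functions is the multiplication by their Jacobiator. -/
theorem commutator₃_sq {i j k : ZMod 2} {f g h : A} (hf : f ∈ 𝒜 i) (hg : g ∈ 𝒜 j)
    (hh : h ∈ 𝒜 k) :
    commutator (0 + i + j) k (commutator (0 + i) j (commutator 0 i (Δ ∘ₗ Δ) f) g) h =
      LinearMap.mulLeft ℝ (bracket Δ (i + j + 1) (bracket Δ i f g) h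
        + sgn (j * k) • bracket Δ (i + k + 1) (bracket Δ i f h) g
        + sgn (i * (j + k)) • bracket Δ (j + k + 1) (bracket Δ j g h) f) := by
  -- By symmetry of the bracket, `{{f, g}, h}` is the commutator of `[Δ, h]` with `{f, g}`.
  have key : ∀ {i j k : ZMod 2} {f g h : A}, f ∈ 𝒜 i → g ∈ 𝒜 j → h ∈ 𝒜 k →
      LinearMap.mulLeft ℝ (bracket Δ (i + j + 1) (bracket Δ i f g) h) =
        sgn ((i + j + 1) * k) • (commutator 1 k Δ h ∘ₗ LinearMap.mulLeft ℝ (bracket Δ i f g))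
        + sgn (i + j) • (LinearMap.mulLeft ℝ (bracket Δ i f g) ∘ₗ commutator 1 k Δ h) := by
    intro i j k f g h hf hg hh
    have hb := bracket_mem hA hodd hone hf hg
    have := commutator_commutator_eq_mulLeft hA htop hodd hone hord hh hb
    rw [bracket_symm hA hodd hone hb hh]
    ext u
    have hu := LinearMap.congr_fun this u
    rw [commutator_apply, LinearMap.mulLeft_apply] at hu
    simp only [LinearMap.mulLeft_apply, LinearMap.add_apply, LinearMap.smul_apply,
      LinearMap.comp_apply, smul_mul_assoc, ← hu, smul_sub, sgn_smul_smul]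
    rw [sub_eq_add_neg, neg_eq_sgn_smul, sgn_smul_smul]
    congr 3
    clear * -; decide +revert
  rw [commutator_commutator_sq]
  simp only [commutator_commutator_eq_mulLeft hA htop hodd hone hord hf hg]
  have hb := bracket_mem hA hodd hone hf hg
  have e1 : 0 + i + j = 1 + (i + j + 1) := by clear * -; decide +revert
  have e2 : 1 + (i + j + 1) = (1 + j) + (1 + i) := by clear * -; decide +revert
  have e3 : (1 + j) + (1 + i) = (1 + i) + (1 + j) := by ring
  have e4 : (1 + i) + (1 + j) = (i + j + 1) + 1 := by ring
  simp only [commutator_add, commutator_smul]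
  have c1 : commutator (0 + i + j) k (Δ ∘ₗ LinearMap.mulLeft ℝ (bracket Δ i f g)) h =
      sgn ((i + j + 1) * k) • (commutator 1 k Δ h ∘ₗ LinearMap.mulLeft ℝ (bracket Δ i f g)) := by
    rw [e1, commutator_comp, hA.commutator_mulLeft hb hh, LinearMap.comp_zero, zero_add]
  have c2 : commutator (0 + i + j) k (commutator 1 j Δ g ∘ₗ commutator 1 i Δ f) h =
      commutator 1 j Δ g ∘ₗ LinearMap.mulLeft ℝ (bracket Δ i f h) +
        sgn ((1 + i) * k) • (LinearMap.mulLeft ℝ (bracket Δ j g h) ∘ₗ commutator 1 i Δ f) := by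
    rw [e1, e2, commutator_comp, commutator_commutator_eq_mulLeft hA htop hodd hone hord hf hh,
      commutator_commutator_eq_mulLeft hA htop hodd hone hord hg hh]
  have c3 : commutator (0 + i + j) k (commutator 1 i Δ f ∘ₗ commutator 1 j Δ g) h =
      commutator 1 i Δ f ∘ₗ LinearMap.mulLeft ℝ (bracket Δ j g h) +
        sgn ((1 + j) * k) • (LinearMap.mulLeft ℝ (bracket Δ i f h) ∘ₗ commutator 1 j Δ g) := by
    rw [e1, e2, e3, commutator_comp, commutator_commutator_eq_mulLeft hA htop hodd hone hord hf hh,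
      commutator_commutator_eq_mulLeft hA htop hodd hone hord hg hh]
  have c4 : commutator (0 + i + j) k (LinearMap.mulLeft ℝ (bracket Δ i f g) ∘ₗ Δ) h =
      LinearMap.mulLeft ℝ (bracket Δ i f g) ∘ₗ commutator 1 k Δ h := by
    rw [e1, e2, e3, e4, commutator_comp, hA.commutator_mulLeft hb hh, LinearMap.zero_comp,
      smul_zero, add_zero]
  rw [c1, c2, c3, c4]
  have hlin : ∀ (x y z : A) (r s : ℝ), LinearMap.mulLeft ℝ (x + r • y + s • z) =
      LinearMap.mulLeft ℝ x + r • LinearMap.mulLeft ℝ y + s • LinearMap.mulLeft ℝ z := by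
    intro x y z r s
    ext u
    simp [add_mul]
  rw [hlin, key hf hg hh, key hf hh hg, key hg hh hf]
  simp only [smul_add, sgn_smul_smul]
  rw [show j * k + (i + k + 1) * j = (1 + i) * j by clear * -; decide +revert,
    show j * k + (i + k) = i + (1 + j) * k + (i * 0) by clear * -; decide +revert,
    show i * (j + k) + (j + k + 1) * i = i by clear * -; decide +revert,
    show i * (j + k) + (j + k) = (1 + i) * j + (1 + i) * k by ring, mul_zero, add_zero]
  abel

include hA htop hodd hone hord in
/-- The square of `Δ` has order `≤ 2` if and only if the bracket satisfies the Jacobi identity. -/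
theorem ordLE_two_sq_iff : OrdLE 𝒜 2 0 (Δ ∘ₗ Δ) ↔ Jacobi3 𝒜 Δ := by
  constructor
  · intro h i j k f hf g hg u hu
    have := LinearMap.congr_fun (h i f hf j g hg k u hu) 1
    rwa [commutator₃_sq hA htop hodd hone hord hf hg hu, LinearMap.mulLeft_apply, mul_one] at this
  · intro h i f hf j g hg k u hu
    change commutator _ _ _ _ = 0
    rw [commutator₃_sq hA htop hodd hone hord hf hg hu, h i j k f hf g hg u hu,
      LinearMap.mulLeft_zero_eq_zero]

include hA htop hodd hone hord in
/-- The square of `Δ` has order `≤ 1` if and only if the bracket satisfies the Jacobi identity and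
`Δ` is a derivation of it. -/
theorem ordLE_one_sq_iff :
    OrdLE 𝒜 1 0 (Δ ∘ₗ Δ) ↔ Jacobi3 𝒜 Δ ∧ Jacobi2 𝒜 Δ := by
  have e : ∀ x y z : A, x = -y - z ↔ x + y + z = 0 := fun x y z =>
    ⟨fun h => by rw [h]; abel, fun h => by rw [← sub_eq_zero, ← h]; abel⟩
  constructor
  · intro h
    refine ⟨(ordLE_two_sq_iff hA htop hodd hone hord).1 (CommutatorsVanish.succ h), ?_⟩
    intro i j f hf g hg
    have := LinearMap.congr_fun (h i f hf j g hg) 1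
    rw [commutator_commutator_sq_one hone i j f g hf hg hA hodd] at this
    exact (e _ _ _).2 this
  · rintro ⟨h3, h2⟩ i f hf j g hg
    change commutator _ _ _ _ = 0
    have hv : commutator (0 + i) j (commutator 0 i (Δ ∘ₗ Δ) f) g 1 = 0 := by
      rw [commutator_commutator_sq_one hone i j f g hf hg hA hodd]
      exact (e _ _ _).1 (h2 i j f hf g hg)
    have := hA.eq_mulLeft htop (ε := 0 + i + j) (hv ▸ Submodule.zero_mem _)
      ((ordLE_two_sq_iff hA htop hodd hone hord).2 h3 i f hf j g hg)
    rw [this, hv, LinearMap.mulLeft_zero_eq_zero]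

end OddOperator

end Algebraic


/-! ### Second-order operators over a super calculus -/

/-- A family of supercommuting superderivations `d a`, of parities `p a`, of a supercommutative
algebra. -/
structure IsSuperCalculus {A : Type*} [Ring A] [Algebra ℝ A] (𝒜 : ZMod 2 → Submodule ℝ A)
    {I : Type*} (p : I → ZMod 2) (d : I → A →ₗ[ℝ] A) : Prop extends IsSupercommutative 𝒜 where
  d_mem : ∀ {i f} a, f ∈ 𝒜 i → d a f ∈ 𝒜 (i + p a)
  leibniz : ∀ {i f} a, f ∈ 𝒜 i → ∀ g, d a (f * g) = d a f * g + sgn (p a * i) • (f * d a g)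
  d_comm : ∀ a b f, d a (d b f) = sgn (p a * p b) • d b (d a f)

section Supersymmetric

variable {A : Type*} [Ring A] [Algebra ℝ A] {𝒜 : ZMod 2 → Submodule ℝ A}
  {I : Type*} [Fintype I] {p : I → ZMod 2}

theorem eq_zero_of_eq_neg {E : Type*} [AddCommGroup E] [Module ℝ E] {x : E} (h : x = -x) :
    x = 0 := by
  have h2 : (2 : ℝ) • x = 0 := by rw [two_smul]; nth_rewrite 1 [h]; exact neg_add_cancel x
  exact (smul_eq_zero_iff_right two_ne_zero).1 h2

/-- In the square of an odd operator `∑ U_α P_α`, where the `P_α` supercommute and have the parity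
opposite to that of `U_α`, the terms `± U_α U_β P_β P_α` cancel. Here `r α β` is `P_β P_α f`. -/
theorem IsSupercommutative.sum_odd_mul_odd_eq_zero (hA : IsSupercommutative 𝒜) {U : I → A}
    (hU : ∀ α, U α ∈ 𝒜 (p α + 1)) {r : I → I → A}
    (hr : ∀ α β, r α β = sgn (p α * p β) • r β α) :
    ∑ α, ∑ β, sgn (p α) • (U α * U β * r α β) = 0 := by
  refine eq_zero_of_eq_neg ?_
  conv_lhs => rw [Finset.sum_comm]
  simp only [← Finset.sum_neg_distrib]
  refine Finset.sum_congr rfl fun α _ => Finset.sum_congr rfl fun β _ => ?_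
  rw [hA.comm (hU β) (hU α), hr β α, neg_eq_sgn_smul]
  simp only [smul_mul_assoc, mul_smul_comm, sgn_smul_smul]
  congr 2
  generalize p α = i
  generalize p β = j
  clear * -
  decide +revert

variable (p) in
/-- The sum, with signs, over the positions of the first index of a three-index quantity that is
supersymmetric in the other two. -/
def cyc₃ {E : Type*} [AddCommGroup E] [Module ℝ E] (K : I → I → I → E) (b c e : I) : E :=
  sgn (p b * (p c + p e)) • K b c e + K e b c + sgn (p c * p e) • K c b e

variable (p) in
/-- The supersymmetrization of a two-index quantity. -/
def cyc₂ {E : Type*} [AddCommGroup E] [Module ℝ E] (N : I → I → E) (a b : I) : E :=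
  N a b + sgn (p a * p b) • N b a

/-- A contraction with a supersymmetric quantity only depends on the supersymmetrization. -/
theorem sum_mul_eq_zero_of_cyc₂ {N r : I → I → A} (hN : ∀ a b, cyc₂ p N a b = 0)
    (hr : ∀ a b, r a b = sgn (p a * p b) • r b a) : ∑ a, ∑ b, N a b * r b a = 0 := by
  have h : ∑ a, ∑ b, cyc₂ p N a b * r b a = 0 := by simp [hN]
  simp only [cyc₂, add_mul, Finset.sum_add_distrib] at h
  have h2 : ∑ a, ∑ b, (sgn (p a * p b) • N b a) * r b a = ∑ a, ∑ b, N a b * r b a := by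
    rw [Finset.sum_comm]
    refine Finset.sum_congr rfl fun a _ => Finset.sum_congr rfl fun b _ => ?_
    rw [hr a b]
    rw [smul_mul_assoc, mul_smul_comm, mul_comm (p b), sgn_smul_smul,
      sgn_smul_eq_self (CharTwo.add_self_eq_zero _)]
  rw [h2, ← two_smul ℝ] at h
  exact (smul_eq_zero_iff_right two_ne_zero).1 h

/-- A contraction with a quantity supersymmetric in all three indices only depends on `cyc₃`. -/
theorem sum_mul_eq_zero_of_cyc₃ {K r : I → I → I → A} (hK : ∀ a b c, cyc₃ p K a b c = 0)
    (hr₁ : ∀ a b c, r a b c = sgn (p a * p b) • r b a c)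
    (hr₂ : ∀ a b c, r a b c = sgn (p b * p c) • r a c b) :
    ∑ a, ∑ c, ∑ e, K a c e * r a e c = 0 := by
  have h : ∑ b, ∑ c, ∑ e, sgn (p b * (p c + p e)) • (cyc₃ p K b c e * r b e c) = 0 := by simp [hK]
  simp only [cyc₃, add_mul, Finset.sum_add_distrib, smul_add] at h
  have h1 : ∑ b, ∑ c, ∑ e, sgn (p b * (p c + p e)) • ((sgn (p b * (p c + p e)) • K b c e) * r b e c)
      = ∑ a, ∑ c, ∑ e, K a c e * r a e c := by
    refine Finset.sum_congr rfl fun a _ => Finset.sum_congr rfl fun b _ =>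
      Finset.sum_congr rfl fun c _ => ?_
    rw [smul_mul_assoc, sgn_smul_smul, sgn_smul_eq_self (CharTwo.add_self_eq_zero _)]
  have h2 : ∑ b, ∑ c, ∑ e, sgn (p b * (p c + p e)) • (K e b c * r b e c)
      = ∑ a, ∑ c, ∑ e, K a c e * r a e c := by
    rw [Finset.sum_congr rfl fun b _ => Finset.sum_comm, Finset.sum_comm]
    refine Finset.sum_congr rfl fun a _ => Finset.sum_congr rfl fun c _ =>
      Finset.sum_congr rfl fun e _ => ?_
    rw [hr₁ c a e, hr₂ a c e, mul_smul_comm, mul_smul_comm]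
    simp only [sgn_smul_smul]
    refine sgn_smul_eq_self ?_ _
    generalize p c = i; generalize p e = j; generalize p a = k; clear * -; decide +revert
  have h3 : ∑ b, ∑ c, ∑ e, sgn (p b * (p c + p e)) • ((sgn (p c * p e) • K c b e) * r b e c)
      = ∑ a, ∑ c, ∑ e, K a c e * r a e c := by
    rw [Finset.sum_comm]
    refine Finset.sum_congr rfl fun a _ => Finset.sum_congr rfl fun c _ =>
      Finset.sum_congr rfl fun e _ => ?_
    rw [hr₂ c e a, hr₁ c a e, hr₂ a c e, smul_mul_assoc, mul_smul_comm, mul_smul_comm,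
      mul_smul_comm]
    simp only [sgn_smul_smul]
    refine sgn_smul_eq_self ?_ _
    generalize p c = i; generalize p e = j; generalize p a = k; clear * -; decide +revert
  rw [h1, h2, h3] at h
  have h' : (3 : ℝ) • ∑ a, ∑ c, ∑ e, K a c e * r a e c = 0 := by
    rw [← h]
    module
  exact (smul_eq_zero_iff_right three_ne_zero).1 h'

end Supersymmetric

section Calculus

variable {A : Type*} [Ring A] [Algebra ℝ A] {𝒜 : ZMod 2 → Submodule ℝ A}
  {I : Type*} [Fintype I] {p : I → ZMod 2} {d : I → A →ₗ[ℝ] A}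

variable (d) in
/-- The operator `½ S^{ab} ∂_b ∂_a + T^a ∂_a`. -/
def secondOrder (S : I → I → A) (T : I → A) : A →ₗ[ℝ] A :=
  (1 / 2 : ℝ) • ∑ a, ∑ b, LinearMap.mulLeft ℝ (S a b) ∘ₗ d b ∘ₗ d a +
    ∑ a, LinearMap.mulLeft ℝ (T a) ∘ₗ d a

theorem secondOrder_apply (S : I → I → A) (T : I → A) (f : A) :
    secondOrder d S T f = (1 / 2 : ℝ) • ∑ a, ∑ b, S a b * d b (d a f) + ∑ a, T a * d a f := by
  simp [secondOrder, LinearMap.sum_apply]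

namespace IsSuperCalculus

omit [Fintype I] in
theorem d_one (h : IsSuperCalculus 𝒜 p d) (a : I) : d a 1 = 0 := by
  have := h.leibniz a h.one_mem 1
  simp only [mul_one, mul_zero, sgn_zero, one_smul, one_mul] at this
  simpa using this

theorem secondOrder_one (h : IsSuperCalculus 𝒜 p d) (S : I → I → A) (T : I → A) :
    secondOrder d S T 1 = 0 := by
  simp [secondOrder_apply, h.d_one]

omit [Fintype I] in
theorem commutator_d (h : IsSuperCalculus 𝒜 p d) (a : I) {i : ZMod 2} {f : A} (hf : f ∈ 𝒜 i) :
    commutator (p a) i (d a) f = LinearMap.mulLeft ℝ (d a f) := by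
  ext u
  rw [commutator_apply, h.leibniz a hf, LinearMap.mulLeft_apply, add_sub_cancel_right]

theorem commutatorsVanish_mulLeft (h : IsSupercommutative 𝒜) {ε : ZMod 2} {f : A}
    (hf : f ∈ 𝒜 ε) : CommutatorsVanish 𝒜 1 ε (LinearMap.mulLeft ℝ f) :=
  fun _ _ hg => h.commutator_mulLeft hf hg

omit [Fintype I] in
theorem commutatorsVanish_d (h : IsSuperCalculus 𝒜 p d) (a : I) :
    CommutatorsVanish 𝒜 2 (p a) (d a) := by
  intro i f hf
  rw [h.commutator_d a hf, add_comm (p a)]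
  exact commutatorsVanish_mulLeft h.toIsSupercommutative (h.d_mem a hf)

theorem commutatorsVanish_firstOrder (h : IsSuperCalculus 𝒜 p d) {ε : ZMod 2} {T : I → A}
    (hT : ∀ a, T a ∈ 𝒜 (p a + ε)) :
    CommutatorsVanish 𝒜 2 ε (∑ a, LinearMap.mulLeft ℝ (T a) ∘ₗ d a) := by
  refine .sum _ fun a _ => ?_
  have := (commutatorsVanish_mulLeft h.toIsSupercommutative (hT a)).comp (h.commutatorsVanish_d a)
  rwa [add_right_comm, CharTwo.add_self_eq_zero, zero_add] at this

theorem ordLE_secondOrder (h : IsSuperCalculus 𝒜 p d) {ε : ZMod 2} {S : I → I → A} {T : I → A}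
    (hS : ∀ a b, S a b ∈ 𝒜 (p a + p b + ε)) (hT : ∀ a, T a ∈ 𝒜 (p a + ε)) :
    OrdLE 𝒜 2 ε (secondOrder d S T) := by
  refine .add (.smul (.sum _ fun a _ => .sum _ fun b _ => ?_) _)
    (h.commutatorsVanish_firstOrder hT).succ
  have := (commutatorsVanish_mulLeft h.toIsSupercommutative (hS a b)).comp
    ((h.commutatorsVanish_d b).comp (h.commutatorsVanish_d a))
  rwa [show p a + p b + ε + (p b + p a) = ε by
    generalize p a = i; generalize p b = j; clear * -; decide +revert] at this

theorem ordLE_firstOrder (h : IsSuperCalculus 𝒜 p d) {ε : ZMod 2} {T : I → A}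
    (hT : ∀ a, T a ∈ 𝒜 (p a + ε)) : OrdLE 𝒜 1 ε (secondOrder d 0 T) := by
  have e : secondOrder d 0 T = ∑ a, LinearMap.mulLeft ℝ (T a) ∘ₗ d a := by
    ext f
    simp [secondOrder_apply, LinearMap.sum_apply]
  rw [e]
  exact h.commutatorsVanish_firstOrder hT

omit [Fintype I] in
theorem d_d_mul (h : IsSuperCalculus 𝒜 p d) (a b : I) {i : ZMod 2} {f : A} (hf : f ∈ 𝒜 i) (g : A) :
    d b (d a (f * g)) = d b (d a f) * g + sgn (p b * (i + p a)) • (d a f * d b g) +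
      sgn (p a * i) • (d b f * d a g) + sgn (p a * i + p b * i) • (f * d b (d a g)) := by
  rw [h.leibniz a hf, map_add, map_smul, h.leibniz b (h.d_mem a hf), h.leibniz b hf, smul_add,
    sgn_smul_smul, ← add_assoc]

section Odd

variable (h : IsSuperCalculus 𝒜 p d) {S : I → I → A} {T : I → A}
  (hS : ∀ a b, S a b ∈ 𝒜 (p a + p b + 1)) (hSs : ∀ a b, S a b = sgn (p a * p b) • S b a)
  (hT : ∀ a, T a ∈ 𝒜 (p a + 1))

include h hS hT in
theorem hasParity_secondOrder : HasParity 𝒜 1 (secondOrder d S T) := by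
  intro i f hf
  rw [secondOrder_apply]
  refine Submodule.add_mem _ (Submodule.smul_mem _ _ (Submodule.sum_mem _ fun a _ =>
    Submodule.sum_mem _ fun b _ => ?_)) (Submodule.sum_mem _ fun a _ => ?_)
  · have := h.mul_mem (hS a b) (h.d_mem b (h.d_mem a hf))
    rwa [show p a + p b + 1 + (i + p a + p b) = i + 1 by
      generalize p a = i; generalize p b = j; clear * -; decide +revert] at this
  · have := h.mul_mem (hT a) (h.d_mem a hf)
    rwa [show p a + 1 + (i + p a) = i + 1 by
      generalize p a = i; clear * -; decide +revert] at this

include h hS hSs hT in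
theorem secondOrder_mul {i : ZMod 2} {f : A} (hf : f ∈ 𝒜 i) (g : A) :
    secondOrder d S T (f * g) = secondOrder d S T f * g + sgn i • (f * secondOrder d S T g) +
      ∑ a, ∑ b, sgn (p a * i) • (S a b * d b f * d a g) := by
  have h2 : ∀ a b, S a b * d b (d a (f * g)) = S a b * d b (d a f) * g +
      sgn (p b * (i + p a)) • (S a b * d a f * d b g) +
      sgn (p a * i) • (S a b * d b f * d a g) + sgn i • (f * (S a b * d b (d a g))) := by
    intro a b
    rw [h.d_d_mul a b hf]
    simp only [mul_add, mul_smul_comm, ← mul_assoc]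
    rw [h.comm (hS a b) hf, smul_mul_assoc, sgn_smul_smul]
    congr 3
    generalize p a = i; generalize p b = j; clear * -; decide +revert
  have h1 : ∀ a, T a * d a (f * g) = T a * d a f * g + sgn i • (f * (T a * d a g)) := by
    intro a
    rw [h.leibniz a hf]
    simp only [mul_add, mul_smul_comm, ← mul_assoc]
    rw [h.comm (hT a) hf, smul_mul_assoc, sgn_smul_smul]
    congr 3
    generalize p a = i; clear * -; decide +revert
  have hsymm : ∑ a, ∑ b, sgn (p b * (i + p a)) • (S a b * d a f * d b g) =
      ∑ a, ∑ b, sgn (p a * i) • (S a b * d b f * d a g) := by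
    rw [Finset.sum_comm]
    refine Finset.sum_congr rfl fun a _ => Finset.sum_congr rfl fun b _ => ?_
    rw [hSs b a, smul_mul_assoc, smul_mul_assoc, sgn_smul_smul]
    congr 2
    generalize p a = i; generalize p b = j; clear * -; decide +revert
  simp only [secondOrder_apply, h1, h2, Finset.sum_add_distrib, hsymm]
  simp only [← Finset.sum_mul, ← Finset.mul_sum, ← Finset.smul_sum, smul_add, add_mul, mul_add,
    smul_mul_assoc, mul_smul_comm]
  module

include h hS hSs hT in
/-- The bracket generated by `½ S^{ab} ∂_b ∂_a + T^a ∂_a` in coordinates. -/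
theorem bracket_secondOrder {i : ZMod 2} {f : A} (hf : f ∈ 𝒜 i) (g : A) :
    bracket (secondOrder d S T) i f g = ∑ a, ∑ b, sgn (p a * i) • (S a b * d b f * d a g) := by
  rw [bracket_eq (h.secondOrder_one S T), h.secondOrder_mul hS hSs hT hf]
  abel

end Odd

end IsSuperCalculus

end Calculus


/-! ### The square of a second-order operator in coordinates -/

section Square

variable {A : Type*} [Ring A] [Algebra ℝ A] {𝒜 : ZMod 2 → Submodule ℝ A}
  {I : Type*} [Fintype I] {p : I → ZMod 2} {d : I → A →ₗ[ℝ] A}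

variable (p d) in
/-- The third-order coefficients `K^{ace}`, contracted with `∂_a ∂_e ∂_c`, of the square of the odd
operator `½ S^{ab} ∂_b ∂_a + T^a ∂_a`. -/
def cubicCoeff (S : I → I → A) (a c e : I) : A :=
  (1 / 2 : ℝ) • ∑ b, sgn (p a * (p c + p e + 1)) • (S a b * d b (S c e))

variable (p d) in
/-- The second-order coefficients `N^{ce}`, contracted with `∂_e ∂_c`, of the square of the odd
operator `½ S^{ab} ∂_b ∂_a + T^a ∂_a`. -/
def quadCoeff (S : I → I → A) (T : I → A) (c e : I) : A :=
  (1 / 2 : ℝ) • secondOrder d S T (S c e) +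
    ∑ b, sgn (p e * (p c + 1)) • (S e b * d b (T c))

namespace IsSuperCalculus

variable (h : IsSuperCalculus 𝒜 p d) {S : I → I → A} {T : I → A}
  (hS : ∀ a b, S a b ∈ 𝒜 (p a + p b + 1)) (hSs : ∀ a b, S a b = sgn (p a * p b) • S b a)
  (hT : ∀ a, T a ∈ 𝒜 (p a + 1))

include h hS hT in
/-- The terms of the square of `Δ = ½ S^{ab} ∂_b ∂_a + T^a ∂_a` in which the left factor does not
differentiate the coefficients of the right one cancel. -/
theorem sum_coeff_mul_secondOrder (f : A) :
    (1 / 2 : ℝ) • ∑ c, ∑ e, sgn (p c + p e + 1) • (S c e * secondOrder d S T (d e (d c f))) +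
      ∑ c, sgn (p c + 1) • (T c * secondOrder d S T (d c f)) = 0 := by
  -- `Δ` as a single sum of operators `∂_b ∂_a` and `∂_a` with coefficients
  let U : (I × I) ⊕ I → A := Sum.elim (fun α => (1 / 2 : ℝ) • S α.1 α.2) T
  let P : (I × I) ⊕ I → A →ₗ[ℝ] A := Sum.elim (fun α => d α.2 ∘ₗ d α.1) d
  let q : (I × I) ⊕ I → ZMod 2 := Sum.elim (fun α => p α.1 + p α.2) p
  have hU : ∀ α, U α ∈ 𝒜 (q α + 1) := by
    rintro (⟨a, b⟩ | a)
    · exact Submodule.smul_mem _ _ (hS a b)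
    · exact hT a
  have hP1 : ∀ α a g, P α (d a g) = sgn (q α * p a) • d a (P α g) := by
    rintro (⟨a, b⟩ | a) c g
    · change d b (d a (d c g)) = sgn ((p a + p b) * p c) • d c (d b (d a g))
      rw [h.d_comm a c, map_smul, h.d_comm b c, sgn_smul_smul, add_mul]
    · exact h.d_comm a c g
  have hP : ∀ α β, P α (P β f) = sgn (q α * q β) • P β (P α f) := by
    rintro α (⟨a, b⟩ | a)
    · change P α (d b (d a f)) = sgn (q α * (p a + p b)) • d b (d a (P α f))
      rw [hP1, hP1, map_smul, sgn_smul_smul, mul_add, add_comm]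
    · exact hP1 α a f
  have hΔ : ∀ g, secondOrder d S T g = ∑ β, U β * P β g := by
    intro g
    simp only [U, P, secondOrder_apply, Fintype.sum_sum_type, Fintype.sum_prod_type, Sum.elim_inl,
      Sum.elim_inr, LinearMap.comp_apply, smul_mul_assoc, Finset.smul_sum]
  have key := h.sum_odd_mul_odd_eq_zero (p := q) hU (r := fun α β => P β (P α f))
    (fun α β => by rw [hP β α, mul_comm])
  have hsum : ∀ α, ∑ β, sgn (q α) • (U α * U β * P β (P α f)) =
      sgn (q α) • (U α * secondOrder d S T (P α f)) := by
    intro α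
    simp only [hΔ, Finset.mul_sum, Finset.smul_sum, mul_assoc]
  simp only [hsum, Fintype.sum_sum_type, Fintype.sum_prod_type, U, P, q, Sum.elim_inl,
      Sum.elim_inr, LinearMap.comp_apply, smul_mul_assoc] at key
  have hneg : ∀ (i : ZMod 2) (x : A), sgn (i + 1) • x = - (sgn i • x) := by
    intro i x
    rw [sgn_add, sgn_one, mul_neg_one, neg_smul]
  simp only [hneg, Finset.sum_neg_distrib, smul_neg]
  rw [← neg_add, neg_eq_zero, ← key]
  simp only [Finset.smul_sum]
  congr 1
  exact Finset.sum_congr rfl fun a _ => Finset.sum_congr rfl fun b _ => smul_comm _ _ _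

include h hS hSs hT in
/-- The square of the odd operator `½ S^{ab} ∂_b ∂_a + T^a ∂_a` in coordinates. -/
theorem secondOrder_secondOrder (f : A) :
    secondOrder d S T (secondOrder d S T f) =
      ∑ a, ∑ c, ∑ e, cubicCoeff p d S a c e * d a (d e (d c f)) +
      ∑ c, ∑ e, quadCoeff p d S T c e * d e (d c f) +
      ∑ c, secondOrder d S T (T c) * d c f := by
  have h1 : secondOrder d S T (secondOrder d S T f) =
      (1 / 2 : ℝ) • ∑ c, ∑ e, (secondOrder d S T (S c e) * d e (d c f) +
        sgn (p c + p e + 1) • (S c e * secondOrder d S T (d e (d c f))) +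
        ∑ a, ∑ b, sgn (p a * (p c + p e + 1)) • (S a b * d b (S c e) * d a (d e (d c f)))) +
      ∑ c, (secondOrder d S T (T c) * d c f + sgn (p c + 1) • (T c * secondOrder d S T (d c f)) +
        ∑ a, ∑ b, sgn (p a * (p c + 1)) • (S a b * d b (T c) * d a (d c f))) := by
    conv_lhs => rw [secondOrder_apply (d := d) S T f]
    simp only [map_add, map_smul, map_sum]
    refine congrArg₂ (· + ·) (congrArg _ ?_) ?_
    · refine Finset.sum_congr rfl fun c _ => Finset.sum_congr rfl fun e _ => ?_
      rw [h.secondOrder_mul hS hSs hT (hS c e)]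
    · refine Finset.sum_congr rfl fun c _ => ?_
      rw [h.secondOrder_mul hS hSs hT (hT c)]
  have h3 : ∑ a, ∑ c, ∑ e, cubicCoeff p d S a c e * d a (d e (d c f)) =
      (1 / 2 : ℝ) • ∑ c, ∑ e, ∑ a, ∑ b,
        sgn (p a * (p c + p e + 1)) • (S a b * d b (S c e) * d a (d e (d c f))) := by
    rw [Finset.sum_comm, Finset.smul_sum]
    refine Finset.sum_congr rfl fun c _ => ?_
    rw [Finset.sum_comm, Finset.smul_sum]
    refine Finset.sum_congr rfl fun e _ => ?_
    rw [Finset.smul_sum]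
    refine Finset.sum_congr rfl fun a _ => ?_
    simp only [cubicCoeff, smul_mul_assoc, Finset.sum_mul]
  have h2 : ∑ c, ∑ e, quadCoeff p d S T c e * d e (d c f) =
      (1 / 2 : ℝ) • ∑ c, ∑ e, secondOrder d S T (S c e) * d e (d c f) +
      ∑ c, ∑ a, ∑ b, sgn (p a * (p c + 1)) • (S a b * d b (T c) * d a (d c f)) := by
    simp only [quadCoeff, add_mul, smul_mul_assoc, Finset.sum_mul, Finset.sum_add_distrib,
      Finset.smul_sum]
  rw [h1, h2, h3]
  have h0 := h.sum_coeff_mul_secondOrder hS hT f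
  simp only [Finset.sum_add_distrib, smul_add] at h0 ⊢
  rw [← sub_eq_zero, ← h0]
  abel

include h hS in
theorem cubicCoeff_mem (a c e : I) : cubicCoeff p d S a c e ∈ 𝒜 (p a + p c + p e) := by
  refine Submodule.smul_mem _ _ (Submodule.sum_mem _ fun b _ => Submodule.smul_mem _ _ ?_)
  have := h.mul_mem (hS a b) (h.d_mem b (hS c e))
  rwa [show p a + p b + 1 + (p c + p e + 1 + p b) = p a + p c + p e by
    generalize p a = i; generalize p b = j; generalize p c = k; generalize p e = l
    clear * -; decide +revert] at this

include hSs in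
theorem cubicCoeff_symm (a c e : I) :
    cubicCoeff p d S a c e = sgn (p c * p e) • cubicCoeff p d S a e c := by
  have h1 : ∀ b, sgn (p a * (p c + p e + 1)) • (S a b * d b (S c e)) =
      sgn (p c * p e) • sgn (p a * (p e + p c + 1)) • (S a b * d b (S e c)) := by
    intro b
    rw [hSs c e, map_smul, mul_smul_comm, smul_comm, add_comm (p c)]
  simp only [cubicCoeff]
  rw [Finset.sum_congr rfl fun b _ => h1 b, ← Finset.smul_sum, smul_comm]

include h hS hT in
theorem quadCoeff_mem (c e : I) : quadCoeff p d S T c e ∈ 𝒜 (p c + p e) := by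
  refine Submodule.add_mem _ (Submodule.smul_mem _ _ ?_)
    (Submodule.sum_mem _ fun b _ => Submodule.smul_mem _ _ ?_)
  · have := h.hasParity_secondOrder hS hT _ _ (hS c e)
    rwa [add_assoc _ (1 : ZMod 2), CharTwo.add_self_eq_zero, add_zero] at this
  · have := h.mul_mem (hS e b) (h.d_mem b (hT c))
    rwa [show p e + p b + 1 + (p c + 1 + p b) = p c + p e by
      generalize p b = j; generalize p c = k; generalize p e = l
      clear * -; decide +revert] at this

include h hS hSs hT in
/-- If the third-order symbol of the square vanishes, so does its third-order part. -/
theorem square_eq_of_cyc₃ (hK : ∀ b c e, cyc₃ p (cubicCoeff p d S) b c e = 0) :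
    secondOrder d S T ∘ₗ secondOrder d S T =
      secondOrder d ((2 : ℝ) • quadCoeff p d S T) (fun c => secondOrder d S T (T c)) := by
  ext f
  rw [LinearMap.comp_apply, h.secondOrder_secondOrder hS hSs hT, secondOrder_apply,
    sum_mul_eq_zero_of_cyc₃ hK (r := fun a e c => d a (d e (d c f))) (fun a b c => h.d_comm a b _)
      (fun a b c => by rw [h.d_comm b c, map_smul]), zero_add]
  simp only [Pi.smul_apply, smul_mul_assoc, Finset.smul_sum, smul_smul]
  norm_num

include h hS hSs hT in
/-- If moreover the second-order symbol of the square vanishes, the square is a vector field. -/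
theorem square_eq_of_cyc₂ (hK : ∀ b c e, cyc₃ p (cubicCoeff p d S) b c e = 0)
    (hN : ∀ a b, cyc₂ p (quadCoeff p d S T) a b = 0) :
    secondOrder d S T ∘ₗ secondOrder d S T =
      secondOrder d 0 (fun c => secondOrder d S T (T c)) := by
  ext f
  rw [LinearMap.comp_apply, h.secondOrder_secondOrder hS hSs hT, secondOrder_apply,
    sum_mul_eq_zero_of_cyc₃ hK (r := fun a e c => d a (d e (d c f))) (fun a b c => h.d_comm a b _)
      (fun a b c => by rw [h.d_comm b c, map_smul]),
    sum_mul_eq_zero_of_cyc₂ hN (r := fun a b => d a (d b f)) (fun a b => h.d_comm a b _)]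
  simp

include h hS hSs hT in
theorem ordLE_two_sq (hK : ∀ b c e, cyc₃ p (cubicCoeff p d S) b c e = 0) :
    OrdLE 𝒜 2 0 (secondOrder d S T ∘ₗ secondOrder d S T) := by
  rw [h.square_eq_of_cyc₃ hS hSs hT hK]
  refine h.ordLE_secondOrder (fun a b => ?_) fun a => ?_
  · rw [add_zero]
    exact Submodule.smul_mem _ _ (h.quadCoeff_mem hS hT a b)
  · have := h.hasParity_secondOrder hS hT _ _ (hT a)
    rwa [add_assoc, CharTwo.add_self_eq_zero] at this

include h hS hSs hT in
theorem ordLE_one_sq (hK : ∀ b c e, cyc₃ p (cubicCoeff p d S) b c e = 0)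
    (hN : ∀ a b, cyc₂ p (quadCoeff p d S T) a b = 0) :
    OrdLE 𝒜 1 0 (secondOrder d S T ∘ₗ secondOrder d S T) := by
  rw [h.square_eq_of_cyc₂ hS hSs hT hK hN]
  refine h.ordLE_firstOrder fun a => ?_
  have := h.hasParity_secondOrder hS hT _ _ (hT a)
  rwa [add_assoc, CharTwo.add_self_eq_zero] at this

variable [DecidableEq I] {x : I → A} (hx : ∀ a, x a ∈ 𝒜 (p a))
  (hdx : ∀ a b, d a (x b) = if a = b then 1 else 0)

include h hS hSs hT hdx in
theorem bracket_coord {i : ZMod 2} {f : A} (hf : f ∈ 𝒜 i) (c : I) :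
    bracket (secondOrder d S T) i f (x c) = ∑ b, sgn (p c * i) • (S c b * d b f) := by
  rw [h.bracket_secondOrder hS hSs hT hf, Finset.sum_eq_single c]
  · simp [hdx]
  · intro a _ ha
    simp [hdx, ha]
  · simp

include h hS hSs hT hx hdx in
theorem bracket_coord_coord (a c : I) :
    bracket (secondOrder d S T) (p a) (x a) (x c) = S a c := by
  rw [h.bracket_coord hS hSs hT hdx (hx a), Finset.sum_eq_single a]
  · rw [hSs a c, mul_comm (p c)]
    simp [hdx]
  · intro b _ hb
    simp [hdx, hb]
  · simp

include h hdx in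
theorem secondOrder_coord (c : I) : secondOrder d S T (x c) = T c := by
  have : ∀ a b, d b (if a = c then (1 : A) else 0) = 0 := by
    intro a b
    split_ifs
    · exact h.d_one b
    · exact map_zero _
  simp [secondOrder_apply, hdx, this]

omit [Fintype I] in
include h hx hdx in
theorem d_d_coord_mul_coord (a b c e : I) : d e (d c (x a * x b)) =
    (if c = a ∧ e = b then 1 else 0) +
      sgn (p a * p b) • (if c = b ∧ e = a then (1 : A) else 0) := by
  have h1 : ∀ c a : I, d e (if c = a then (1 : A) else 0) = 0 := by
    intro c a
    split_ifs
    · exact h.d_one e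
    · exact map_zero _
  rw [h.d_d_mul c e (hx a)]
  simp only [hdx, h1]
  by_cases h1 : c = a <;> by_cases h2 : e = b <;> by_cases h3 : c = b <;> by_cases h4 : e = a <;>
    subst_vars <;> simp_all [CharTwo.add_self_eq_zero, sgn_zero]
  rw [mul_comm]

include h hSs hx hdx in
/-- The coefficients `S^{ab}` are determined by the operator. -/
theorem secondOrder_coord_mul_coord (a b : I) : secondOrder d S T (x a * x b) =
    S a b + T a * x b + sgn (p a * p b) • (T b * x a) := by
  have h1 : ∀ c, d c (x a * x b) = (if c = a then 1 else 0) * x b +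
      sgn (p a * p b) • ((if c = b then 1 else 0) * x a) := by
    intro c
    rw [h.leibniz c (hx a), hdx, hdx]
    congr 1
    split_ifs with hc
    · rw [hc, mul_one, one_mul, mul_comm (p b)]
    · simp
  rw [secondOrder_apply]
  simp only [h.d_d_coord_mul_coord hx hdx]
  simp only [h1]
  have h2 : ∑ c, ∑ e, S c e * ((if c = a ∧ e = b then 1 else 0) +
      sgn (p a * p b) • (if c = b ∧ e = a then (1 : A) else 0)) =
      S a b + sgn (p a * p b) • S b a := by
    simp only [mul_add, mul_smul_comm, Finset.sum_add_distrib, ite_and, mul_ite, mul_one, mul_zero]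
    simp [Finset.sum_ite_eq']
  have h3 : ∑ c, T c * ((if c = a then 1 else 0) * x b +
      sgn (p a * p b) • ((if c = b then 1 else 0) * x a)) =
      T a * x b + sgn (p a * p b) • (T b * x a) := by
    simp only [mul_add, mul_smul_comm, Finset.sum_add_distrib, ite_mul, one_mul, zero_mul, mul_ite,
      mul_zero]
    simp [Finset.sum_ite_eq']
  rw [h2, h3, ← hSs a b, ← add_assoc]
  module

include h hS hSs hT hx hdx in
/-- The Jacobiator of the coordinates is the total symbol of the third-order part of the square. -/
theorem jacobi_coord (b c e : I) :
    bracket (secondOrder d S T) (p b + p c + 1)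
          (bracket (secondOrder d S T) (p b) (x b) (x c)) (x e)
      + sgn (p c * p e) • bracket (secondOrder d S T) (p b + p e + 1)
          (bracket (secondOrder d S T) (p b) (x b) (x e)) (x c)
      + sgn (p b * (p c + p e)) • bracket (secondOrder d S T) (p c + p e + 1)
          (bracket (secondOrder d S T) (p c) (x c) (x e)) (x b) =
      (2 : ℝ) • cyc₃ p (cubicCoeff p d S) b c e := by
  simp only [h.bracket_coord_coord hS hSs hT hx hdx, h.bracket_coord hS hSs hT hdx (hS _ _),
    cyc₃, cubicCoeff]
  module

include h hS hSs hT hx hdx in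
/-- The failure of `Δ` to be a derivation of its bracket on coordinates is the total symbol of the
second-order part of `Δ²`. -/
theorem derivation_coord (a c : I) :
    secondOrder d S T (bracket (secondOrder d S T) (p a) (x a) (x c)) +
      bracket (secondOrder d S T) (p a + 1) (secondOrder d S T (x a)) (x c) +
      sgn (p a) • bracket (secondOrder d S T) (p a) (x a) (secondOrder d S T (x c)) =
      cyc₂ p (quadCoeff p d S T) a c := by
  have hodd := h.hasParity_secondOrder hS hT
  rw [h.bracket_coord_coord hS hSs hT hx hdx, h.secondOrder_coord hdx, h.secondOrder_coord hdx,
    bracket_symm h.toIsSupercommutative hodd (h.secondOrder_one S T) (hx a) (hT c),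
    h.bracket_coord hS hSs hT hdx (hT a), h.bracket_coord hS hSs hT hdx (hT c), sgn_smul_smul,
    show p a + p a * (p c + 1) = p a * p c by
      generalize p a = i; generalize p c = j; clear * -; decide +revert]
  have : secondOrder d S T (S a c) = (1 / 2 : ℝ) • secondOrder d S T (S a c) +
      sgn (p a * p c) • (1 / 2 : ℝ) • secondOrder d S T (S c a) := by
    conv_lhs => rw [hSs a c, map_smul]
    conv_rhs => rw [hSs a c, map_smul]
    module
  simp only [cyc₂, quadCoeff, smul_add]
  conv_lhs => rw [this]
  abel

/-! ### Evaluation of global conditions on coordinates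

Here `G` plays the role of the algebra of global functions, `σ` is the local representation in a
chart, `ρ` the restriction to an open set near a point, and `F a` a global function that coincides
with the coordinate `x a` on that open set. -/

section Transfer

variable {G A' : Type*} [Ring G] [Algebra ℝ G] [Ring A'] [Algebra ℝ A']
  {𝒢 : ZMod 2 → Submodule ℝ G} (hG : IsSupercommutative 𝒢) {Δ : G →ₗ[ℝ] G} (hodd : HasParity 𝒢 1 Δ)
  {σ : G →ₐ[ℝ] A} (hσ : ∀ f, σ (Δ f) = secondOrder d S T (σ f))
  {ρ : A →ₐ[ℝ] A'} (hρ : ∀ a f g, ρ f = ρ g → ρ (d a f) = ρ (d a g))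
  {F : I → G} (hF : ∀ a, F a ∈ 𝒢 (p a)) (hFx : ∀ a, ρ (σ (F a)) = ρ (x a))

omit [DecidableEq I] in
include hρ in
/-- Differential operators are local. -/
theorem secondOrder_congr {f g : A} (hfg : ρ f = ρ g) :
    ρ (secondOrder d S T f) = ρ (secondOrder d S T g) := by
  simp only [secondOrder_apply, map_add, map_smul, map_sum, map_mul]
  congr 1
  · congr 1
    exact Finset.sum_congr rfl fun a _ => Finset.sum_congr rfl fun b _ => by
      rw [hρ b _ _ (hρ a _ _ hfg)]
  · exact Finset.sum_congr rfl fun a _ => by rw [hρ a _ _ hfg]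

omit [DecidableEq I] in
include hσ hρ in
theorem map_operator {u : G} {f : A} (hu : ρ (σ u) = ρ f) :
    ρ (σ (Δ u)) = ρ (secondOrder d S T f) := by
  rw [hσ]
  exact secondOrder_congr hρ hu

omit [DecidableEq I] in
include hσ hρ in
theorem map_bracket (i : ZMod 2) {u v : G} {f g : A} (hu : ρ (σ u) = ρ f) (hv : ρ (σ v) = ρ g) :
    ρ (σ (bracket Δ i u v)) = ρ (bracket (secondOrder d S T) i f g) := by
  have h1 : ρ (σ 1) = ρ 1 := by rw [map_one]
  have huv : ρ (σ (u * v)) = ρ (f * g) := by rw [map_mul, map_mul, map_mul, hu, hv]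
  simp only [bracket, map_add, map_sub, map_mul, map_smul, map_operator hσ hρ huv,
    map_operator hσ hρ hu, map_operator hσ hρ hv, map_operator hσ hρ h1, hu, hv]

include h hσ hρ hF hFx hdx hodd in
/-- Locally, `T^a` is the value of `Δ` on a global function, which gives its parity. -/
theorem exists_map_eq_firstCoeff (a : I) : ∃ g ∈ 𝒢 (p a + 1), ρ (σ g) = ρ (T a) :=
  ⟨_, hodd _ _ (hF a), by rw [map_operator hσ hρ (hFx a), h.secondOrder_coord hdx]⟩

include h hσ hρ hF hFx hx hdx hodd hSs hG in
/-- Locally, `S^{ab}` is a combination of values of `Δ` on global functions, which gives its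
parity. -/
theorem exists_map_eq_secondCoeff (a b : I) :
    ∃ g ∈ 𝒢 (p a + p b + 1), ρ (σ g) = ρ (S a b) := by
  refine ⟨Δ (F a * F b) - Δ (F a) * F b - sgn (p a * p b) • (Δ (F b) * F a),
    Submodule.sub_mem _ (Submodule.sub_mem _ (hodd _ _ (hG.mul_mem (hF a) (hF b))) ?_)
      (Submodule.smul_mem _ _ ?_), ?_⟩
  · have := hG.mul_mem (hodd _ _ (hF a)) (hF b)
    rwa [add_right_comm] at this
  · have := hG.mul_mem (hodd _ _ (hF b)) (hF a)
    rwa [add_right_comm, add_comm (p b)] at this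
  · have hab : ρ (σ (F a * F b)) = ρ (x a * x b) := by
      rw [map_mul, map_mul, map_mul, hFx, hFx]
    simp only [map_sub, map_smul, map_mul, map_operator hσ hρ hab, map_operator hσ hρ (hFx _), hFx]
    rw [h.secondOrder_coord_mul_coord hSs hx hdx, h.secondOrder_coord hdx, h.secondOrder_coord hdx]
    simp only [map_add, map_smul, map_mul]
    abel

include h hS hSs hT hσ hρ hF hFx hx hdx in
theorem map_cyc₃_eq_zero (hJ : Jacobi3 𝒢 Δ) (b c e : I) :
    ρ (cyc₃ p (cubicCoeff p d S) b c e) = 0 := by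
  have h0 := congrArg (fun f => ρ (σ f)) (hJ _ _ _ _ (hF b) _ (hF c) _ (hF e))
  have hb := fun a b => map_bracket hσ hρ (p a) (hFx a) (hFx b)
  simp only [map_add, map_smul, map_bracket hσ hρ _ (hb _ _) (hFx _), map_zero] at h0
  simp only [← map_smul, ← map_add] at h0
  rw [h.jacobi_coord hS hSs hT hx hdx, map_smul] at h0
  exact (smul_eq_zero_iff_right two_ne_zero).1 h0

include h hS hSs hT hσ hρ hF hFx hx hdx in
theorem map_cyc₂_eq_zero (hJ : Jacobi2 𝒢 Δ) (a c : I) :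
    ρ (cyc₂ p (quadCoeff p d S T) a c) = 0 := by
  have h0 := congrArg (fun f => ρ (σ f)) (hJ _ _ _ (hF a) _ (hF c))
  have hΔ := fun a => map_operator hσ hρ (hFx a)
  simp only [map_sub, map_neg, map_smul,
    map_operator hσ hρ (map_bracket hσ hρ (p a) (hFx a) (hFx c)),
    map_bracket hσ hρ _ (hΔ a) (hFx c), map_bracket hσ hρ _ (hFx a) (hΔ c)] at h0
  rw [← h.derivation_coord hS hSs hT hx hdx, map_add, map_add, map_smul, h0]
  abel

end Transfer

end IsSuperCalculus

end Square


/-! ### Odd Hamiltonian vector fields -/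

section Hamiltonian

variable {A : Type*} [Ring A] [Algebra ℝ A] {𝒜 : ZMod 2 → Submodule ℝ A}
  {I : Type*} [Fintype I] {p : I → ZMod 2} {dx dp : I → A →ₗ[ℝ] A}

variable (p dx dp) in
/-- The Hamiltonian vector field of an odd function `s`: `F ↦ (s, F)` in Darboux coordinates, `dx a`
and `dp a` being the derivatives in the `a`-th position and momentum, both of parity `p a`. -/
def hamilton (s F : A) : A :=
  ∑ a, (dp a s * dx a F - sgn (p a) • (dx a s * dp a F))

variable (dx dp) in
/-- The operator `∑ ∂²/∂x^a∂p_a`. -/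
def divergence (s : A) : A := ∑ a, dx a (dp a s)

/-- The odd vector field `∑ V^a ∂_a` squares to zero if it annihilates its own coefficients. -/
theorem IsSuperCalculus.vectorField_sq {d : I → A →ₗ[ℝ] A} (h : IsSuperCalculus 𝒜 p d) {V : I → A}
    (hV : ∀ a, V a ∈ 𝒜 (p a + 1)) (h0 : ∀ b, ∑ a, V a * d a (V b) = 0) (F : A) :
    ∑ a, V a * d a (∑ b, V b * d b F) = 0 := by
  have h1 : ∀ a, V a * d a (∑ b, V b * d b F) = ∑ b, V a * d a (V b) * d b F +
      ∑ b, sgn (p a) • (V a * V b * d b (d a F)) := by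
    intro a
    rw [map_sum, Finset.mul_sum, ← Finset.sum_add_distrib]
    refine Finset.sum_congr rfl fun b _ => ?_
    rw [h.leibniz a (hV b), h.d_comm a b]
    simp only [mul_add, mul_smul_comm, sgn_smul_smul, mul_assoc]
    congr 3
    generalize p a = i; generalize p b = j; clear * -; decide +revert
  simp only [h1, Finset.sum_add_distrib]
  rw [h.sum_odd_mul_odd_eq_zero hV (r := fun a b => d b (d a F))
    (fun a b => by rw [h.d_comm b a, mul_comm]), add_zero, Finset.sum_comm]
  simp [← Finset.sum_mul, h0]

/-- The Hamiltonian vector field in the form `∑ V^α ∂_α`, where `α` runs over the positions and the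
momenta. -/
theorem hamilton_eq_sum (s F : A) : hamilton p dx dp s F =
    ∑ α : I ⊕ I, Sum.elim (fun a => dp a s) (fun a => sgn (p a + 1) • dx a s) α *
      (Sum.elim dx dp : I ⊕ I → A →ₗ[ℝ] A) α F := by
  simp only [hamilton, Fintype.sum_sum_type, Sum.elim_inl, Sum.elim_inr, sub_eq_add_neg,
    Finset.sum_add_distrib]
  congr 1
  refine Finset.sum_congr rfl fun a _ => ?_
  rw [sgn_add, sgn_one, mul_neg_one, neg_smul, neg_mul, smul_mul_assoc]

namespace IsSuperCalculus

variable (h : IsSuperCalculus 𝒜 (Sum.elim p p) (Sum.elim dx dp)) {s : A} (hs : s ∈ 𝒜 1)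

omit [Fintype I] in
include h in
theorem dx_mem {i : ZMod 2} {f : A} (hf : f ∈ 𝒜 i) (a : I) : dx a f ∈ 𝒜 (i + p a) :=
  h.d_mem (Sum.inl a) hf

omit [Fintype I] in
include h in
theorem dp_mem {i : ZMod 2} {f : A} (hf : f ∈ 𝒜 i) (a : I) : dp a f ∈ 𝒜 (i + p a) :=
  h.d_mem (Sum.inr a) hf

omit [Fintype I] in
include h in
theorem dx_dx (a b : I) (f : A) : dx a (dx b f) = sgn (p a * p b) • dx b (dx a f) :=
  h.d_comm (Sum.inl a) (Sum.inl b) f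

omit [Fintype I] in
include h in
theorem dp_dp (a b : I) (f : A) : dp a (dp b f) = sgn (p a * p b) • dp b (dp a f) :=
  h.d_comm (Sum.inr a) (Sum.inr b) f

omit [Fintype I] in
include h in
theorem dp_dx (a b : I) (f : A) : dp a (dx b f) = sgn (p a * p b) • dx b (dp a f) :=
  h.d_comm (Sum.inr a) (Sum.inl b) f

include h hs in
theorem hamilton_self : hamilton p dx dp s s = (2 : ℝ) • ∑ a, dp a s * dx a s := by
  rw [Finset.smul_sum]
  refine Finset.sum_congr rfl fun a _ => ?_
  rw [h.comm (h.dx_mem hs a) (h.dp_mem hs a), two_smul, sgn_smul_smul, sub_eq_add_neg,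
    neg_eq_sgn_smul, sgn_smul_smul, sgn_smul_eq_self]
  generalize p a = i; clear * -; decide +revert

include h hs in
theorem sum_dp_mul_dx_eq_zero (h0 : hamilton p dx dp s s = 0) : ∑ a, dp a s * dx a s = 0 := by
  rw [h.hamilton_self hs] at h0
  exact (smul_eq_zero_iff_right two_ne_zero).1 h0

include h hs in
/-- The derivatives of a solution of the master equation are annihilated by its Hamiltonian vector
field: a derivative of `(s, s)` is, up to a factor, the bracket of `s` with the derivative of
`s`. -/
theorem hamilton_d (h0 : hamilton p dx dp s s = 0) (β : I ⊕ I) :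
    hamilton p dx dp s ((Sum.elim dx dp : I ⊕ I → A →ₗ[ℝ] A) β s) = 0 := by
  obtain ⟨D, hD⟩ : ∃ D, D = (Sum.elim dx dp : I ⊕ I → A →ₗ[ℝ] A) β := ⟨_, rfl⟩
  obtain ⟨q, hq⟩ : ∃ q, q = Sum.elim p p β := ⟨_, rfl⟩
  have hl : ∀ {i f}, f ∈ 𝒜 i → ∀ g, D (f * g) = D f * g + sgn (q * i) • (f * D g) := by
    rw [hD, hq]
    exact fun hf g => h.leibniz β hf g
  have hx : ∀ a, D (dx a s) = sgn (q * p a) • dx a (D s) := by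
    rw [hD, hq]
    exact fun a => h.d_comm β (Sum.inl a) s
  have hp : ∀ a, D (dp a s) = sgn (q * p a) • dp a (D s) := by
    rw [hD, hq]
    exact fun a => h.d_comm β (Sum.inr a) s
  have hm : D s ∈ 𝒜 (1 + q) := by
    rw [hD, hq]
    exact h.d_mem β hs
  rw [← hD]
  have h1 : ∀ a, D (dp a s * dx a s) =
      sgn q • (dp a s * dx a (D s) - sgn (p a) • (dx a s * dp a (D s))) := by
    intro a
    rw [hl (h.dp_mem hs a), hx, hp, h.comm (h.dx_mem hs a) (h.dp_mem hm a)]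
    simp only [smul_sub, smul_mul_assoc, mul_smul_comm, sgn_smul_smul]
    rw [sub_eq_add_neg, neg_eq_sgn_smul, sgn_smul_smul, add_comm]
    congr 3 <;>
    · generalize p a = i; clear * -; decide +revert
  have h2 := congrArg D (h.sum_dp_mul_dx_eq_zero hs h0)
  rw [map_sum, map_zero, Finset.sum_congr rfl fun a _ => h1 a, ← Finset.smul_sum] at h2
  exact sgn_smul_eq_zero h2

include h hs in
/-- The Hamiltonian vector field of an odd solution of the master equation squares to zero. -/
theorem hamilton_hamilton (h0 : hamilton p dx dp s s = 0) (F : A) :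
    hamilton p dx dp s (hamilton p dx dp s F) = 0 := by
  rw [hamilton_eq_sum s F, hamilton_eq_sum]
  refine h.vectorField_sq ?_ ?_ F
  · rintro (a | a)
    · have := h.dp_mem hs a
      rwa [add_comm] at this
    · have := h.dx_mem hs a
      rw [add_comm] at this
      exact Submodule.smul_mem _ _ this
  · intro β
    rw [← hamilton_eq_sum]
    rcases β with a | a
    · exact h.hamilton_d hs h0 (Sum.inr a)
    · have := h.hamilton_d hs h0 (Sum.inl a)
      rw [Sum.elim_inl] at this
      rw [hamilton_eq_sum] at this ⊢
      simp only [Sum.elim_inr, map_smul, mul_smul_comm]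
      rw [← Finset.smul_sum, this, smul_zero]

include h hs in
/-- The operator `divergence`, applied to the master equation. -/
theorem hamilton_divergence (h0 : hamilton p dx dp s s = 0) :
    hamilton p dx dp s (divergence dx dp s) =
      -∑ e, ∑ a, sgn (p e * p a) • (dp e (dp a s) * dx e (dx a s)) := by
  have h1 : ∀ e a, dx e (dp e (dp a s * dx a s)) = dp a (dx e (dp e s)) * dx a s +
      dp a s * dx a (dx e (dp e s)) + sgn (p e * p a) • (dp e (dp a s) * dx e (dx a s)) +
      sgn (p e) • (dx e (dp a s) * dx a (dp e s)) := by
    intro e a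
    have l1 : ∀ g, dp e (dp a s * g) = _ := fun g => h.leibniz (Sum.inr e) (h.dp_mem hs a) g
    have l2 : ∀ g, dx e (dp e (dp a s) * g) = _ := fun g =>
      h.leibniz (Sum.inl e) (h.dp_mem (h.dp_mem hs a) e) g
    have l3 : ∀ g, dx e (dp a s * g) = _ := fun g => h.leibniz (Sum.inl e) (h.dp_mem hs a) g
    have c1 : dx e (dp e (dp a s)) = dp a (dx e (dp e s)) := by
      rw [h.dp_dp e a, map_smul, h.dp_dx a e, mul_comm (p a)]
    have c2 : dx e (dp e (dx a s)) = dx a (dx e (dp e s)) := by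
      rw [h.dp_dx e a, map_smul, h.dx_dx a e, mul_comm (p a)]
    simp only [Sum.elim_inl, Sum.elim_inr] at l1 l2 l3
    rw [l1, map_add, map_smul, l2, l3, c1, c2, h.dp_dx e a]
    simp only [smul_add, mul_smul_comm, sgn_smul_smul]
    rw [sgn_smul_eq_self (CharTwo.add_self_eq_zero _),
      show p e * (1 + p a + p e) = p e * p a by
        generalize p a = i; generalize p e = j; clear * -; decide +revert,
      show p e * (1 + p a) + p e * p a = p e by
        generalize p a = i; generalize p e = j; clear * -; decide +revert]
    abel
  have h2 : ∑ e, ∑ a, sgn (p e) • (dx e (dp a s) * dx a (dp e s)) = 0 := by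
    refine eq_zero_of_eq_neg ?_
    conv_lhs => rw [Finset.sum_comm]
    simp only [← Finset.sum_neg_distrib]
    refine Finset.sum_congr rfl fun e _ => Finset.sum_congr rfl fun a _ => ?_
    rw [h.comm (h.dx_mem (h.dp_mem hs e) a) (h.dx_mem (h.dp_mem hs a) e), neg_eq_sgn_smul,
      sgn_smul_smul, sgn_smul_smul]
    congr 2
    generalize p a = i; generalize p e = j; clear * -; decide +revert
  have h3 : ∀ a, dp a s * dx a (divergence dx dp s) -
      sgn (p a) • (dx a s * dp a (divergence dx dp s)) =
      ∑ e, (dp a (dx e (dp e s)) * dx a s + dp a s * dx a (dx e (dp e s))) := by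
    intro a
    have hm : ∀ e, dx e (dp e s) ∈ 𝒜 1 := by
      intro e
      have := h.dx_mem (h.dp_mem hs e) e
      rwa [add_assoc, CharTwo.add_self_eq_zero, add_zero] at this
    simp only [divergence, map_sum, Finset.mul_sum, Finset.smul_sum]
    rw [← Finset.sum_sub_distrib]
    refine Finset.sum_congr rfl fun e _ => ?_
    rw [h.comm (h.dx_mem hs a) (h.dp_mem (hm e) a), sgn_smul_smul, sub_eq_add_neg,
      neg_eq_sgn_smul, sgn_smul_smul, sgn_smul_eq_self, add_comm]
    generalize p a = i; clear * -; decide +revert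
  have h4 : ∑ e, ∑ a, dx e (dp e (dp a s * dx a s)) = 0 := by
    simp only [← map_sum, h.sum_dp_mul_dx_eq_zero hs h0, map_zero, Finset.sum_const_zero]
  simp only [h1, Finset.sum_add_distrib, h2, add_zero] at h4
  rw [hamilton, Finset.sum_congr rfl fun a _ => h3 a, eq_neg_iff_add_eq_zero, ← h4,
    Finset.sum_comm]
  simp only [Finset.sum_add_distrib]

end IsSuperCalculus

end Hamiltonian


/-! ### Symbols on the cotangent bundle -/

/-- The cotangent bundle of a super calculus on `B`: an algebra `A` with the pullback `φ : B → A`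
of functions on the base, momenta `y a`, and derivatives `dx a`, `dp a` in the positions and the
momenta. -/
structure IsCotangent {A B : Type*} [Ring A] [Algebra ℝ A] [Ring B] [Algebra ℝ B]
    (ℬ : ZMod 2 → Submodule ℝ B) (𝒜 : ZMod 2 → Submodule ℝ A) {I : Type*} [DecidableEq I]
    (p : I → ZMod 2) (d : I → B →ₗ[ℝ] B) (dx dp : I → A →ₗ[ℝ] A) (φ : B →ₐ[ℝ] A) (y : I → A) :
    Prop where
  base : IsSuperCalculus ℬ p d
  total : IsSuperCalculus 𝒜 (Sum.elim p p) (Sum.elim dx dp)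
  pull_mem : ∀ {i f}, f ∈ ℬ i → φ f ∈ 𝒜 i
  pull_injective : Function.Injective φ
  mom_mem : ∀ a, y a ∈ 𝒜 (p a)
  dx_pull : ∀ a f, dx a (φ f) = φ (d a f)
  dp_pull : ∀ a f, dp a (φ f) = 0
  dx_mom : ∀ a b, dx a (y b) = 0
  dp_mom : ∀ a b, dp a (y b) = if a = b then 1 else 0

section Cotangent

variable {A B : Type*} [Ring A] [Algebra ℝ A] [Ring B] [Algebra ℝ B]
    {ℬ : ZMod 2 → Submodule ℝ B} {𝒜 : ZMod 2 → Submodule ℝ A} {I : Type*} [Fintype I]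
    {p : I → ZMod 2} {d : I → B →ₗ[ℝ] B} {dx dp : I → A →ₗ[ℝ] A} {φ : B →ₐ[ℝ] A}
    {y : I → A}

variable (φ y) in
/-- The function `u^a p_a`. -/
def linSymbol (u : I → B) : A := ∑ a, φ (u a) * y a

variable (φ y) in
/-- The function `N^{ab} p_b p_a`. -/
def quadSymbol (N : I → I → B) : A := ∑ a, ∑ b, φ (N a b) * y b * y a

variable (φ y) in
/-- The function `K^{ace} p_a p_e p_c`. -/
def cubicSymbol (K : I → I → I → B) : A := ∑ a, ∑ c, ∑ e, φ (K a c e) * y a * y e * y c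

namespace IsCotangent

variable [DecidableEq I] (h : IsCotangent ℬ 𝒜 p d dx dp φ y)

omit [Fintype I] in
include h in
theorem dp_pull_mul {i : ZMod 2} {f : B} (hf : f ∈ ℬ i) (a : I) (g : A) :
    dp a (φ f * g) = sgn (p a * i) • (φ f * dp a g) := by
  have : dp a (φ f * g) = _ := h.total.leibniz (Sum.inr a) (h.pull_mem hf) g
  rw [this, Sum.elim_inr, Sum.elim_inr, h.dp_pull, zero_mul, zero_add]

omit [Fintype I] in
include h in
theorem dp_mom_mul (a b : I) (g : A) :
    dp a (y b * g) = (if a = b then 1 else 0) * g + sgn (p a * p b) • (y b * dp a g) := by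
  have : dp a (y b * g) = _ := h.total.leibniz (Sum.inr a) (h.mom_mem b) g
  rw [this, Sum.elim_inr, Sum.elim_inr, h.dp_mom]

omit [Fintype I] in
include h in
theorem dx_mom_mul (a b : I) (g : A) : dx a (y b * g) = sgn (p a * p b) • (y b * dx a g) := by
  have : dx a (y b * g) = _ := h.total.leibniz (Sum.inl a) (h.mom_mem b) g
  rw [this, Sum.elim_inl, Sum.elim_inl, h.dx_mom, zero_mul, zero_add]

omit [Fintype I] in
include h in
theorem dx_pull_mul {i : ZMod 2} {f : B} (hf : f ∈ ℬ i) (a : I) (g : A) :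
    dx a (φ f * g) = φ (d a f) * g + sgn (p a * i) • (φ f * dx a g) := by
  have : dx a (φ f * g) = _ := h.total.leibniz (Sum.inl a) (h.pull_mem hf) g
  rw [this, Sum.elim_inl, Sum.elim_inl, h.dx_pull]

include h in
theorem dx_linSymbol {ε : ZMod 2} {u : I → B} (hu : ∀ a, u a ∈ ℬ (p a + ε)) (e : I) :
    dx e (linSymbol φ y u) = linSymbol φ y fun a => d e (u a) := by
  rw [linSymbol, map_sum]
  refine Finset.sum_congr rfl fun a _ => ?_
  rw [h.dx_pull_mul (hu a), h.dx_mom, mul_zero, smul_zero, add_zero]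

include h in
theorem dp_linSymbol {ε : ZMod 2} {u : I → B} (hu : ∀ a, u a ∈ ℬ (p a + ε)) (e : I) :
    dp e (linSymbol φ y u) = sgn (p e * (p e + ε)) • φ (u e) := by
  rw [linSymbol, map_sum, Finset.sum_eq_single e]
  · rw [h.dp_pull_mul (hu e), h.dp_mom, if_pos rfl, mul_one]
  · intro b _ hb
    rw [h.dp_pull_mul (hu b), h.dp_mom, if_neg hb.symm, mul_zero, smul_zero]
  · simp

include h in
theorem dx_quadSymbol {ε : ZMod 2} {N : I → I → B} (hN : ∀ a b, N a b ∈ ℬ (p a + p b + ε))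
    (e : I) : dx e (quadSymbol φ y N) = quadSymbol φ y fun a b => d e (N a b) := by
  simp only [quadSymbol, map_sum, mul_assoc]
  refine Finset.sum_congr rfl fun a _ => Finset.sum_congr rfl fun b _ => ?_
  rw [h.dx_pull_mul (hN a b), h.dx_mom_mul, h.dx_mom, mul_zero, smul_zero, mul_zero, smul_zero,
    add_zero]

include h in
theorem dp_quadSymbol {ε : ZMod 2} {N : I → I → B} (hN : ∀ a b, N a b ∈ ℬ (p a + p b + ε))
    (e : I) : dp e (quadSymbol φ y N) =
      sgn (p e * (ε + 1)) • linSymbol φ y fun c => cyc₂ p N e c := by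
  have h1 : ∀ a b, dp e (φ (N a b) * y b * y a) =
      (if e = b then sgn (p e * (ε + 1)) • sgn (p e * p a) • (φ (N a e) * y a) else 0) +
      (if e = a then sgn (p e * (ε + 1)) • (φ (N e b) * y b) else 0) := by
    intro a b
    rw [mul_assoc, h.dp_pull_mul (hN a b), h.dp_mom_mul, h.dp_mom, mul_add (φ _), smul_add]
    congr 1
    · split_ifs with hb
      · subst hb
        rw [one_mul, sgn_smul_smul]
        congr 2
        generalize p a = i; generalize p e = j; clear * -; decide +revert
      · rw [zero_mul, mul_zero, smul_zero]
    · split_ifs with ha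
      · subst ha
        rw [mul_one, mul_smul_comm, sgn_smul_smul]
        congr 2
        generalize p b = i; generalize p e = j; clear * -; decide +revert
      · rw [mul_zero, smul_zero, mul_zero, smul_zero]
  simp only [quadSymbol, map_sum, h1, Finset.sum_add_distrib, Finset.sum_ite_eq, Finset.mem_univ,
    if_true]
  rw [Finset.sum_comm (f := fun a b => if e = a then _ else _)]
  simp only [Finset.sum_ite_eq, Finset.mem_univ, if_true, ← Finset.sum_add_distrib]
  rw [linSymbol, Finset.smul_sum]
  refine Finset.sum_congr rfl fun a _ => ?_
  rw [← smul_add, cyc₂, map_add, map_smul, add_mul, smul_mul_assoc, add_comm (φ (N e a) * y a)]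

include h in
/-- A quadratic function of the momenta determines the supersymmetrization of its coefficients, by
differentiation in the momenta. -/
theorem quadSymbol_eq_zero_iff {ε : ZMod 2} {N : I → I → B}
    (hN : ∀ a b, N a b ∈ ℬ (p a + p b + ε)) :
    quadSymbol φ y N = 0 ↔ ∀ a b, cyc₂ p N a b = 0 := by
  have hmem : ∀ a b, cyc₂ p N a b ∈ ℬ (p b + (p a + ε)) := fun a b => by
    rw [← add_assoc, add_comm (p b)]
    refine Submodule.add_mem _ (hN a b) (Submodule.smul_mem _ _ ?_)
    rw [add_comm (p a)]
    exact hN b a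
  constructor
  · intro h0 a b
    have h1 := h.dp_quadSymbol hN a
    rw [h0, map_zero] at h1
    have h2 := h.dp_linSymbol (hmem a) b
    rw [sgn_smul_eq_zero h1.symm, map_zero] at h2
    exact h.pull_injective ((sgn_smul_eq_zero h2.symm).trans (map_zero φ).symm)
  · intro hc
    have := sum_mul_eq_zero_of_cyc₂ (p := p) (N := fun a b => φ (N a b)) (r := fun a b => y a * y b)
      (fun a b => ?_) fun a b => h.total.comm (h.mom_mem a) (h.mom_mem b)
    · simpa only [quadSymbol, mul_assoc] using this
    · have := congrArg φ (hc a b)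
      rwa [cyc₂, map_add, map_smul, map_zero] at this

include h in
theorem dp_cubicSymbol {K : I → I → I → B} (hK : ∀ a c e, K a c e ∈ ℬ (p a + p c + p e))
    (hKs : ∀ a c e, K a c e = sgn (p c * p e) • K a e c) (b : I) :
    dp b (cubicSymbol φ y K) = sgn (p b) • quadSymbol φ y fun c e =>
      sgn (p b * (p c + p e)) • K b c e + (2 : ℝ) • K e b c := by
  have h1 : ∀ a c e, dp b (φ (K a c e) * y a * y e * y c) =
      (if b = a then sgn (p b) • (sgn (p b * (p c + p e)) • (φ (K b c e) * y e * y c)) else 0) +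
      ((if b = e then sgn (p b) • (φ (K a b c) * y a * y c) else 0) +
      (if b = c then sgn (p b) • (φ (K a b e) * y a * y e) else 0)) := by
    intro a c e
    rw [mul_assoc, mul_assoc, h.dp_pull_mul (hK a c e), h.dp_mom_mul, h.dp_mom_mul, h.dp_mom,
      mul_add (y a), mul_smul_comm (sgn (p b * p e)), smul_add, mul_add (φ _), mul_add (φ _),
      smul_add, smul_add]
    congr 1
    · split_ifs with ha
      · subst ha
        rw [one_mul, sgn_smul_smul, mul_assoc]
        congr 2
        generalize p c = i; generalize p b = j; generalize p e = k; clear * -; decide +revert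
      · simp
    · congr 1
      · split_ifs with ha
        · subst ha
          rw [one_mul, mul_smul_comm, sgn_smul_smul, mul_assoc, hKs a c b, map_smul,
            smul_mul_assoc, sgn_smul_smul]
          congr 2
          generalize p c = i; generalize p b = j; generalize p a = k; clear * -; decide +revert
        · simp
      · split_ifs with ha
        · subst ha
          rw [mul_one, mul_smul_comm, mul_smul_comm, sgn_smul_smul, sgn_smul_smul, mul_assoc]
          congr 2
          generalize p e = i; generalize p b = j; generalize p a = k; clear * -; decide +revert
        · simp
  have e1 : ∑ a, ∑ c, ∑ e, (if b = a then
      sgn (p b) • (sgn (p b * (p c + p e)) • (φ (K b c e) * y e * y c)) else 0) =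
      sgn (p b) • quadSymbol φ y fun c e => sgn (p b * (p c + p e)) • K b c e := by
    rw [Finset.sum_eq_single b (fun a _ ha => by simp [ha.symm]) (by simp)]
    simp only [if_true, quadSymbol, map_smul, smul_mul_assoc, Finset.smul_sum]
  have e2 : ∑ a, ∑ c, ∑ e, (if b = e then sgn (p b) • (φ (K a b c) * y a * y c) else 0) =
      sgn (p b) • quadSymbol φ y fun c e => K e b c := by
    simp only [Finset.sum_ite_eq, Finset.mem_univ, if_true]
    rw [Finset.sum_comm]
    simp only [quadSymbol, Finset.smul_sum]
  have e3 : ∑ a, ∑ c, ∑ e, (if b = c then sgn (p b) • (φ (K a b e) * y a * y e) else 0) =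
      sgn (p b) • quadSymbol φ y fun c e => K e b c := by
    rw [← e2]
    refine Finset.sum_congr rfl fun a _ => Finset.sum_comm
  simp only [cubicSymbol, map_sum, h1, Finset.sum_add_distrib]
  rw [e1, e2, e3, ← smul_add, ← smul_add]
  simp only [quadSymbol, ← Finset.sum_add_distrib, map_add, map_smul, add_mul, smul_mul_assoc,
    two_smul]

include h in
/-- A cubic function of the momenta determines the supersymmetrization of its coefficients. -/
theorem cubicSymbol_eq_zero_iff {K : I → I → I → B} (hK : ∀ a c e, K a c e ∈ ℬ (p a + p c + p e))
    (hKs : ∀ a c e, K a c e = sgn (p c * p e) • K a e c) :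
    cubicSymbol φ y K = 0 ↔ ∀ b c e, cyc₃ p K b c e = 0 := by
  constructor
  · intro h0 b c e
    have h1 := h.dp_cubicSymbol hK hKs b
    rw [h0, map_zero] at h1
    have h2 := (h.quadSymbol_eq_zero_iff (ε := p b) (fun c e => ?_)).1
      (sgn_smul_eq_zero h1.symm) c e
    · have h3 : cyc₂ p (fun c e => sgn (p b * (p c + p e)) • K b c e + (2 : ℝ) • K e b c) c e =
          (2 : ℝ) • cyc₃ p K b c e := by
        have : sgn (p c * p e) • sgn (p b * (p e + p c)) • K b e c =
            sgn (p b * (p c + p e)) • K b c e := by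
          rw [hKs b c e, smul_comm, add_comm (p e)]
        simp only [cyc₂, cyc₃, smul_add, this]
        module
      rw [h3] at h2
      exact (smul_eq_zero_iff_right two_ne_zero).1 h2
    · refine Submodule.add_mem _ (Submodule.smul_mem _ _ ?_) (Submodule.smul_mem _ _ ?_)
      · have := hK b c e
        rwa [show p b + p c + p e = p c + p e + p b by ring] at this
      · have := hK e b c
        rwa [show p e + p b + p c = p c + p e + p b by ring] at this
  · intro hc
    have hy := fun a b => h.total.comm (h.mom_mem a) (h.mom_mem b)
    have := sum_mul_eq_zero_of_cyc₃ (p := p) (K := fun a b c => φ (K a b c))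
      (r := fun a b c => y a * y b * y c)
      (fun a b c => ?_) (fun a b c => by rw [hy a b, smul_mul_assoc])
      (fun a b c => by rw [mul_assoc, hy b c, mul_smul_comm, mul_assoc])
    · simpa only [cubicSymbol, mul_assoc] using this
    · have := congrArg φ (hc a b c)
      rwa [cyc₃, map_add, map_add, map_smul, map_smul, map_zero] at this

section Odd

variable {S : I → I → B} {T : I → B}
  (hS : ∀ a b, S a b ∈ ℬ (p a + p b + 1)) (hSs : ∀ a b, S a b = sgn (p a * p b) • S b a)
  (hT : ∀ a, T a ∈ ℬ (p a + 1))

include h hS in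
theorem symbol_mem : (1 / 2 : ℝ) • quadSymbol φ y S ∈ 𝒜 1 := by
  refine Submodule.smul_mem _ _ (Submodule.sum_mem _ fun a _ => Submodule.sum_mem _ fun b _ => ?_)
  have := h.total.mul_mem (h.total.mul_mem (h.pull_mem (hS a b)) (h.mom_mem b)) (h.mom_mem a)
  rwa [show p a + p b + 1 + p b + p a = 1 by
    generalize p a = i; generalize p b = j; clear * -; decide +revert] at this

include h hS hSs in
theorem dp_symbol (a : I) : dp a ((1 / 2 : ℝ) • quadSymbol φ y S) = linSymbol φ y (S a) := by
  rw [map_smul, h.dp_quadSymbol hS, CharTwo.add_self_eq_zero, mul_zero, sgn_zero, one_smul,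
    linSymbol, linSymbol, Finset.smul_sum]
  refine Finset.sum_congr rfl fun b _ => ?_
  rw [cyc₂, ← hSs a b, map_add, add_mul]
  module

include h hSs in
theorem linSymbol_mul_pull (a : I) {i : ZMod 2} {f : B} (hf : f ∈ ℬ i) (g : A) :
    linSymbol φ y (S a) * (φ f * g) =
      ∑ b, sgn (p b * (i + p a)) • (φ (S b a * f) * y b * g) := by
  rw [linSymbol, Finset.sum_mul]
  refine Finset.sum_congr rfl fun b _ => ?_
  rw [mul_assoc, ← mul_assoc (y b), h.total.comm (h.mom_mem b) (h.pull_mem hf), hSs a b, map_smul,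
    map_mul]
  simp only [smul_mul_assoc, mul_smul_comm, sgn_smul_smul, mul_assoc]
  congr 2
  generalize p a = i; generalize p b = j; clear * -; decide +revert

include h hS hSs in
/-- `(S, S)` is the total symbol of the third-order part of the square. -/
theorem hamilton_symbol_symbol : hamilton p dx dp ((1 / 2 : ℝ) • quadSymbol φ y S)
      ((1 / 2 : ℝ) • quadSymbol φ y S) = (2 : ℝ) • cubicSymbol φ y (cubicCoeff p d S) := by
  rw [h.total.hamilton_self (h.symbol_mem hS)]
  congr 1
  have h1 : ∀ a, dp a ((1 / 2 : ℝ) • quadSymbol φ y S) * dx a ((1 / 2 : ℝ) • quadSymbol φ y S) =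
      ∑ c, ∑ e, ∑ b, (1 / 2 : ℝ) • sgn (p b * (p c + p e + 1)) •
        (φ (S b a * d a (S c e)) * y b * y e * y c) := by
    intro a
    rw [h.dp_symbol hS hSs, map_smul, h.dx_quadSymbol hS, quadSymbol, mul_smul_comm, Finset.mul_sum,
      Finset.smul_sum]
    refine Finset.sum_congr rfl fun c _ => ?_
    rw [Finset.mul_sum, Finset.smul_sum]
    refine Finset.sum_congr rfl fun e _ => ?_
    rw [mul_assoc, h.linSymbol_mul_pull hSs a (h.base.d_mem a (hS c e)), Finset.smul_sum]
    refine Finset.sum_congr rfl fun b _ => ?_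
    rw [← mul_assoc (φ _ * y b), add_assoc _ (p a), CharTwo.add_self_eq_zero, add_zero]
  have h2 : cubicSymbol φ y (cubicCoeff p d S) =
      ∑ b, ∑ c, ∑ e, ∑ a, (1 / 2 : ℝ) • sgn (p b * (p c + p e + 1)) •
        (φ (S b a * d a (S c e)) * y b * y e * y c) := by
    simp only [cubicSymbol, cubicCoeff, map_smul, map_sum, smul_mul_assoc, Finset.sum_mul,
      Finset.smul_sum]
  rw [Finset.sum_congr rfl fun a _ => h1 a, h2]
  refine Finset.sum_comm.trans (.trans (Finset.sum_congr rfl fun c _ => ?_) Finset.sum_comm)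
  refine Finset.sum_comm.trans (.trans ?_ Finset.sum_comm)
  exact Finset.sum_congr rfl fun e _ => Finset.sum_comm

omit [DecidableEq I] in
theorem quadSymbol_add (N N' : I → I → B) :
    quadSymbol φ y (fun a b => N a b + N' a b) = quadSymbol φ y N + quadSymbol φ y N' := by
  simp only [quadSymbol, map_add, add_mul, Finset.sum_add_distrib]

omit [DecidableEq I] in
theorem quadSymbol_smul (r : ℝ) (N : I → I → B) :
    quadSymbol φ y (fun a b => r • N a b) = r • quadSymbol φ y N := by
  simp only [quadSymbol, map_smul, smul_mul_assoc, Finset.smul_sum]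

omit [DecidableEq I] in
theorem quadSymbol_sum {α : Type*} (s : Finset α) (N : α → I → I → B) :
    quadSymbol φ y (fun a b => ∑ i ∈ s, N i a b) = ∑ i ∈ s, quadSymbol φ y (N i) := by
  simp only [quadSymbol, map_sum, Finset.sum_mul]
  exact (Finset.sum_congr rfl fun a _ => Finset.sum_comm).trans Finset.sum_comm

omit [DecidableEq I] in
theorem pull_mul_quadSymbol (f : B) (N : I → I → B) :
    φ f * quadSymbol φ y N = quadSymbol φ y (fun a b => f * N a b) := by
  simp only [quadSymbol, map_mul, Finset.mul_sum, mul_assoc]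

include h hS hSs in
theorem divergence_symbol : divergence dx dp ((1 / 2 : ℝ) • quadSymbol φ y S) =
    linSymbol φ y fun a => ∑ b, d b (S b a) := by
  have h1 : ∀ b, dx b (dp b ((1 / 2 : ℝ) • quadSymbol φ y S)) =
      linSymbol φ y fun a => d b (S b a) := by
    intro b
    rw [h.dp_symbol hS hSs, h.dx_linSymbol (ε := p b + 1)]
    intro a
    rw [← add_assoc, add_comm (p a)]
    exact hS b a
  rw [divergence, Finset.sum_congr rfl fun b _ => h1 b]
  simp only [linSymbol, map_sum, Finset.sum_mul]
  exact Finset.sum_comm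

include h hS hSs in
/-- The part of `(S, γ)` that contains second derivatives of `S`. -/
theorem hamilton_symbol_divergence (h0 : hamilton p dx dp ((1 / 2 : ℝ) • quadSymbol φ y S)
      ((1 / 2 : ℝ) • quadSymbol φ y S) = 0) :
    hamilton p dx dp ((1 / 2 : ℝ) • quadSymbol φ y S)
      (divergence dx dp ((1 / 2 : ℝ) • quadSymbol φ y S)) =
    -((1 / 2 : ℝ) • quadSymbol φ y fun c e => ∑ a, ∑ b, S a b * d b (d a (S c e))) := by
  rw [h.total.hamilton_divergence (h.symbol_mem hS) h0]
  congr 1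
  have h1 : ∀ a b, sgn (p b * p a) • (dp b (dp a ((1 / 2 : ℝ) • quadSymbol φ y S)) *
      dx b (dx a ((1 / 2 : ℝ) • quadSymbol φ y S))) =
      (1 / 2 : ℝ) • quadSymbol φ y fun c e => S a b * d b (d a (S c e)) := by
    intro a b
    rw [h.dp_symbol hS hSs, h.dp_linSymbol (ε := p a + 1), map_smul, map_smul, h.dx_quadSymbol hS,
      h.dx_quadSymbol (ε := p a + 1), smul_mul_assoc, sgn_smul_smul, sgn_smul_eq_self,
      mul_smul_comm, pull_mul_quadSymbol]
    · generalize p a = i; generalize p b = j; clear * -; decide +revert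
    · intro c e
      rw [add_comm (p a), ← add_assoc]
      exact h.base.d_mem a (hS c e)
    · intro c
      rw [← add_assoc, add_comm (p c)]
      exact hS a c
  rw [Finset.sum_comm]
  simp only [h1, ← Finset.smul_sum, ← quadSymbol_sum]

include h hS hSs hT in
theorem hamilton_symbol_linSymbol :
    hamilton p dx dp ((1 / 2 : ℝ) • quadSymbol φ y S) (linSymbol φ y T) =
    (quadSymbol φ y fun c e => ∑ b, sgn (p e * (p c + 1)) • (S e b * d b (T c))) +
      (1 / 2 : ℝ) • quadSymbol φ y fun c e => ∑ a, T a * d a (S c e) := by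
  have h1 : ∀ a, dp a ((1 / 2 : ℝ) • quadSymbol φ y S) * dx a (linSymbol φ y T) =
      quadSymbol φ y fun c e => sgn (p e * (p c + 1)) • (S e a * d a (T c)) := by
    intro a
    rw [h.dp_symbol hS hSs, h.dx_linSymbol hT, linSymbol.eq_1 φ y (fun c => d a (T c)), quadSymbol,
      Finset.mul_sum]
    refine Finset.sum_congr rfl fun c _ => ?_
    rw [h.linSymbol_mul_pull hSs a (h.base.d_mem a (hT c))]
    refine Finset.sum_congr rfl fun b _ => ?_
    rw [add_assoc _ (p a), CharTwo.add_self_eq_zero, add_zero, map_smul, smul_mul_assoc,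
      smul_mul_assoc]
  have h2 : ∀ a, -(sgn (p a) • (dx a ((1 / 2 : ℝ) • quadSymbol φ y S) * dp a (linSymbol φ y T))) =
      (1 / 2 : ℝ) • quadSymbol φ y fun c e => T a * d a (S c e) := by
    intro a
    rw [h.dp_linSymbol hT, mul_smul_comm,
      h.total.comm (h.total.dx_mem (h.symbol_mem hS) a) (h.pull_mem (hT a)), map_smul,
      h.dx_quadSymbol hS, neg_eq_sgn_smul, sgn_smul_smul, sgn_smul_smul, sgn_smul_smul,
      sgn_smul_eq_self, mul_smul_comm, pull_mul_quadSymbol]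
    generalize p a = i; clear * -; decide +revert
  simp only [hamilton, sub_eq_add_neg, h1, h2, Finset.sum_add_distrib, ← Finset.smul_sum,
    ← quadSymbol_sum]

include h hS hSs hT in
/-- For a solution of the master equation, `(S, γ)` is the total symbol of the second-order part of
the square. -/
theorem hamilton_symbol_subprincipal (h0 : hamilton p dx dp ((1 / 2 : ℝ) • quadSymbol φ y S)
      ((1 / 2 : ℝ) • quadSymbol φ y S) = 0) :
    hamilton p dx dp ((1 / 2 : ℝ) • quadSymbol φ y S)
      (linSymbol φ y fun a => ∑ b, d b (S b a) - (2 : ℝ) • T a) =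
    -((2 : ℝ) • quadSymbol φ y (quadCoeff p d S T)) := by
  have h1 : (linSymbol φ y fun a => ∑ b, d b (S b a) - (2 : ℝ) • T a) =
      divergence dx dp ((1 / 2 : ℝ) • quadSymbol φ y S) - (2 : ℝ) • linSymbol φ y T := by
    rw [h.divergence_symbol hS hSs]
    simp only [linSymbol, map_sub, map_smul, sub_mul, smul_mul_assoc, Finset.sum_sub_distrib,
      Finset.smul_sum]
  have h2 : ∀ s F G : A, hamilton p dx dp s (F - (2 : ℝ) • G) =
      hamilton p dx dp s F - (2 : ℝ) • hamilton p dx dp s G := by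
    intro s F G
    rw [hamilton, hamilton, hamilton, Finset.smul_sum, ← Finset.sum_sub_distrib]
    refine Finset.sum_congr rfl fun a _ => ?_
    simp only [map_sub, map_smul, mul_sub, mul_smul_comm]
    module
  have h3 : quadSymbol φ y (quadCoeff p d S T) = (1 / 2 : ℝ) • ((1 / 2 : ℝ) •
      (quadSymbol φ y fun c e => ∑ a, ∑ b, S a b * d b (d a (S c e))) +
      quadSymbol φ y fun c e => ∑ a, T a * d a (S c e)) +
      quadSymbol φ y fun c e => ∑ b, sgn (p e * (p c + 1)) • (S e b * d b (T c)) := by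
    rw [← quadSymbol_smul, ← quadSymbol_add, ← quadSymbol_smul, ← quadSymbol_add]
    simp only [← secondOrder_apply]
    rfl
  rw [h1, h2, h.hamilton_symbol_divergence hS hSs h0, h.hamilton_symbol_linSymbol hS hSs hT, h3]
  module

variable {br : A → A → A} (hbr : ∀ s ∈ 𝒜 1, ∀ F, br s F = hamilton p dx dp s F)

include h hS hSs hbr in
/-- The master equation `(S, S) = 0` in coordinates, for any bracket `br` in which the bracket with
an odd function is its Hamiltonian vector field. -/
theorem master_iff {s : A} (hs : s = (1 / 2 : ℝ) • quadSymbol φ y S) :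
    br s s = 0 ↔ ∀ b c e, cyc₃ p (cubicCoeff p d S) b c e = 0 := by
  rw [hs, hbr _ (h.symbol_mem hS), h.hamilton_symbol_symbol hS hSs,
    smul_eq_zero_iff_right two_ne_zero,
    h.cubicSymbol_eq_zero_iff (h.base.cubicCoeff_mem hS) (IsSuperCalculus.cubicCoeff_symm hSs)]

include h hS hSs hT hbr in
/-- The equation `(S, γ) = 0` in coordinates, for a solution of the master equation. -/
theorem flat_iff {s γ : A} (hs : s = (1 / 2 : ℝ) • quadSymbol φ y S)
    (hγ : γ = linSymbol φ y fun a => ∑ b, d b (S b a) - (2 : ℝ) • T a) (h0 : br s s = 0) :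
    br s γ = 0 ↔ ∀ a b, cyc₂ p (quadCoeff p d S T) a b = 0 := by
  rw [hs, hbr _ (h.symbol_mem hS)] at h0
  rw [hs, hγ, hbr _ (h.symbol_mem hS), h.hamilton_symbol_subprincipal hS hSs hT h0, neg_eq_zero,
    smul_eq_zero_iff_right two_ne_zero, h.quadSymbol_eq_zero_iff (ε := 0)]
  intro a b
  rw [add_zero]
  exact h.base.quadCoeff_mem hS hT a b

include h hS hbr in
/-- `D² = 0` for a solution of the master equation. -/
theorem master_sq {s : A} (hs : s = (1 / 2 : ℝ) • quadSymbol φ y S) (h0 : br s s = 0) (F : A) :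
    br s (br s F) = 0 := by
  rw [hs, hbr _ (h.symbol_mem hS)] at h0 ⊢
  rw [hbr _ (h.symbol_mem hS)]
  exact h.total.hamilton_hamilton (h.symbol_mem hS) h0 F

end Odd

end IsCotangent

end Cotangent


/-! ### Grassmann algebras -/

section Grassmann

variable {κ κ' : Type}

/-- The elements of a given parity of the Grassmann algebra. -/
abbrev grassmannParity (κ : Type) (i : ZMod 2) : Submodule ℝ (Grassmann κ) :=
  CliffordAlgebra.evenOdd (0 : QuadraticForm ℝ (κ → ℝ)) i

theorem zmod_two_cases (i : ZMod 2) : i = 0 ∨ i = 1 := by decide +revert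

theorem involute_of_mem {i : ZMod 2} {x : Grassmann κ} (hx : x ∈ grassmannParity κ i) :
    CliffordAlgebra.involute x = sgn i • x := by
  rcases zmod_two_cases i with rfl | rfl
  · rw [CliffordAlgebra.involute_eq_of_mem_even hx, sgn_zero, one_smul]
  · rw [CliffordAlgebra.involute_eq_of_mem_odd hx, sgn_one, neg_one_smul]

theorem mem_of_involute {i : ZMod 2} {x : Grassmann κ}
    (hx : CliffordAlgebra.involute x = sgn i • x) : x ∈ grassmannParity κ i := by
  have htop : x ∈ grassmannParity κ 0 ⊔ grassmannParity κ 1 :=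
    (CliffordAlgebra.evenOdd_isCompl (0 : QuadraticForm ℝ (κ → ℝ))).sup_eq_top.symm ▸
      Submodule.mem_top
  obtain ⟨y, hy, z, hz, rfl⟩ := Submodule.mem_sup.1 htop
  rw [map_add, involute_of_mem hy, involute_of_mem hz, smul_add] at hx
  rcases zmod_two_cases i with rfl | rfl
  · rw [add_right_inj, sgn_zero, sgn_one, one_smul, neg_one_smul] at hx
    rw [eq_zero_of_eq_neg hx.symm, add_zero]
    exact hy
  · rw [add_left_inj, sgn_zero, sgn_one, one_smul, neg_one_smul] at hx
    rw [eq_zero_of_eq_neg hx, zero_add]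
    exact hz

theorem mem_grassmannParity_iff {i : ZMod 2} {x : Grassmann κ} :
    x ∈ grassmannParity κ i ↔ CliffordAlgebra.involute x = sgn i • x :=
  ⟨involute_of_mem, mem_of_involute⟩

theorem grassmann_comm {i j : ZMod 2} {x y : Grassmann κ} (hx : x ∈ grassmannParity κ i)
    (hy : y ∈ grassmannParity κ j) : x * y = sgn (i * j) • (y * x) := by
  have h := CliffordAlgebra.map_mul_map_of_isOrtho_of_mem_evenOdd
    (QuadraticMap.Isometry.id (0 : QuadraticForm ℝ (κ → ℝ)))
    (QuadraticMap.Isometry.id (0 : QuadraticForm ℝ (κ → ℝ)))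
    (fun x y => by simp [QuadraticMap.IsOrtho]) x y hx hy
  rw [CliffordAlgebra.map_id, AlgHom.id_apply, AlgHom.id_apply] at h
  rw [h, mul_comm j i]
  rcases zmod_two_cases (i * j) with h | h <;> rw [h]
  · rw [uzpow_zero, sgn_zero, one_smul, one_smul]
  · rw [uzpow_one, sgn_one, neg_one_smul, Units.neg_smul, one_smul]

theorem involute_contractLeft (l : Module.Dual ℝ (κ → ℝ)) (x : Grassmann κ) :
    CliffordAlgebra.involute (CliffordAlgebra.contractLeft l x) =
      -CliffordAlgebra.contractLeft l (CliffordAlgebra.involute x) := by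
  induction x using CliffordAlgebra.left_induction with
  | algebraMap r => simp
  | add x y hx hy => rw [map_add, map_add, map_add, map_add, hx, hy, neg_add]
  | ι_mul x v hx =>
    rw [CliffordAlgebra.contractLeft_ι_mul, map_sub, map_smul, map_mul, map_mul, hx,
      CliffordAlgebra.involute_ι, neg_mul, neg_mul, map_neg, CliffordAlgebra.contractLeft_ι_mul]
    simp

/-- Contraction is an antiderivation. -/
theorem contractLeft_mul (l : Module.Dual ℝ (κ → ℝ)) (x y : Grassmann κ) :
    CliffordAlgebra.contractLeft l (x * y) = CliffordAlgebra.contractLeft l x * y +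
      CliffordAlgebra.involute x * CliffordAlgebra.contractLeft l y := by
  induction x using CliffordAlgebra.left_induction with
  | algebraMap r => simp [CliffordAlgebra.contractLeft_algebraMap_mul]
  | add x z hx hz =>
    rw [add_mul, map_add, map_add, map_add, hx, hz, add_mul, add_mul]
    abel
  | ι_mul x v hx =>
    rw [mul_assoc, CliffordAlgebra.contractLeft_ι_mul, hx, CliffordAlgebra.contractLeft_ι_mul,
      map_mul, CliffordAlgebra.involute_ι, sub_mul, mul_add, smul_mul_assoc, mul_assoc, neg_mul,
      neg_mul, mul_assoc]
    abel

theorem involute_map (g : (κ → ℝ) →ₗ[ℝ] (κ' → ℝ)) (x : Grassmann κ) :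
    CliffordAlgebra.involute (ExteriorAlgebra.map g x) =
      ExteriorAlgebra.map g (CliffordAlgebra.involute x) := by
  induction x using CliffordAlgebra.left_induction with
  | algebraMap r => simp
  | add x y hx hy => rw [map_add, map_add, map_add, map_add, hx, hy]
  | ι_mul x v hx =>
    have h1 : ExteriorAlgebra.map g (CliffordAlgebra.ι 0 v) = CliffordAlgebra.ι 0 (g v) :=
      ExteriorAlgebra.map_apply_ι g v
    rw [map_mul, map_mul, map_mul, map_mul, hx, h1, CliffordAlgebra.involute_ι,
      CliffordAlgebra.involute_ι, map_neg, h1]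

theorem contractLeft_map (g : (κ → ℝ) →ₗ[ℝ] (κ' → ℝ)) (l : Module.Dual ℝ (κ' → ℝ))
    (x : Grassmann κ) : CliffordAlgebra.contractLeft l (ExteriorAlgebra.map g x) =
      ExteriorAlgebra.map g (CliffordAlgebra.contractLeft (l ∘ₗ g) x) := by
  induction x using CliffordAlgebra.left_induction with
  | algebraMap r => simp
  | add x y hx hy => rw [map_add, map_add, map_add, map_add, hx, hy]
  | ι_mul x v hx =>
    have h1 : ExteriorAlgebra.map g (CliffordAlgebra.ι 0 v) = CliffordAlgebra.ι 0 (g v) :=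
      ExteriorAlgebra.map_apply_ι g v
    rw [map_mul, h1, CliffordAlgebra.contractLeft_ι_mul, CliffordAlgebra.contractLeft_ι_mul, hx,
      map_sub, map_smul, map_mul, h1, LinearMap.comp_apply]

theorem grassmann_ext {x y : Grassmann κ} (h : ∀ l : Module.Dual ℝ (Grassmann κ), l x = l y) :
    x = y := by
  rw [← sub_eq_zero, ← Module.forall_dual_apply_eq_zero_iff ℝ]
  intro l
  rw [map_sub, h, sub_self]

end Grassmann

/-! ### Partial derivatives of superfunctions -/

namespace SuperFun

variable {ι κ : Type} [Fintype ι] [Fintype κ] {V : Opens (ι → ℝ)}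

theorem ext_dual {f g : SuperFun κ V}
    (h : ∀ x (l : Module.Dual ℝ (Grassmann κ)), l (f.1 x) = l (g.1 x)) : f = g :=
  Subtype.ext (funext fun x => grassmann_ext (h x))

/-- A linear functional of a superfunction, extended by zero to a real function on the whole
space. -/
def comp (l : Module.Dual ℝ (Grassmann κ)) (f : SuperFun κ V) : (ι → ℝ) → ℝ :=
  Function.extend Subtype.val (fun x => l (f.1 x)) 0

theorem comp_apply (l : Module.Dual ℝ (Grassmann κ)) (f : SuperFun κ V) (x : V) :
    comp l f x.1 = l (f.1 x) :=
  extend_val _ x.2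

theorem contDiffAt_comp (l : Module.Dual ℝ (Grassmann κ)) (f : SuperFun κ V) (x : V) :
    ContDiffAt ℝ ∞ (comp l f) x.1 :=
  (f.2 l).contDiffAt (V.isOpen.mem_nhds x.2)

theorem differentiableAt_comp (l : Module.Dual ℝ (Grassmann κ)) (f : SuperFun κ V) (x : V) :
    DifferentiableAt ℝ (comp l f) x.1 :=
  (contDiffAt_comp l f x).differentiableAt (by simp)

theorem eventuallyEq_comp {l : Module.Dual ℝ (Grassmann κ)} {f : SuperFun κ V}
    {u : (ι → ℝ) → ℝ} {W : Opens (ι → ℝ)} {x : ι → ℝ} (hx : x ∈ W) (hW : W ≤ V)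
    (hu : ∀ y (hy : y ∈ W), l (f.1 ⟨y, hW hy⟩) = u y) : comp l f =ᶠ[nhds x] u := by
  filter_upwards [W.isOpen.mem_nhds hx] with y hy
  rw [← hu y hy]
  exact comp_apply l f ⟨y, hW hy⟩

section Deriv

variable [DecidableEq ι]

/-- Derivatives are computed componentwise in any basis. -/
theorem dual_evenDeriv (l : Module.Dual ℝ (Grassmann κ)) (i : ι) (f : SuperFun κ V) (x : V) :
    l ((evenDeriv i f).1 x) = fderiv ℝ (comp l f) x.1 (Pi.single i 1) := by
  set b := Module.finBasis ℝ (Grassmann κ)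
  have h1 : comp l f =ᶠ[nhds x.1] fun y => ∑ k, comp (b.coord k) f y * l (b k) := by
    refine eventuallyEq_comp x.2 le_rfl fun y hy => ?_
    conv_lhs => rw [← b.sum_repr (f.1 ⟨y, hy⟩), map_sum]
    refine Finset.sum_congr rfl fun k _ => ?_
    rw [map_smul, smul_eq_mul]
    congr 1
    exact (comp_apply (b.coord k) f ⟨y, hy⟩).symm
  rw [h1.fderiv_eq, fderiv_fun_sum fun k _ => (differentiableAt_comp _ f x).mul_const _]
  simp only [evenDeriv, map_sum, map_smul, smul_eq_mul, sum_apply]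
  refine Finset.sum_congr rfl fun k _ => ?_
  rw [fderiv_mul_const (differentiableAt_comp _ f x)]
  simp only [smul_apply, smul_eq_mul]
  exact mul_comm _ _

theorem dual_evenDeriv_eq {l : Module.Dual ℝ (Grassmann κ)} {i : ι} {f : SuperFun κ V}
    {u : (ι → ℝ) → ℝ} {x : V} (hu : ∀ y (hy : y ∈ V), l (f.1 ⟨y, hy⟩) = u y) :
    l ((evenDeriv i f).1 x) = fderiv ℝ u x.1 (Pi.single i 1) := by
  rw [dual_evenDeriv, (eventuallyEq_comp x.2 le_rfl hu).fderiv_eq]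

/-- Derivatives are local. -/
theorem evenDeriv_congr {W : Opens (ι → ℝ)} (hW : W ≤ V) {f g : SuperFun κ V}
    (h : restrict hW f = restrict hW g) (i : ι) :
    restrict hW (evenDeriv i f) = restrict hW (evenDeriv i g) := by
  refine ext_dual fun x l => ?_
  have hfg : comp l f =ᶠ[nhds x.1] comp l g := by
    refine eventuallyEq_comp x.2 hW fun y hy => ?_
    rw [comp_apply l g ⟨y, hW hy⟩]
    exact congrArg (fun k : SuperFun κ W => l (k.1 ⟨y, hy⟩)) h
  change l ((evenDeriv i f).1 ⟨x.1, hW x.2⟩) = l ((evenDeriv i g).1 ⟨x.1, hW x.2⟩)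
  rw [dual_evenDeriv, dual_evenDeriv, hfg.fderiv_eq]

theorem dual_mul (l : Module.Dual ℝ (Grassmann κ)) (x y : Grassmann κ) :
    l (x * y) = ∑ j, ∑ k, (Module.finBasis ℝ (Grassmann κ)).coord j x *
      (Module.finBasis ℝ (Grassmann κ)).coord k y *
      l (Module.finBasis ℝ (Grassmann κ) j * Module.finBasis ℝ (Grassmann κ) k) := by
  conv_lhs => rw [← (Module.finBasis ℝ (Grassmann κ)).sum_repr x,
    ← (Module.finBasis ℝ (Grassmann κ)).sum_repr y, Finset.sum_mul_sum, map_sum]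
  simp only [map_sum, smul_mul_smul_comm, map_smul, smul_eq_mul, Module.Basis.coord_apply]

theorem evenDeriv_mul (i : ι) (f g : SuperFun κ V) :
    evenDeriv i (f * g) = evenDeriv i f * g + f * evenDeriv i g := by
  refine ext_dual fun x l => ?_
  set b := Module.finBasis ℝ (Grassmann κ) with hb
  have h1 : l ((evenDeriv i (f * g)).1 x) = fderiv ℝ (fun y => ∑ j, ∑ k,
      comp (b.coord j) f y * comp (b.coord k) g y * l (b j * b k)) x.1 (Pi.single i 1) := by
    refine dual_evenDeriv_eq fun y hy => ?_
    change l (f.1 ⟨y, hy⟩ * g.1 ⟨y, hy⟩) = _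
    rw [dual_mul]
    refine Finset.sum_congr rfl fun j _ => Finset.sum_congr rfl fun k _ => ?_
    rw [comp_apply _ f ⟨y, hy⟩, comp_apply _ g ⟨y, hy⟩]
  have hd : ∀ j k, HasFDerivAt (fun y => comp (b.coord j) f y * comp (b.coord k) g y *
      l (b j * b k)) _ x.1 := fun j k => ((differentiableAt_comp (b.coord j) f x).hasFDerivAt.mul
        (differentiableAt_comp (b.coord k) g x).hasFDerivAt).mul_const (l (b j * b k))
  have hs := HasFDerivAt.fun_sum fun j (_ : j ∈ Finset.univ) =>
    HasFDerivAt.fun_sum fun k (_ : k ∈ Finset.univ) => hd j k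
  rw [h1, hs.fderiv]
  change _ = l ((evenDeriv i f).1 x * g.1 x + f.1 x * (evenDeriv i g).1 x)
  rw [map_add, dual_mul, dual_mul, ← Finset.sum_add_distrib]
  simp only [sum_apply]
  refine Finset.sum_congr rfl fun j _ => ?_
  rw [← Finset.sum_add_distrib]
  refine Finset.sum_congr rfl fun k _ => ?_
  simp only [← hb, dual_evenDeriv, smul_apply, add_apply,
    smul_eq_mul, comp_apply]
  ring

/-- Pointwise application of a linear map to a superfunction. -/
def mapLin {κ' : Type} [Fintype κ'] (L : Grassmann κ →ₗ[ℝ] Grassmann κ') (f : SuperFun κ V) :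
    SuperFun κ' V :=
  ⟨fun x => L (f.1 x), f.2.linear L⟩

theorem evenDeriv_mapLin {κ' : Type} [Fintype κ'] (L : Grassmann κ →ₗ[ℝ] Grassmann κ') (i : ι)
    (f : SuperFun κ V) : evenDeriv i (mapLin L f) = mapLin L (evenDeriv i f) := by
  refine ext_dual fun x l => ?_
  rw [dual_evenDeriv]
  exact (dual_evenDeriv (l.comp L) i f x).symm

theorem evenDeriv_evenDeriv (i j : ι) (f : SuperFun κ V) :
    evenDeriv i (evenDeriv j f) = evenDeriv j (evenDeriv i f) := by
  refine ext_dual fun x l => ?_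
  have h1 : ∀ i j, l ((evenDeriv i (evenDeriv j f)).1 x) =
      fderiv ℝ (fderiv ℝ (comp l f)) x.1 (Pi.single i 1) (Pi.single j 1) := by
    intro i j
    rw [dual_evenDeriv_eq (u := fun y => fderiv ℝ (comp l f) y (Pi.single j 1))
      fun y hy => dual_evenDeriv l j f ⟨y, hy⟩, fderiv_clm_apply]
    · simp
    · exact ((contDiffAt_comp l f x).fderiv_right (m := 1) (by norm_cast)).differentiableAt
        (by simp)
    · exact differentiableAt_const _
  rw [h1, h1]
  exact (contDiffAt_comp l f x).isSymmSndFDerivAt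
    (by rw [minSmoothness_of_isRCLikeNormedField]; norm_cast) _ _

theorem evenDeriv_add (i : ι) (f g : SuperFun κ V) :
    evenDeriv i (f + g) = evenDeriv i f + evenDeriv i g := by
  refine ext_dual fun x l => ?_
  rw [dual_evenDeriv_eq (u := fun y => comp l f y + comp l g y) fun y hy => by
    rw [comp_apply l f ⟨y, hy⟩, comp_apply l g ⟨y, hy⟩]; exact map_add l _ _,
    fderiv_fun_add (differentiableAt_comp l f x) (differentiableAt_comp l g x)]
  change _ = l ((evenDeriv i f).1 x + (evenDeriv i g).1 x)
  rw [map_add, dual_evenDeriv, dual_evenDeriv]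
  rfl

theorem evenDeriv_smul (i : ι) (r : ℝ) (f : SuperFun κ V) :
    evenDeriv i (r • f) = r • evenDeriv i f := by
  refine ext_dual fun x l => ?_
  rw [dual_evenDeriv_eq (u := fun y => r • comp l f y) fun y hy => by
    rw [comp_apply l f ⟨y, hy⟩]; exact map_smul l _ _,
    fderiv_fun_const_smul (differentiableAt_comp l f x)]
  change _ = l (r • (evenDeriv i f).1 x)
  rw [map_smul, dual_evenDeriv]
  rfl

theorem evenDeriv_const (i : ι) (c : Grassmann κ) (f : SuperFun κ V) (hf : ∀ x, f.1 x = c) :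
    evenDeriv i f = 0 := by
  refine ext_dual fun x l => ?_
  rw [dual_evenDeriv_eq (u := fun _ => l c) fun y hy => by rw [hf]]
  simp

variable (V) in
/-- The partial derivatives as linear maps. -/
def pdLin (a : ι ⊕ κ) : SuperFun κ V →ₗ[ℝ] SuperFun κ V where
  toFun := pd a
  map_add' f g := by
    rcases a with i | j
    · exact evenDeriv_add i f g
    · exact Subtype.ext (funext fun x => map_add _ _ _)
  map_smul' r f := by
    rcases a with i | j
    · exact evenDeriv_smul i r f
    · refine Subtype.ext (funext fun x => ?_)
      change CliffordAlgebra.contractLeft _ (r • f.1 x) = r • CliffordAlgebra.contractLeft _ (f.1 x)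
      exact map_smul _ _ _

omit [DecidableEq ι] in
theorem mem_parity_iff {i : ZMod 2} {f : SuperFun κ V} :
    f ∈ parity V i ↔ invol f = sgn i • f := by
  constructor
  · exact fun h => Subtype.ext (funext fun x => involute_of_mem (h x))
  · intro h x
    exact mem_of_involute (congrFun (congrArg Subtype.val h) x)

theorem pd_mem {i : ZMod 2} {f : SuperFun κ V} (a : ι ⊕ κ) (hf : f ∈ parity V i) :
    pd a f ∈ parity V (i + par a) := by
  rcases a with k | j
  · change evenDeriv k f ∈ parity V (i + 0)
    rw [add_zero, mem_parity_iff]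
    change mapLin CliffordAlgebra.involute.toLinearMap _ = _
    rw [← evenDeriv_mapLin, ← evenDeriv_smul, ← mem_parity_iff.1 hf]
    rfl
  · intro x
    change CliffordAlgebra.contractLeft _ (f.1 x) ∈ grassmannParity κ (i + 1)
    rw [mem_grassmannParity_iff, involute_contractLeft, involute_of_mem (hf x), map_smul, sgn_add,
      sgn_one, mul_neg_one, neg_smul]

/-- Superfunctions on a superdomain with their partial derivatives are a super calculus. -/
theorem isSuperCalculus (V : Opens (ι → ℝ)) :
    IsSuperCalculus (parity (κ := κ) V) par (pdLin V) where
  one_mem := fun x => CliffordAlgebra.one_le_evenOdd_zero (0 : QuadraticForm ℝ (κ → ℝ))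
    (Submodule.one_le.1 le_rfl)
  mul_mem := fun hf hg x => CliffordAlgebra.evenOdd_mul_le _ _ _
    (Submodule.mul_mem_mul (hf x) (hg x))
  comm := fun hf hg => Subtype.ext (funext fun x => grassmann_comm (hf x) (hg x))
  d_mem := pd_mem
  leibniz := by
    intro i f a hf g
    rcases a with k | j
    · change evenDeriv k (f * g) = evenDeriv k f * g + sgn (0 * i) • (f * evenDeriv k g)
      rw [evenDeriv_mul, zero_mul, sgn_zero, one_smul]
    · refine Subtype.ext (funext fun x => ?_)
      change CliffordAlgebra.contractLeft _ (f.1 x * g.1 x) =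
        (oddDeriv j f * g + sgn (1 * i) • (f * oddDeriv j g)).1 x
      rw [contractLeft_mul, involute_of_mem (hf x), smul_mul_assoc, one_mul]
      rfl
  d_comm := by
    rintro (i | i) (j | j) f
    · change evenDeriv i (evenDeriv j f) = sgn (0 * 0) • evenDeriv j (evenDeriv i f)
      rw [mul_zero, sgn_zero, one_smul, evenDeriv_evenDeriv]
    · change evenDeriv i (oddDeriv j f) = sgn (0 * 1) • oddDeriv j (evenDeriv i f)
      rw [zero_mul, sgn_zero, one_smul]
      exact evenDeriv_mapLin _ i f
    · change oddDeriv i (evenDeriv j f) = sgn (1 * 0) • evenDeriv j (oddDeriv i f)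
      rw [mul_zero, sgn_zero, one_smul]
      exact (evenDeriv_mapLin _ j f).symm
    · change oddDeriv i (oddDeriv j f) = sgn (1 * 1) • oddDeriv j (oddDeriv i f)
      rw [mul_one, sgn_one, neg_one_smul]
      exact Subtype.ext (funext fun x => CliffordAlgebra.contractLeft_comm _ _ _)

theorem pd_congr {W : Opens (ι → ℝ)} (hW : W ≤ V) {f g : SuperFun κ V}
    (h : restrict hW f = restrict hW g) (a : ι ⊕ κ) :
    restrict hW (pd a f) = restrict hW (pd a g) := by
  rcases a with i | j
  · exact evenDeriv_congr hW h i
  · exact congrArg (oddDeriv j) h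

variable [DecidableEq κ]

theorem coord_mem (a : ι ⊕ κ) : coord V a ∈ parity V (par a) := by
  rcases a with i | j
  · intro x
    change algebraMap ℝ (Grassmann κ) (x.1 i) ∈ _
    rw [Algebra.algebraMap_eq_smul_one]
    exact Submodule.smul_mem _ _ ((isSuperCalculus V).one_mem x)
  · exact fun x => CliffordAlgebra.ι_mem_evenOdd_one _ _

theorem pd_coord (a b : ι ⊕ κ) : pd a (coord V b) = if a = b then 1 else 0 := by
  rcases a with i | i <;> rcases b with j | j
  · refine ext_dual fun x l => ?_
    change l ((evenDeriv i (coord V (Sum.inl j))).1 x) = _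
    have h2 : fderiv ℝ (fun y : ι → ℝ => y j) x.1 = ContinuousLinearMap.proj j :=
      (ContinuousLinearMap.proj (R := ℝ) (φ := fun _ : ι => ℝ) j).hasFDerivAt.fderiv
    rw [dual_evenDeriv_eq (u := fun y => y j * l 1) fun y hy => by
      change l (algebraMap ℝ (Grassmann κ) (y j)) = _
      rw [Algebra.algebraMap_eq_smul_one, map_smul, smul_eq_mul],
      fderiv_mul_const (by fun_prop), h2]
    by_cases h : i = j
    · subst h
      simp
    · simp [h, Ne.symm h]
  · change evenDeriv i (coord V (Sum.inr j)) = _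
    rw [evenDeriv_const i (ExteriorAlgebra.ι ℝ (Pi.single j 1)) _ fun _ => rfl]
    simp
  · refine Subtype.ext (funext fun x => ?_)
    change CliffordAlgebra.contractLeft _ (algebraMap ℝ (Grassmann κ) (x.1 j)) = _
    rw [CliffordAlgebra.contractLeft_algebraMap]
    simp
  · refine Subtype.ext (funext fun x => ?_)
    change CliffordAlgebra.contractLeft _ (CliffordAlgebra.ι _ (Pi.single j 1)) = _
    rw [CliffordAlgebra.contractLeft_ι, LinearMap.proj_apply]
    by_cases h : i = j
    · subst h
      simp
    · simp [h]

end Deriv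

end SuperFun


/-! ### The cotangent bundle of a superdomain -/

theorem IsSuperCalculus.reindex {A : Type*} [Ring A] [Algebra ℝ A] {𝒜 : ZMod 2 → Submodule ℝ A}
    {I J : Type*} {p : I → ZMod 2} {d : I → A →ₗ[ℝ] A} (h : IsSuperCalculus 𝒜 p d) (e : J → I) :
    IsSuperCalculus 𝒜 (p ∘ e) (d ∘ e) where
  toIsSupercommutative := h.toIsSupercommutative
  d_mem a hf := h.d_mem (e a) hf
  leibniz a hf g := h.leibniz (e a) hf g
  d_comm a b f := h.d_comm (e a) (e b) f

namespace SuperFun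

variable {ι κ : Type} [Fintype ι] [Fintype κ] {V : Opens (ι → ℝ)}

theorem par_pos {ι κ : Type} (a : ι ⊕ κ) : par (pos a) = par a := by cases a <;> rfl

theorem par_mom {ι κ : Type} (a : ι ⊕ κ) : par (mom a) = par a := by cases a <;> rfl

variable (κ) in
/-- The inclusion of the base Grassmann generators. -/
abbrev inclOdd : (κ → ℝ) →ₗ[ℝ] (κ ⊕ κ → ℝ) :=
  LinearMap.pi (Sum.elim (fun j : κ => LinearMap.proj (R := ℝ) (φ := fun _ : κ => ℝ) j) 0)

variable (V) in
/-- The pullback of functions to the cotangent bundle as an algebra homomorphism. -/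
def pullHom : SuperFun κ V →ₐ[ℝ] SuperFun (κ ⊕ κ) (cot V) where
  toFun := pull
  map_one' := Subtype.ext (funext fun _ => map_one (ExteriorAlgebra.map (inclOdd κ)))
  map_mul' _ _ := Subtype.ext (funext fun _ => map_mul (ExteriorAlgebra.map (inclOdd κ)) _ _)
  map_zero' := Subtype.ext (funext fun _ => map_zero (ExteriorAlgebra.map (inclOdd κ)))
  map_add' _ _ := Subtype.ext (funext fun _ => map_add (ExteriorAlgebra.map (inclOdd κ)) _ _)
  commutes' r := Subtype.ext (funext fun _ => AlgHom.commutes (ExteriorAlgebra.map (inclOdd κ)) r)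

theorem pull_mem {i : ZMod 2} {f : SuperFun κ V} (hf : f ∈ parity V i) :
    pull f ∈ parity (cot V) i := by
  intro z
  have h := hf ⟨z.1 ∘ Sum.inl, z.2⟩
  change ExteriorAlgebra.map (inclOdd κ) _ ∈ grassmannParity (κ ⊕ κ) i
  rw [mem_grassmannParity_iff, involute_map, involute_of_mem h, map_smul]

theorem pull_injective : Function.Injective (pull : SuperFun κ V → SuperFun (κ ⊕ κ) (cot V)) := by
  intro f g h
  have hker : LinearMap.ker (inclOdd κ) = ⊥ := by
    rw [LinearMap.ker_eq_bot]
    intro v w hvw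
    funext j
    exact congrFun hvw (Sum.inl j)
  refine Subtype.ext (funext fun x => ?_)
  have hz : (Sum.elim x.1 0 : ι ⊕ ι → ℝ) ∈ cot V := by
    change Sum.elim x.1 0 ∘ Sum.inl ∈ V
    rw [Sum.elim_comp_inl]
    exact x.2
  have := congrFun (congrArg Subtype.val h) ⟨_, hz⟩
  exact ExteriorAlgebra.map_injective_field hker this

variable [DecidableEq ι]

theorem dual_evenDeriv_pull (l : Module.Dual ℝ (Grassmann (κ ⊕ κ))) (i : ι ⊕ ι) (f : SuperFun κ V)
    (z : cot V) : l ((evenDeriv i (pull f)).1 z) =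
      fderiv ℝ (comp (l ∘ₗ (ExteriorAlgebra.map (inclOdd κ)).toLinearMap) f) (z.1 ∘ Sum.inl)
        ((Pi.single i 1 : ι ⊕ ι → ℝ) ∘ Sum.inl) := by
  set l' := l ∘ₗ (ExteriorAlgebra.map (inclOdd κ)).toLinearMap
  let P : (ι ⊕ ι → ℝ) →L[ℝ] (ι → ℝ) :=
    ContinuousLinearMap.pi fun i => ContinuousLinearMap.proj (Sum.inl i)
  have h1 : HasFDerivAt (comp l' f) (fderiv ℝ (comp l' f) (P z.1)) (P z.1) :=
    (differentiableAt_comp l' f ⟨z.1 ∘ Sum.inl, z.2⟩).hasFDerivAt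
  rw [dual_evenDeriv_eq (u := comp l' f ∘ P) fun y hy =>
    (comp_apply l' f ⟨y ∘ Sum.inl, hy⟩).symm, (h1.comp z.1 P.hasFDerivAt).fderiv]
  rfl

theorem pd_pos_pull (a : ι ⊕ κ) (f : SuperFun κ V) : pd (pos a) (pull f) = pull (pd a f) := by
  rcases a with i | j
  · refine ext_dual fun z l => ?_
    have h : ((Pi.single (Sum.inl i) 1 : ι ⊕ ι → ℝ) ∘ Sum.inl) = Pi.single i 1 := by
      funext k
      simp [Pi.single_apply]
    change l ((evenDeriv (Sum.inl i) (pull f)).1 z) = _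
    rw [dual_evenDeriv_pull, h]
    exact (dual_evenDeriv (l ∘ₗ (ExteriorAlgebra.map (inclOdd κ)).toLinearMap) i f
      ⟨z.1 ∘ Sum.inl, z.2⟩).symm
  · refine Subtype.ext (funext fun z => ?_)
    exact contractLeft_map (inclOdd κ) _ _

theorem pd_mom_pull (a : ι ⊕ κ) (f : SuperFun κ V) : pd (mom a) (pull f) = 0 := by
  rcases a with i | j
  · refine ext_dual fun z l => ?_
    have h : ((Pi.single (Sum.inr i) 1 : ι ⊕ ι → ℝ) ∘ Sum.inl) = 0 := by
      funext k
      simp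
    change l ((evenDeriv (Sum.inr i) (pull f)).1 z) = l 0
    rw [dual_evenDeriv_pull, h, map_zero, map_zero]
  · refine Subtype.ext (funext fun z => ?_)
    refine (contractLeft_map (inclOdd κ) _ _).trans ?_
    have h : LinearMap.proj (R := ℝ) (φ := fun _ : κ ⊕ κ => ℝ) (Sum.inr j) ∘ₗ inclOdd κ = 0 := rfl
    rw [h, map_zero, LinearMap.zero_apply, map_zero]
    rfl

variable [DecidableEq κ]

/-- The cotangent bundle of a superdomain, with the coordinates `p_a`. -/
theorem isCotangent (V : Opens (ι → ℝ)) :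
    IsCotangent (parity (κ := κ) V) (parity (cot V)) par (pdLin V)
      (fun a => pdLin (cot V) (pos a)) (fun a => pdLin (cot V) (mom a)) (pullHom V)
      (fun a => coord (cot V) (mom a)) where
  base := isSuperCalculus V
  total := by
    have := (isSuperCalculus (κ := κ ⊕ κ) (cot V)).reindex (Sum.elim pos mom)
    rw [Sum.comp_elim, Sum.comp_elim] at this
    convert this using 2
    · exact funext fun a => (par_pos a).symm
    · exact funext fun a => (par_mom a).symm
    · rfl
    · rfl
  pull_mem := pull_mem
  pull_injective := pull_injective
  mom_mem a := by
    rw [← par_mom a]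
    exact coord_mem (mom a)
  dx_pull := pd_pos_pull
  dp_pull := pd_mom_pull
  dx_mom a b := by
    refine (pd_coord (pos a) (mom b)).trans (if_neg ?_)
    rcases a with a | a <;> rcases b with b | b <;> simp [pos, mom]
  dp_mom a b := by
    refine (pd_coord (mom a) (mom b)).trans ?_
    congr 1
    rcases a with a | a <;> rcases b with b | b <;> simp [mom]

omit [DecidableEq κ] in
/-- The Poisson bracket with an odd function is its Hamiltonian vector field. -/
theorem poisson_eq_hamilton {s : SuperFun (κ ⊕ κ) (cot V)} (hs : s ∈ parity (cot V) 1)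
    (F : SuperFun (κ ⊕ κ) (cot V)) : poisson s F = hamilton par
      (fun a => pdLin (cot V) (pos a)) (fun a => pdLin (cot V) (mom a)) s F := by
  refine Finset.sum_congr rfl fun a _ => ?_
  have ht : twist a s = sgn (par a) • s := by
    rw [twist]
    split_ifs with h
    · rw [h, sgn_zero, one_smul]
    · rw [mem_parity_iff.1 hs, (zmod_two_cases (par a)).resolve_left h]
  change sgn (par a) • (pdLin (cot V) (mom a) (twist a s) * pdLin (cot V) (pos a) F) -
    pdLin (cot V) (pos a) (twist a s) * pdLin (cot V) (mom a) F = _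
  rw [ht, map_smul, map_smul, smul_mul_assoc, smul_mul_assoc, sgn_smul_smul,
    sgn_smul_eq_self (CharTwo.add_self_eq_zero _)]

omit [DecidableEq ι] in
theorem symbol_eq_quadSymbol (S : ι ⊕ κ → ι ⊕ κ → SuperFun κ V) :
    symbol S = (1 / 2 : ℝ) • quadSymbol (pullHom V) (fun a => coord (cot V) (mom a)) S := rfl

theorem subprincipal_eq_linSymbol (S : ι ⊕ κ → ι ⊕ κ → SuperFun κ V) (T : ι ⊕ κ → SuperFun κ V) :
    subprincipal 1 S T = linSymbol (pullHom V) (fun a => coord (cot V) (mom a))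
      fun a => ∑ b, pdLin V b (S b a) - (2 : ℝ) • T a := by
  have h : (1 : ZMod 2) + 1 = 0 := by decide
  simp only [subprincipal, h, mul_zero, sgn_zero, one_smul]
  rfl

section Odd

variable {S : ι ⊕ κ → ι ⊕ κ → SuperFun κ V} {T : ι ⊕ κ → SuperFun κ V}
  (hS : ∀ a b, S a b ∈ parity V (par a + par b + 1))
  (hSs : ∀ a b, S a b = sgn (par a * par b) • S b a) (hT : ∀ a, T a ∈ parity V (par a + 1))

include hS hSs in
/-- The master equation `(S, S) = 0` in coordinates. -/
theorem poisson_symbol_symbol_eq_zero_iff : poisson (symbol S) (symbol S) = 0 ↔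
    ∀ b c e, cyc₃ par (cubicCoeff par (pdLin V) S) b c e = 0 :=
  (isCotangent (κ := κ) V).master_iff hS hSs (fun _ hs F => poisson_eq_hamilton hs F)
    (symbol_eq_quadSymbol S)

include hS hSs hT in
/-- The equation `(S, γ) = 0` in coordinates, for a solution of the master equation. -/
theorem poisson_symbol_subprincipal_eq_zero_iff (h0 : poisson (symbol S) (symbol S) = 0) :
    poisson (symbol S) (subprincipal 1 S T) = 0 ↔
      ∀ a b, cyc₂ par (quadCoeff par (pdLin V) S T) a b = 0 :=
  (isCotangent (κ := κ) V).flat_iff hS hSs hT (fun _ hs F => poisson_eq_hamilton hs F)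
    (symbol_eq_quadSymbol S) (subprincipal_eq_linSymbol S T) h0

include hS in
theorem poisson_symbol_poisson_symbol (h0 : poisson (symbol S) (symbol S) = 0)
    (F : SuperFun (κ ⊕ κ) (cot V)) : poisson (symbol S) (poisson (symbol S) F) = 0 :=
  (isCotangent (κ := κ) V).master_sq hS (fun _ hs F => poisson_eq_hamilton hs F)
    (symbol_eq_quadSymbol S) h0 F

end Odd

end SuperFun


/-! ### Functions on a supermanifold in charts -/

namespace SuperFun

variable {ι κ : Type} [Fintype ι] [Fintype κ] {V W : Opens (ι → ℝ)}

/-- Restriction to a smaller open set as an algebra homomorphism. -/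
def restrictHom (h : V ≤ W) : SuperFun κ W →ₐ[ℝ] SuperFun κ V where
  toFun := restrict h
  map_one' := rfl
  map_mul' _ _ := rfl
  map_zero' := rfl
  map_add' _ _ := rfl
  commutes' _ := rfl

theorem mem_parity_of_local {i : ZMod 2} {f : SuperFun κ V}
    (h : ∀ x ∈ V, ∃ W, ∃ hW : W ≤ V, x ∈ W ∧ ∃ g ∈ parity V i, restrict hW f = restrict hW g) :
    f ∈ parity V i := by
  intro x
  obtain ⟨W, hW, hx, g, hg, hfg⟩ := h x.1 x.2
  have : f.1 x = g.1 x := congrFun (congrArg Subtype.val hfg) ⟨x.1, hx⟩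
  rw [this]
  exact hg x

theorem eq_zero_of_local {f : SuperFun κ V}
    (h : ∀ x ∈ V, ∃ W, ∃ hW : W ≤ V, x ∈ W ∧ restrict hW f = 0) : f = 0 := by
  refine Subtype.ext (funext fun x => ?_)
  obtain ⟨W, hW, hx, hf⟩ := h x.1 x.2
  exact congrFun (congrArg Subtype.val hf) ⟨x.1, hx⟩

theorem eq_zero_of_mem_parity {i : ZMod 2} {f : SuperFun κ V} (h0 : f ∈ parity V i)
    (h1 : f ∈ parity V (i + 1)) : f = 0 := by
  have h := (mem_parity_iff.1 h0).symm.trans (mem_parity_iff.1 h1)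
  rw [sgn_add, sgn_one, mul_neg_one, neg_smul] at h
  exact sgn_smul_eq_zero (eq_zero_of_eq_neg h)

/-- A cutoff function: even, equal to `1` near a given point, and vanishing outside a compact
set. -/
theorem exists_cutoff [DecidableEq ι] {x₀ : ι → ℝ} (hx₀ : x₀ ∈ V) : ∃ χ ∈ parity (κ := κ) V 0,
    (∃ K : Set (ι → ℝ), IsCompact K ∧ K ⊆ V ∧ ∀ x : V, x.1 ∉ K → χ.1 x = 0) ∧
    ∃ W, ∃ hW : W ≤ V, x₀ ∈ W ∧ restrict hW χ = 1 := by
  obtain ⟨r, hr, hrV⟩ := Metric.nhds_basis_closedBall.mem_iff.1 (V.isOpen.mem_nhds hx₀)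
  let b : ContDiffBump x₀ := ⟨r / 2, r, half_pos hr, half_lt_self hr⟩
  refine ⟨⟨fun x => algebraMap ℝ (Grassmann κ) (b x.1), IsSmooth.of_formula fun l =>
      ⟨fun x => b x * l 1, b.contDiff.contDiffOn.mul contDiffOn_const, fun x => by
        rw [Algebra.algebraMap_eq_smul_one, map_smul, smul_eq_mul]⟩⟩, ?_,
    ⟨Metric.closedBall x₀ r, isCompact_closedBall x₀ r, hrV, ?_⟩,
    ⟨Metric.ball x₀ (r / 2), Metric.isOpen_ball⟩, ?_, ?_, ?_⟩
  · intro x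
    change algebraMap ℝ (Grassmann κ) (b x.1) ∈ _
    rw [Algebra.algebraMap_eq_smul_one]
    exact Submodule.smul_mem _ _ ((isSuperCalculus V).one_mem x)
  · intro x hx
    change algebraMap ℝ (Grassmann κ) (b x.1) = 0
    rw [b.zero_of_le_dist (not_le.1 hx).le, map_zero]
  · exact fun x hx => hrV (Metric.ball_subset_closedBall (Metric.ball_subset_ball
      (half_le_self hr.le) hx))
  · exact Metric.mem_ball_self (half_pos hr)
  · refine Subtype.ext (funext fun x => ?_)
    change algebraMap ℝ (Grassmann κ) (b x.1) = 1
    rw [b.one_of_mem_closedBall (Metric.ball_subset_closedBall x.2), map_one]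

end SuperFun

theorem res_res {X : TopCat.{u}} (O : TopCat.Sheaf (AlgCat.{u} ℝ) X) {U V W : Opens X} (h : U ≤ V)
    (h' : V ≤ W) (f : O.obj.obj (op W)) : res O h (res O h' f) = res O (h.trans h') f := by
  rw [res, res, res, ← AlgHom.comp_apply, ← AlgCat.hom_comp, ← O.obj.map_comp]
  rfl

namespace Supermanifold

variable {p q : ℕ} {M : Supermanifold.{u} p q}

/-- The local representation as an algebra homomorphism. -/
def Chart.localRepHom (c : M.Chart) :
    M.Functions →ₐ[ℝ] SuperFun (Fin q) (targetOpens c.e) :=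
  (c.iso _ le_rfl).toAlgHom.comp (res M.O le_top)

theorem Chart.localRep_mem (c : M.Chart) {i : ZMod 2} {f : M.Functions}
    (hf : f ∈ M.functionsParity i) : c.localRepHom f ∈ SuperFun.parity (targetOpens c.e) i :=
  c.iso_parity _ _ _ _ (M.res_parity _ _ _ _ _ hf)

/-- A function that vanishes in all charts is zero. -/
theorem eq_zero_of_localRep {f : M.Functions} (h : ∀ c : M.Chart, c.localRepHom f = 0) :
    f = 0 := by
  refine TopCat.Sheaf.eq_of_locally_eq' M.O
    (fun c : M.Chart => overOpens c.e (targetOpens c.e)) ⊤ (fun c => homOfLE le_top) ?_ f 0 ?_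
  · intro x _
    obtain ⟨c, hc⟩ := M.exists_chart x
    exact Opens.mem_iSup.2 ⟨c, hc, c.e.map_source hc⟩
  · intro c
    have h1 : res M.O (le_top : overOpens c.e (targetOpens c.e) ≤ ⊤) f = 0 :=
      (c.iso _ le_rfl).injective ((h c).trans (map_zero _).symm)
    exact h1.trans (map_zero (res M.O (le_top : overOpens c.e (targetOpens c.e) ≤ ⊤))).symm

/-- A superfunction on a coordinate domain that vanishes outside a compact set extends by zero to
the whole supermanifold. -/
theorem Chart.exists_localRep_eq (c : M.Chart) (u : SuperFun (Fin q) (targetOpens c.e))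
    {K : Set (Fin p → ℝ)} (hK : IsCompact K) (hKV : K ⊆ c.e.target)
    (hu : ∀ x : targetOpens c.e, x.1 ∉ K → u.1 x = 0) : ∃ f : M.Functions, c.localRepHom f = u := by
  have := M.t2
  let U₁ := overOpens c.e (targetOpens c.e)
  have hK' : IsClosed (c.e.symm '' K) :=
    (hK.image_of_continuousOn (c.e.continuousOn_symm.mono hKV)).isClosed
  let U₂ : Opens M.X := ⟨(c.e.symm '' K)ᶜ, hK'.isOpen_compl⟩
  let V' : Opens (Fin p → ℝ) := ⟨c.e.target \ K, c.e.open_target.sdiff hK.isClosed⟩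
  have hV' : V' ≤ targetOpens c.e := fun x hx => hx.1
  let s := (c.iso _ le_rfl).symm u
  -- The section `s` with local expression `u` vanishes on the overlap of the coordinate domain
  -- `U₁` with `U₂`, the complement of the closed set corresponding to `K`, so it glues with `0`.
  have hs : res M.O (overOpens_mono c.e hV') s = 0 := by
    refine (c.iso V' hV').injective ?_
    rw [c.iso_res V' _ hV' le_rfl hV', map_zero, AlgEquiv.apply_symm_apply]
    exact Subtype.ext (funext fun x => hu _ x.2.2)
  have hle : U₁ ⊓ U₂ ≤ overOpens c.e V' := fun x hx =>
    ⟨hx.1.1, c.e.map_source hx.1.1, fun hxK => hx.2 ⟨_, hxK, c.e.left_inv hx.1.1⟩⟩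
  have hs' : res M.O (inf_le_left : U₁ ⊓ U₂ ≤ U₁) s = 0 := by
    rw [← res_res M.O hle (overOpens_mono c.e hV'), hs, map_zero]
  let U : Bool → Opens M.X := fun b => bif b then U₁ else U₂
  let sf : ∀ b, M.O.obj.obj (op (U b)) := fun b => match b with
    | true => s
    | false => 0
  have hcover : ⊤ ≤ iSup U := by
    intro x _
    rw [Opens.mem_iSup]
    by_cases hx : x ∈ U₂
    · exact ⟨false, hx⟩
    · obtain ⟨y, hy, rfl⟩ := not_not.1 hx
      refine ⟨true, c.e.map_target (hKV hy), ?_⟩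
      change c.e (c.e.symm y) ∈ c.e.target
      rw [c.e.right_inv (hKV hy)]
      exact hKV hy
  have hcompat : TopCat.Presheaf.IsCompatible M.O.1 U sf := by
    have hs'' : res M.O (inf_le_right : U₂ ⊓ U₁ ≤ U₁) s = 0 := by
      rw [← res_res M.O (le_of_eq (inf_comm _ _) : U₂ ⊓ U₁ ≤ U₁ ⊓ U₂) inf_le_left, hs', map_zero]
    rintro (_ | _) (_ | _)
    · rfl
    · exact (map_zero (res M.O (inf_le_left : U₂ ⊓ U₁ ≤ U₂))).trans hs''.symm
    · exact hs'.trans (map_zero (res M.O (inf_le_right : U₁ ⊓ U₂ ≤ U₂))).symm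
    · rfl
  obtain ⟨f, hf, -⟩ :=
    TopCat.Sheaf.existsUnique_gluing' M.O U ⊤ (fun b => homOfLE le_top) hcover sf hcompat
  refine ⟨f, ?_⟩
  have h1 : res M.O (le_top : U₁ ≤ ⊤) f = s := hf true
  change c.iso _ le_rfl (res M.O (le_top : U₁ ≤ ⊤) f) = u
  rw [h1, AlgEquiv.apply_symm_apply]

/-- The component of parity `i`. -/
theorem exists_mem_parity_sub (f : M.Functions) (i : ZMod 2) :
    ∃ g ∈ M.functionsParity i, f - g ∈ M.functionsParity (i + 1) := by
  have htop : f ∈ ⨆ j, M.functionsParity j := by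
    rw [(M.isInternal ⊤).submodule_iSup_eq_top]
    trivial
  induction htop using Submodule.iSup_induction' with
  | mem j f hf =>
    rcases zmod_two_cases (j - i) with h | h
    · rw [sub_eq_zero] at h
      exact ⟨f, h ▸ hf, by rw [sub_self]; exact Submodule.zero_mem _⟩
    · refine ⟨0, Submodule.zero_mem _, ?_⟩
      rw [sub_zero, ← h, add_sub_cancel]
      exact hf
  | zero => exact ⟨0, Submodule.zero_mem _, by rw [sub_zero]; exact Submodule.zero_mem _⟩
  | add f g _ _ hf hg =>
    obtain ⟨f', hf', h1⟩ := hf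
    obtain ⟨g', hg', h2⟩ := hg
    exact ⟨f' + g', Submodule.add_mem _ hf' hg', by
      rw [add_sub_add_comm]; exact Submodule.add_mem _ h1 h2⟩

/-- Near each point, the coordinates of a chart are the restrictions of global functions. -/
theorem Chart.exists_coord (c : M.Chart) {x₀ : Fin p → ℝ} (hx₀ : x₀ ∈ targetOpens c.e) :
    ∃ W, ∃ hW : W ≤ targetOpens c.e, x₀ ∈ W ∧ ∃ F : Fin p ⊕ Fin q → M.Functions,
      (∀ a, F a ∈ M.functionsParity (par a)) ∧
      ∀ a, SuperFun.restrict hW (c.localRepHom (F a)) =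
        SuperFun.restrict hW (SuperFun.coord _ a) := by
  obtain ⟨χ, hχ, ⟨K, hK, hKV, hχK⟩, W, hW, hxW, hχW⟩ := SuperFun.exists_cutoff (κ := Fin q) hx₀
  have key : ∀ a, ∃ f ∈ M.functionsParity (par a),
      c.localRepHom f = χ * SuperFun.coord (targetOpens c.e) a := by
    intro a
    obtain ⟨f, hf⟩ := c.exists_localRep_eq (χ * SuperFun.coord (targetOpens c.e) a) hK hKV
      fun x hx => (congrArg (· * _) (hχK x hx)).trans (zero_mul _)
    -- The extension by zero need not be homogeneous a priori, but its component of the right parity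
    -- has the same local expression.
    obtain ⟨g, hg, hfg⟩ := exists_mem_parity_sub f (par a)
    refine ⟨g, hg, ?_⟩
    rw [← hf, eq_comm, ← sub_eq_zero, ← map_sub]
    refine SuperFun.eq_zero_of_mem_parity (i := par a) ?_ (c.localRep_mem hfg)
    rw [map_sub, hf]
    refine Submodule.sub_mem _ ?_ (c.localRep_mem hg)
    have := (SuperFun.isSuperCalculus _).mul_mem hχ (SuperFun.coord_mem a)
    rwa [zero_add] at this
  choose F hF hFx using key
  refine ⟨W, hW, hxW, F, hF, fun a => ?_⟩
  rw [hFx a]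
  exact (congrArg (· * SuperFun.restrict hW (SuperFun.coord _ a)) hχW).trans (one_mul _)

end Supermanifold


/-! ### Operators in charts -/

namespace Supermanifold

variable {p q : ℕ} {M : Supermanifold.{u} p q}

variable (M) in
theorem isSupercommutative : IsSupercommutative M.functionsParity where
  one_mem := (M.gradedMonoid ⊤).one_mem
  mul_mem hf hg := (M.gradedMonoid ⊤).mul_mem hf hg
  comm hf hg := M.supercomm ⊤ _ _ _ hf _ hg

variable (M) in
theorem mem_iSup_functionsParity (f : M.Functions) : f ∈ ⨆ i, M.functionsParity i := by
  rw [(M.isInternal ⊤).submodule_iSup_eq_top]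
  trivial

namespace SecondOrderOperator

variable {Δ : M.SecondOrderOperator}

variable (Δ) in
/-- The operator without its zeroth-order term in a chart. -/
abbrev localOp (c : M.Chart) :
    SuperFun (Fin q) (targetOpens c.e) →ₗ[ℝ] SuperFun (Fin q) (targetOpens c.e) :=
  secondOrder (SuperFun.pdLin (targetOpens c.e)) (Δ.expr c).S (Δ.expr c).T

/-- The zeroth-order term vanishes, since `Δ 1 = 0`. -/
theorem localRep_apply (hone : Δ.toLin 1 = 0) (c : M.Chart) (f : M.Functions) :
    c.localRepHom (Δ.toLin f) = Δ.localOp c (c.localRepHom f) := by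
  have key : ∀ f, c.localRepHom (Δ.toLin f) = Δ.localOp c (c.localRepHom f) +
      (Δ.expr c).R * c.localRepHom f := by
    intro f
    rw [secondOrder_apply]
    exact (Δ.expr c).eq f
  have hR : (Δ.expr c).R = 0 := by
    have h1 := key 1
    rw [hone, map_zero, map_one, (SuperFun.isSuperCalculus _).secondOrder_one, zero_add,
      mul_one] at h1
    exact h1.symm
  rw [key, hR, zero_mul, add_zero]

section Coefficients

variable (hodd : HasParity M.functionsParity 1 Δ.toLin) (hone : Δ.toLin 1 = 0) (c : M.Chart)

include hodd hone in
/-- The coefficients `T^a` of an odd operator have parity `ã + 1`. -/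
theorem firstCoeff_mem (a : Fin p ⊕ Fin q) :
    (Δ.expr c).T a ∈ SuperFun.parity (targetOpens c.e) (par a + 1) := by
  refine SuperFun.mem_parity_of_local fun x₀ hx₀ => ?_
  obtain ⟨W, hW, hxW, F, hF, hFx⟩ := c.exists_coord hx₀
  obtain ⟨g, hg, h⟩ := (SuperFun.isSuperCalculus (targetOpens c.e)).exists_map_eq_firstCoeff
    (ρ := SuperFun.restrictHom hW) (x := SuperFun.coord (targetOpens c.e))
    (fun a b => SuperFun.pd_coord a b) hodd (localRep_apply hone c)
    (fun a f g h => SuperFun.pd_congr hW h a) hF hFx a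
  exact ⟨W, hW, hxW, _, c.localRep_mem hg, h.symm⟩

include hodd hone in
/-- The coefficients `S^{ab}` of an odd operator have parity `ã + b̃ + 1`. -/
theorem secondCoeff_mem (a b : Fin p ⊕ Fin q) :
    (Δ.expr c).S a b ∈ SuperFun.parity (targetOpens c.e) (par a + par b + 1) := by
  refine SuperFun.mem_parity_of_local fun x₀ hx₀ => ?_
  obtain ⟨W, hW, hxW, F, hF, hFx⟩ := c.exists_coord hx₀
  obtain ⟨g, hg, h⟩ := (SuperFun.isSuperCalculus (targetOpens c.e)).exists_map_eq_secondCoeff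
    (Δ.expr c).symm (ρ := SuperFun.restrictHom hW) (x := SuperFun.coord (targetOpens c.e))
    (fun a => SuperFun.coord_mem a) (fun a b => SuperFun.pd_coord a b) M.isSupercommutative hodd
    (localRep_apply hone c) (fun a f g h => SuperFun.pd_congr hW h a) hF hFx a b
  exact ⟨W, hW, hxW, _, c.localRep_mem hg, h.symm⟩

include hodd hone in
theorem cyc₃_eq_zero (hJ : Jacobi3 M.functionsParity Δ.toLin) (a b e : Fin p ⊕ Fin q) :
    cyc₃ par (cubicCoeff par (SuperFun.pdLin (targetOpens c.e)) (Δ.expr c).S) a b e = 0 := by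
  refine SuperFun.eq_zero_of_local fun x₀ hx₀ => ?_
  obtain ⟨W, hW, hxW, F, hF, hFx⟩ := c.exists_coord hx₀
  exact ⟨W, hW, hxW, (SuperFun.isSuperCalculus (targetOpens c.e)).map_cyc₃_eq_zero
    (secondCoeff_mem hodd hone c) (Δ.expr c).symm (firstCoeff_mem hodd hone c)
    (x := SuperFun.coord (targetOpens c.e))
    (fun a => SuperFun.coord_mem a) (fun a b => SuperFun.pd_coord a b)
    (localRep_apply hone c) (ρ := SuperFun.restrictHom hW)
    (fun a f g h => SuperFun.pd_congr hW h a) hF hFx hJ a b e⟩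

include hodd hone in
theorem cyc₂_eq_zero (hJ : Jacobi2 M.functionsParity Δ.toLin) (a b : Fin p ⊕ Fin q) :
    cyc₂ par (quadCoeff par (SuperFun.pdLin (targetOpens c.e)) (Δ.expr c).S (Δ.expr c).T) a b =
      0 := by
  refine SuperFun.eq_zero_of_local fun x₀ hx₀ => ?_
  obtain ⟨W, hW, hxW, F, hF, hFx⟩ := c.exists_coord hx₀
  exact ⟨W, hW, hxW, (SuperFun.isSuperCalculus (targetOpens c.e)).map_cyc₂_eq_zero
    (secondCoeff_mem hodd hone c) (Δ.expr c).symm (firstCoeff_mem hodd hone c)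
    (x := SuperFun.coord (targetOpens c.e))
    (fun a => SuperFun.coord_mem a) (fun a b => SuperFun.pd_coord a b)
    (localRep_apply hone c) (ρ := SuperFun.restrictHom hW)
    (fun a f g h => SuperFun.pd_congr hW h a) hF hFx hJ a b⟩

include hodd hone in
theorem symbolMasterEq_iff : Δ.SymbolMasterEq ↔ ∀ c : M.Chart, ∀ a b e,
    cyc₃ par (cubicCoeff par (SuperFun.pdLin (targetOpens c.e)) (Δ.expr c).S) a b e = 0 :=
  forall_congr' fun c => SuperFun.poisson_symbol_symbol_eq_zero_iff (secondCoeff_mem hodd hone c)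
    (Δ.expr c).symm

include hodd hone in
theorem flatEq_iff (h0 : Δ.SymbolMasterEq) : Δ.FlatEq ↔ ∀ c : M.Chart, ∀ a b,
    cyc₂ par (quadCoeff par (SuperFun.pdLin (targetOpens c.e)) (Δ.expr c).S (Δ.expr c).T) a b =
      0 :=
  forall_congr' fun c => SuperFun.poisson_symbol_subprincipal_eq_zero_iff
    (secondCoeff_mem hodd hone c) (Δ.expr c).symm (firstCoeff_mem hodd hone c) (h0 c)

omit c in
/-- The order of an operator can be estimated in charts. -/
theorem ordLE_of_local {N : ℕ} {ε : ZMod 2} {L : M.Functions →ₗ[ℝ] M.Functions}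
    {Lc : ∀ c : M.Chart,
      SuperFun (Fin q) (targetOpens c.e) →ₗ[ℝ] SuperFun (Fin q) (targetOpens c.e)}
    (hL : ∀ c f, c.localRepHom (L f) = Lc c (c.localRepHom f))
    (h : ∀ c : M.Chart, OrdLE (SuperFun.parity (targetOpens c.e)) N ε (Lc c)) :
    OrdLE M.functionsParity N ε L :=
  CommutatorsVanish.of_intertwine (B := fun c : M.Chart => SuperFun (Fin q) (targetOpens c.e))
    (ℬ := fun c : M.Chart => SuperFun.parity (targetOpens c.e)) (fun c : M.Chart => c.localRepHom)
    (fun c _ _ hf => c.localRep_mem hf) (fun _ => eq_zero_of_localRep) hL h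

theorem localRep_sq (hone : Δ.toLin 1 = 0) (c : M.Chart) (f : M.Functions) :
    c.localRepHom ((Δ.toLin ∘ₗ Δ.toLin) f) =
      (Δ.localOp c ∘ₗ Δ.localOp c) (c.localRepHom f) := by
  rw [LinearMap.comp_apply, localRep_apply hone, localRep_apply hone]
  rfl

include hodd hone in
theorem ordLE_two : OrdLE M.functionsParity 2 1 Δ.toLin :=
  ordLE_of_local (localRep_apply hone) fun c =>
    (SuperFun.isSuperCalculus (targetOpens c.e)).ordLE_secondOrder
      (secondCoeff_mem hodd hone c) (firstCoeff_mem hodd hone c)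

end Coefficients

end SecondOrderOperator

end Supermanifold

end SuperGeom
end

open SuperGeom SuperGeom.Supermanifold SuperGeom.Supermanifold.SecondOrderOperator in
theorem theorem3p1 {p q : ℕ} (M : SuperGeom.Supermanifold.{u} p q)
    (Δ : M.SecondOrderOperator)
    (hodd : SuperGeom.HasParity M.functionsParity 1 Δ.toLin)
    (hone : Δ.toLin 1 = 0) :
    (SuperGeom.OrdLE M.functionsParity 2 0 (Δ.toLin ∘ₗ Δ.toLin) ↔
      SuperGeom.Jacobi3 M.functionsParity Δ.toLin) ∧
    (SuperGeom.Jacobi3 M.functionsParity Δ.toLin ↔ Δ.SymbolMasterEq) ∧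
    (Δ.SymbolMasterEq → ∀ (c : M.Chart) F, Δ.D c (Δ.D c F) = 0) ∧
    (SuperGeom.OrdLE M.functionsParity 1 0 (Δ.toLin ∘ₗ Δ.toLin) ↔
      SuperGeom.Jacobi3 M.functionsParity Δ.toLin ∧
        SuperGeom.Jacobi2 M.functionsParity Δ.toLin) ∧
    (SuperGeom.Jacobi3 M.functionsParity Δ.toLin ∧
        SuperGeom.Jacobi2 M.functionsParity Δ.toLin ↔
      Δ.SymbolMasterEq ∧ Δ.FlatEq) := by
  have hord2 := ordLE_two_sq_iff M.isSupercommutative M.mem_iSup_functionsParity hodd hone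
    (ordLE_two hodd hone)
  have hord1 := ordLE_one_sq_iff M.isSupercommutative M.mem_iSup_functionsParity hodd hone
    (ordLE_two hodd hone)
  have hmaster := symbolMasterEq_iff hodd hone
  have hJ3 : Jacobi3 M.functionsParity Δ.toLin → Δ.SymbolMasterEq := fun hJ =>
    hmaster.2 fun c => cyc₃_eq_zero hodd hone c hJ
  refine ⟨hord2, ⟨hJ3, fun h => ?_⟩, fun h c F => ?_, hord1, fun h => ?_, fun h => ?_⟩
  · exact hord2.1 (ordLE_of_local (localRep_sq hone) fun c =>
      (SuperFun.isSuperCalculus (targetOpens c.e)).ordLE_two_sq (secondCoeff_mem hodd hone c)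
        (Δ.expr c).symm (firstCoeff_mem hodd hone c) (hmaster.1 h c))
  · exact SuperFun.poisson_symbol_poisson_symbol (secondCoeff_mem hodd hone c) (h c) F
  · exact ⟨hJ3 h.1, (flatEq_iff hodd hone (hJ3 h.1)).2 fun c => cyc₂_eq_zero hodd hone c h.2⟩
  · exact hord1.1 (ordLE_of_local (localRep_sq hone) fun c =>
      (SuperFun.isSuperCalculus (targetOpens c.e)).ordLE_one_sq (secondCoeff_mem hodd hone c)
        (Δ.expr c).symm (firstCoeff_mem hodd hone c) (hmaster.1 h.1 c)
        ((flatEq_iff hodd hone h.1).1 h.2 c))
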